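/- Let $k\ge 1$ be a fixed integer, let $0<\varepsilon<\frac1{k+1}$, and let $\omega(n)$ be a real sequence with $\omega(n)\to\infty$. Suppose that $p=p(n)\in[0,1]$ satisfies, for all large $n$, $$\left(\frac{2\ln n+\omega(n)}{n^{k+1}}\right)^{1/(k+2)}=p<\left(\left(\frac1{k+1}-\varepsilon\right)\frac{\ln n}{n^k}\right)^{1/(k+1)}.$$ For a set $\mathcal Q\subset\binom{[n]}{2}$, a graph $G$ on $[n]=\{1,\dots,n\}$ is called $\mathcal Q$-reconstructible if every graph $G'$ on $[n]$ with $d_{G'}(x,y)=d_G(x,y)$ for all $\{x,y\}\in\mathcal Q$ equals $G$, where $d$ is the graph distance ($\infty$ between different components). Then there is no sequence of sets $\mathcal Q=\mathcal Q(n)\subset\binom{[n]}{2}$ such that, for all large $n$, $$|\mathcal Q(n)|\le\frac{1}{8(k+1)^2n^{k-2}p^k}\,e^{n^kp^{k+1}}\ln n,$$ and such that the binomial random graph $G(n,p)$ is $\mathcal Q(n)$-reconstructible with high probability, that is, with probability tending to $1$ as $n\to\infty$. -/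

import Mathlib

open Filter Topology unitInterval

/-- A set `Q` of queried pairs reconstructs the graph `G` if `G` is the only graph on its vertex set
with the distances `d_G(x, y)`, `{x, y} ∈ Q`. Distances are extended: two vertices in different
components are at distance `⊤`. -/
def Reconstructs {V : Type*} (Q : Set (Sym2 V)) (G : SimpleGraph V) : Prop :=
  ∀ G' : SimpleGraph V, (∀ x y : V, s(x, y) ∈ Q → G'.edist x y = G.edist x y) → G' = G

/-- With high probability, the binomial random graph `G(n, p n)` on `n` labelled vertices has the
property `E n`: the probability tends to `1` as `n → ∞`. -/
def WithHighProbability (p : ℕ → I) (E : (n : ℕ) → Set (SimpleGraph (Fin n))) : Prop :=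
  Tendsto (fun n : ℕ => SimpleGraph.binomialRandom (Fin n) (p n) (E n)) atTop (𝓝 1)

/-!
Write `λ = n ^ k * p ^ (k + 1)`, the expected number of paths of length `k + 1` between two given
vertices, up to lower order terms. For all large `n`, *every* set `Q` of at most the given number of
pairs reconstructs `G(n, p)` with probability at most `9 / 10`. The random graph is treated as a
`p`-random subset of `Sym2 (Fin n)`, whose diagonal elements are ignored
(`RandomSubset.binomialRandom_toReal`), so that all probabilities are finite sums.

The lower bound on `p` makes the number of paths of length `k + 2` between two vertices concentrate,
and Janson's inequality (`RandomSubset.prob_forall_not_subset_le`, `RandomSubset.prob_lt_edist_le`)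
shows that with high probability all distances between queried pairs are at most `k + 2`
(`RandomSubset.eventually_prob_exists_far_le`). There are two cases.

* If `λ ≥ 1 / 2`, the argument is one of entropy. The distance of two given vertices is `k + 1`,
  except with probability about `exp (-λ)`; as `|Q|` is of order `exp λ` times a factor, only few
  queried distances differ from `k + 1`, and the vector of queried distances takes few values. A
  reconstructible graph is determined by this vector, so there are few reconstructible graphs of this
  kind (`RandomSubset.card_reconstructs_mul_le`), and each single graph with about the expected number
  of edges has a very small probability. This gives
  `RandomSubset.eventually_prob_reconstructs_le_of_half_le`.

* If `λ < 1 / 2`, a non-edge `xy` is exhibited whose addition changes no queried distance. If no queried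
  pair `uv` satisfies `d(u, x) + d(v, y) ≤ k`, in either order, then a path through the new edge `xy`
  between queried vertices has length at least `k + 2`, and so cannot be shorter than an existing
  shortest path (`RandomSubset.Uncovered.not_reconstructs`). Since `Q` is small, there are many disjoint
  pairs `xy` that are not queried and contain only vertices in few queried pairs
  (`RandomSubset.eventually_exists_disjoint_pairs`). Conditionally on the graph outside the edges at
  `x` and `y`, being uncovered is an intersection of decreasing events, so Harris' inequality bounds
  its probability from below (`RandomSubset.exp_mul_prob_fiber_le`). Measuring distances in the graph
  outside all chosen vertices makes the pairs independent, and with probability close to `1` one of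
  them is uncovered (`RandomSubset.prob_forall_not_uncovered_le`). This gives
  `RandomSubset.eventually_prob_reconstructs_le_of_lt_half`.
-/

/-! ### Random subsets of a finite set -/

namespace RandomSubset

variable {ι : Type*} [Fintype ι] [DecidableEq ι]

/-- The probability that the `p`-random subset of `ι`, which contains each element independently with
probability `p`, equals `s`. -/
noncomputable def weight (p : ℝ) (s : Finset ι) : ℝ := ∏ e, if e ∈ s then p else 1 - p

/-- The expectation of `f` at a `p`-random subset of `ι`. -/
noncomputable def expect (p : ℝ) (f : Finset ι → ℝ) : ℝ := ∑ s, weight p s * f s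

/-- The probability that a `p`-random subset of `ι` belongs to `A`. -/
noncomputable def prob (p : ℝ) (A : Set (Finset ι)) : ℝ := expect p (A.indicator 1)

variable {p : ℝ}

lemma weight_nonneg (h0 : 0 ≤ p) (h1 : p ≤ 1) (s : Finset ι) : 0 ≤ weight p s :=
  Finset.prod_nonneg fun e _ => by split_ifs <;> linarith

lemma expect_mono (h0 : 0 ≤ p) (h1 : p ≤ 1) {f g : Finset ι → ℝ} (h : ∀ s, f s ≤ g s) :
    expect p f ≤ expect p g :=
  Finset.sum_le_sum fun s _ => mul_le_mul_of_nonneg_left (h s) (weight_nonneg h0 h1 s)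

lemma expect_nonneg (h0 : 0 ≤ p) (h1 : p ≤ 1) {f : Finset ι → ℝ} (h : ∀ s, 0 ≤ f s) :
    0 ≤ expect p f :=
  Finset.sum_nonneg fun s _ => mul_nonneg (weight_nonneg h0 h1 s) (h s)

lemma expect_add (f g : Finset ι → ℝ) :
    expect p (fun s => f s + g s) = expect p f + expect p g := by
  simp [expect, mul_add, Finset.sum_add_distrib]

lemma expect_const_mul (c : ℝ) (f : Finset ι → ℝ) :
    expect p (fun s => c * f s) = c * expect p f := by
  simp only [expect, Finset.mul_sum]
  exact Finset.sum_congr rfl fun s _ => by ring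

lemma expect_sum {κ : Type*} (T : Finset κ) (f : κ → Finset ι → ℝ) :
    expect p (fun s => ∑ i ∈ T, f i s) = ∑ i ∈ T, expect p (f i) := by
  simp only [expect, Finset.mul_sum]
  exact Finset.sum_comm

/-- The independence of the elements: the expectation of a product of functions of single
elements factors. -/
lemma expect_prod (f g : ι → ℝ) :
    expect p (fun s => ∏ e, if e ∈ s then f e else g e) = ∏ e, (p * f e + (1 - p) * g e) := by
  rw [Finset.prod_add]
  simp only [Finset.powerset_univ, expect, weight]
  refine Finset.sum_congr rfl fun s _ => ?_
  rw [← Finset.prod_mul_distrib, ← Finset.prod_mul_prod_compl s, Finset.compl_eq_univ_sdiff]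
  congr 1
  · exact Finset.prod_congr rfl fun e he => by simp [he]
  · refine Finset.prod_congr rfl fun e he => ?_
    have : e ∉ s := by simpa using he
    simp [this]

lemma expect_const (c : ℝ) : expect p (fun _ : Finset ι => c) = c := by
  have h := expect_prod (ι := ι) (p := p) (fun _ => 1) (fun _ => 1)
  have h2 := expect_const_mul (ι := ι) (p := p) c (fun _ => 1)
  simp only [mul_one, ite_self, Finset.prod_const_one] at h
  have : p + (1 - p) = 1 := by ring
  rw [h, this] at h2
  simpa using h2

/-- The generating function of the number of random elements in `F`. -/
lemma expect_pow_card_inter (t : ℝ) (F : Finset ι) :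
    expect p (fun s => t ^ (s ∩ F).card) = (1 - p + p * t) ^ F.card := by
  have h := expect_prod (p := p) (fun e => if e ∈ F then t else 1) (fun _ => 1)
  have e1 : (fun s : Finset ι => ∏ e, if e ∈ s then (if e ∈ F then t else 1) else 1)
      = fun s => t ^ (s ∩ F).card := by
    funext s
    rw [← Finset.prod_const]
    simp only [← ite_and, ← Finset.mem_inter]
    rw [← Finset.prod_filter]
    exact Finset.prod_congr (by ext; simp) fun _ _ => rfl
  rw [e1] at h
  rw [h, ← Finset.prod_const]
  have : ∀ e : ι, p * (if e ∈ F then t else 1) + (1 - p) * 1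
      = if e ∈ F then (1 - p + p * t) else 1 := by
    intro e; split_ifs <;> ring
  simp only [this]
  rw [← Finset.prod_filter]
  exact Finset.prod_congr (by ext; simp) fun _ _ => rfl

lemma weight_insert {e : ι} {s : Finset ι} (he : e ∉ s) :
    (1 - p) * weight p (insert e s) = p * weight p s := by
  unfold weight
  rw [← Finset.mul_prod_erase _ _ (Finset.mem_univ e), ← Finset.mul_prod_erase _ _
    (Finset.mem_univ e)]
  have : ∏ x ∈ Finset.univ.erase e, (if x ∈ insert e s then p else 1 - p)
      = ∏ x ∈ Finset.univ.erase e, (if x ∈ s then p else 1 - p) :=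
    Finset.prod_congr rfl fun x hx => by simp [Finset.ne_of_mem_erase hx]
  rw [this]
  simp [he]
  ring

lemma expect_eq_sum_notMem (e : ι) (f : Finset ι → ℝ) :
    expect p f = ∑ s with e ∉ s, (weight p s * f s + weight p (insert e s) * f (insert e s)) := by
  rw [Finset.sum_add_distrib, expect, ← Finset.sum_filter_not_add_sum_filter _ (fun s => e ∈ s)]
  congr 1
  refine Finset.sum_bij' (fun s _ => s.erase e) (fun s _ => insert e s) ?_ ?_ ?_ ?_ ?_
  · intro s hs; simp
  · intro s hs; simp
  · intro s hs; simp at hs; simp [hs]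
  · intro s hs; simp at hs; simp [hs]
  · intro s hs; simp at hs; simp [hs]

lemma expect_mem_mul (e : ι) (g : Finset ι → ℝ) (hg : ∀ s, g (insert e s) = g s) :
    expect p (fun s => if e ∈ s then g s else 0) = p * expect p g := by
  rw [expect_eq_sum_notMem e, expect_eq_sum_notMem e g, Finset.mul_sum]
  refine Finset.sum_congr rfl fun s hs => ?_
  have he : e ∉ s := by simpa using hs
  have := weight_insert (p := p) he
  simp only [he, if_false, Finset.mem_insert_self, if_true, hg]
  linear_combination g s * this

/-- The presence of the elements of `F` is independent of everything that does not depend on `F`. -/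
lemma expect_subset_mul (F : Finset ι) (g : Finset ι → ℝ)
    (hg : ∀ e ∈ F, ∀ s, g (insert e s) = g s) :
    expect p (fun s => if F ⊆ s then g s else 0) = p ^ F.card * expect p g := by
  induction F using Finset.induction_on with
  | empty => simp
  | insert a F ha ih =>
    have ih' := ih fun e he => hg e (Finset.mem_insert_of_mem he)
    have h := expect_mem_mul (p := p) a (fun s => if F ⊆ s then g s else 0) (by
      intro s
      have : F ⊆ insert a s ↔ F ⊆ s := by
        rw [Finset.subset_insert_iff, Finset.erase_eq_of_notMem ha]
      simp [this, hg a (Finset.mem_insert_self _ _)])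
    rw [Finset.card_insert_of_notMem ha, pow_succ', mul_assoc, ← ih', ← h]
    congr 1
    funext s
    simp only [Finset.insert_subset_iff, ← ite_and]

lemma prob_nonneg (h0 : 0 ≤ p) (h1 : p ≤ 1) (A : Set (Finset ι)) : 0 ≤ prob p A :=
  expect_nonneg h0 h1 fun _ => Set.indicator_nonneg (by simp) _

lemma prob_mono (h0 : 0 ≤ p) (h1 : p ≤ 1) {A B : Set (Finset ι)} (h : A ⊆ B) :
    prob p A ≤ prob p B :=
  expect_mono h0 h1 fun _ => Set.indicator_le_indicator_of_subset h (by simp) _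

lemma prob_univ : prob p (Set.univ : Set (Finset ι)) = 1 := by
  simp only [prob, Set.indicator_univ]
  exact expect_const 1

lemma prob_compl (A : Set (Finset ι)) : prob p Aᶜ = 1 - prob p A := by
  have : prob p A + prob p Aᶜ = 1 := by
    rw [← prob_univ (ι := ι) (p := p), prob, prob, ← expect_add, prob]
    congr 1
    funext s
    by_cases h : s ∈ A <;> simp [h]
  linarith

lemma prob_le_one (h0 : 0 ≤ p) (h1 : p ≤ 1) (A : Set (Finset ι)) : prob p A ≤ 1 := by
  rw [← prob_univ (ι := ι) (p := p)]
  exact prob_mono h0 h1 (Set.subset_univ _)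

lemma prob_union_le (h0 : 0 ≤ p) (h1 : p ≤ 1) (A B : Set (Finset ι)) :
    prob p (A ∪ B) ≤ prob p A + prob p B := by
  rw [prob, prob, prob, ← expect_add]
  refine expect_mono h0 h1 fun s => ?_
  by_cases hA : s ∈ A <;> by_cases hB : s ∈ B <;> simp [hA, hB]

lemma prob_biUnion_le {κ : Type*} (h0 : 0 ≤ p) (h1 : p ≤ 1) (T : Finset κ)
    (A : κ → Set (Finset ι)) : prob p (⋃ i ∈ T, A i) ≤ ∑ i ∈ T, prob p (A i) := by
  classical
  induction T using Finset.induction_on with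
  | empty => simp [prob, expect]
  | insert a T ha ih =>
    rw [Finset.set_biUnion_insert, Finset.sum_insert ha]
    exact (prob_union_le h0 h1 _ _).trans (by linarith)

/-- Markov's inequality. -/
lemma mul_prob_le_expect (h0 : 0 ≤ p) (h1 : p ≤ 1) {c : ℝ} {f : Finset ι → ℝ}
    (hf : ∀ s, 0 ≤ f s) {A : Set (Finset ι)} (hA : ∀ s ∈ A, c ≤ f s) :
    c * prob p A ≤ expect p f := by
  rw [prob, ← expect_const_mul]
  refine expect_mono h0 h1 fun s => ?_
  by_cases h : s ∈ A
  · simpa [h] using hA s h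
  · simpa [h] using hf s

lemma prob_subset (F : Finset ι) : prob p {s | F ⊆ s} = p ^ F.card := by
  have h := expect_subset_mul (p := p) F (fun _ => 1) (by simp)
  rw [expect_const, mul_one] at h
  rw [← h, prob]
  congr 1
  funext s
  simp [Set.indicator_apply]

/-- The probability that a given set of elements is present and another one is absent. -/
lemma prob_inter_eq {F U : Finset ι} (hFU : F ⊆ U) :
    prob p {s | s ∩ U = F} = p ^ F.card * (1 - p) ^ (U.card - F.card) := by
  have h := expect_prod (p := p) (fun e => if e ∈ U \ F then 0 else 1) (fun e => if e ∈ F then 0 else 1)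
  have e1 : (fun s : Finset ι => ∏ e, if e ∈ s then (if e ∈ U \ F then (0:ℝ) else 1)
      else (if e ∈ F then 0 else 1)) = Set.indicator {s | s ∩ U = F} 1 := by
    funext s
    by_cases hs : s ∩ U = F
    · rw [Set.indicator_of_mem (by exact hs)]
      refine Finset.prod_eq_one fun e _ => ?_
      have : e ∈ s ∧ e ∈ U ↔ e ∈ F := by rw [← hs]; simp
      simp only [Finset.mem_sdiff]
      split_ifs <;> simp_all
    · rw [Set.indicator_of_notMem (by exact hs)]
      rw [Finset.ext_iff] at hs
      push Not at hs
      obtain ⟨e, he⟩ := hs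
      refine Finset.prod_eq_zero (Finset.mem_univ e) ?_
      simp only [Finset.mem_inter] at he
      have := @hFU e
      simp only [Finset.mem_sdiff]
      split_ifs <;> simp_all
  rw [prob, ← e1, h, ← Finset.card_sdiff_of_subset hFU, ← Finset.prod_const, ← Finset.prod_const]
  have : ∀ e : ι, (p * (if e ∈ U \ F then 0 else 1) + (1 - p) * (if e ∈ F then 0 else 1))
      = (if e ∈ F then p else 1) * (if e ∈ U \ F then 1 - p else 1) := by
    intro e
    simp only [Finset.mem_sdiff]
    split_ifs <;> simp_all
  simp only [this]
  rw [Finset.prod_mul_distrib, ← Finset.prod_filter, ← Finset.prod_filter,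
    Finset.filter_univ_mem, Finset.filter_univ_mem]

end RandomSubset

/-! ### Correlation inequalities -/

namespace RandomSubset

variable {ι : Type*} [Fintype ι] [DecidableEq ι] {p : ℝ}

lemma weight_mul_weight (s t : Finset ι) :
    weight p s * weight p t = weight p (s ⊓ t) * weight p (s ⊔ t) := by
  unfold weight
  rw [← Finset.prod_mul_distrib, ← Finset.prod_mul_distrib]
  refine Finset.prod_congr rfl fun e _ => ?_
  by_cases h1 : e ∈ s <;> by_cases h2 : e ∈ t <;> simp [h1, h2, mul_comm]

/-- The Harris inequality for a random set conditioned to lie in a sublattice `L`. -/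
lemma expect_indicator_mul_le (h0 : 0 ≤ p) (h1 : p ≤ 1) {L : Set (Finset ι)}
    (hL : ∀ s ∈ L, ∀ t ∈ L, s ⊓ t ∈ L ∧ s ⊔ t ∈ L) {f g : Finset ι → ℝ}
    (hf0 : 0 ≤ f) (hg0 : 0 ≤ g) (hf : Monotone f) (hg : Monotone g) :
    expect p (L.indicator f) * expect p (L.indicator g) ≤
      prob p L * expect p (L.indicator (f * g)) := by
  have h := fkg f g (fun s => weight p s * L.indicator 1 s)
    (fun s => mul_nonneg (weight_nonneg h0 h1 s) (Set.indicator_nonneg (by simp) _))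
    hf0 hg0 hf hg (by
      intro a b
      by_cases ha : a ∈ L
      · by_cases hb : b ∈ L
        · have := hL a ha b hb
          simp only [Set.indicator_of_mem ha, Set.indicator_of_mem hb, Set.indicator_of_mem this.1,
            Set.indicator_of_mem this.2, Pi.one_apply, mul_one]
          exact (weight_mul_weight a b).le
        · simp only [Set.indicator_of_notMem hb, mul_zero]
          exact mul_nonneg (mul_nonneg (weight_nonneg h0 h1 _) (Set.indicator_nonneg (by simp) _))
            (mul_nonneg (weight_nonneg h0 h1 _) (Set.indicator_nonneg (by simp) _))
      · simp only [Set.indicator_of_notMem ha, mul_zero, zero_mul]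
        exact mul_nonneg (mul_nonneg (weight_nonneg h0 h1 _) (Set.indicator_nonneg (by simp) _))
            (mul_nonneg (weight_nonneg h0 h1 _) (Set.indicator_nonneg (by simp) _)))
  have key : ∀ φ : Finset ι → ℝ, ∑ s, weight p s * L.indicator 1 s * φ s
      = expect p (L.indicator φ) := by
    intro φ
    refine Finset.sum_congr rfl fun s _ => ?_
    by_cases hs : s ∈ L <;> simp [hs]
  have e3 := key (f * g)
  simp only [Pi.mul_apply] at e3
  rw [key, key, e3] at h
  exact h

lemma prob_inter_add_prob_inter_compl (L A : Set (Finset ι)) :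
    prob p (L ∩ A) + prob p (L ∩ Aᶜ) = prob p L := by
  rw [prob, prob, ← expect_add, prob]
  congr 1
  funext s
  by_cases h : s ∈ A <;> by_cases hL : s ∈ L <;> simp [h, hL]

lemma prob_mul_prob_le_of_isUpperSet (h0 : 0 ≤ p) (h1 : p ≤ 1) {L A B : Set (Finset ι)}
    (hL : ∀ s ∈ L, ∀ t ∈ L, s ⊓ t ∈ L ∧ s ⊔ t ∈ L) (hA : IsUpperSet A) (hB : IsUpperSet B) :
    prob p (L ∩ A) * prob p (L ∩ B) ≤ prob p L * prob p (L ∩ (A ∩ B)) := by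
  have mono : ∀ {C : Set (Finset ι)}, IsUpperSet C → Monotone (C.indicator (1 : Finset ι → ℝ)) := by
    intro C hC s t hst
    by_cases h : s ∈ C
    · simp [h, hC hst h]
    · rw [Set.indicator_of_notMem h]; exact Set.indicator_nonneg (by simp) _
  have h := expect_indicator_mul_le h0 h1 hL (f := A.indicator 1) (g := B.indicator 1)
    (Set.indicator_nonneg (by simp)) (Set.indicator_nonneg (by simp)) (mono hA) (mono hB)
  have e : A.indicator 1 * B.indicator 1 = (A ∩ B).indicator (1 : Finset ι → ℝ) := by
    funext s
    by_cases hA : s ∈ A <;> by_cases hB : s ∈ B <;> simp [hA, hB]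
  rw [e, Set.indicator_indicator, Set.indicator_indicator, Set.indicator_indicator] at h
  exact h

lemma prob_mul_prob_le_of_isLowerSet (h0 : 0 ≤ p) (h1 : p ≤ 1) {L A B : Set (Finset ι)}
    (hL : ∀ s ∈ L, ∀ t ∈ L, s ⊓ t ∈ L ∧ s ⊔ t ∈ L) (hA : IsLowerSet A) (hB : IsLowerSet B) :
    prob p (L ∩ A) * prob p (L ∩ B) ≤ prob p L * prob p (L ∩ (A ∩ B)) := by
  have h := prob_mul_prob_le_of_isUpperSet h0 h1 hL hA.compl hB.compl
  have e1 := prob_inter_add_prob_inter_compl (p := p) L A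
  have e2 := prob_inter_add_prob_inter_compl (p := p) L B
  have e3 := prob_inter_add_prob_inter_compl (p := p) (L ∩ A) B
  have e4 := prob_inter_add_prob_inter_compl (p := p) (L ∩ Bᶜ) A
  rw [Set.inter_assoc] at e3
  rw [Set.inter_assoc, Set.inter_assoc, Set.inter_comm Bᶜ Aᶜ, Set.inter_comm Bᶜ A,
    ← Set.inter_assoc] at e4
  have f1 : prob p (L ∩ Aᶜ) = prob p L - prob p (L ∩ A) := by linarith
  have f2 : prob p (L ∩ Bᶜ) = prob p L - prob p (L ∩ B) := by linarith
  have f3 : prob p (L ∩ (Aᶜ ∩ Bᶜ)) =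
      prob p L - prob p (L ∩ A) - prob p (L ∩ B) + prob p (L ∩ (A ∩ B)) := by linarith
  rw [f1, f2, f3] at h
  linarith

lemma prob_inter_mul_prob_le (h0 : 0 ≤ p) (h1 : p ≤ 1) {L A B : Set (Finset ι)}
    (hL : ∀ s ∈ L, ∀ t ∈ L, s ⊓ t ∈ L ∧ s ⊔ t ∈ L) (hA : IsUpperSet A) (hB : IsLowerSet B) :
    prob p L * prob p (L ∩ (A ∩ B)) ≤ prob p (L ∩ A) * prob p (L ∩ B) := by
  have h := prob_mul_prob_le_of_isUpperSet h0 h1 hL hA hB.compl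
  have e2 := prob_inter_add_prob_inter_compl (p := p) L B
  have e3 := prob_inter_add_prob_inter_compl (p := p) (L ∩ A) B
  rw [Set.inter_assoc, Set.inter_assoc] at e3
  have f2 : prob p (L ∩ Bᶜ) = prob p L - prob p (L ∩ B) := by linarith
  have f3 : prob p (L ∩ (A ∩ Bᶜ)) = prob p (L ∩ A) - prob p (L ∩ (A ∩ B)) := by linarith
  rw [f2, f3] at h
  linarith

/-- The Harris inequality for finitely many decreasing events, conditioned on a sublattice. -/
lemma prod_mul_prob_le_prob_inter {κ : Type*} (h0 : 0 ≤ p) (h1 : p ≤ 1) {L : Set (Finset ι)}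
    (hL : ∀ s ∈ L, ∀ t ∈ L, s ⊓ t ∈ L ∧ s ⊔ t ∈ L) (T : Finset κ) (A : κ → Set (Finset ι))
    (hA : ∀ i ∈ T, IsUpperSet (A i)) (z : κ → ℝ) (hz : ∀ i ∈ T, z i ≤ 1)
    (hAz : ∀ i ∈ T, prob p (L ∩ A i) ≤ z i * prob p L) :
    (∏ i ∈ T, (1 - z i)) * prob p L ≤ prob p (L ∩ {s | ∀ i ∈ T, s ∉ A i}) := by
  classical
  rcases (prob_nonneg h0 h1 L).eq_or_lt with hL0 | hL0
  · rw [← hL0, mul_zero]; exact prob_nonneg h0 h1 _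
  induction T using Finset.induction_on with
  | empty => simp
  | insert a T ha ih =>
    have ih' := ih (fun i hi => hA i (Finset.mem_insert_of_mem hi))
      (fun i hi => hz i (Finset.mem_insert_of_mem hi))
      (fun i hi => hAz i (Finset.mem_insert_of_mem hi))
    have hlow : IsLowerSet {s : Finset ι | ∀ i ∈ T, s ∉ A i} := by
      intro s t hts hs i hi hti
      exact hs i hi (hA i (Finset.mem_insert_of_mem hi) hts hti)
    have h := prob_mul_prob_le_of_isLowerSet h0 h1 hL (hA a (Finset.mem_insert_self _ _)).compl hlow
    have e : {s : Finset ι | ∀ i ∈ insert a T, s ∉ A i} = (A a)ᶜ ∩ {s | ∀ i ∈ T, s ∉ A i} := by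
      ext s; simp
    rw [e, Finset.prod_insert ha]
    have e1 := prob_inter_add_prob_inter_compl (p := p) L (A a)
    have hza := hAz a (Finset.mem_insert_self _ _)
    have hz1 := hz a (Finset.mem_insert_self _ _)
    have h3 : (1 - z a) * prob p L ≤ prob p (L ∩ (A a)ᶜ) := by linarith
    have h4 : (1 - z a) * prob p L * ((∏ i ∈ T, (1 - z i)) * prob p L) ≤
        prob p (L ∩ (A a)ᶜ) * prob p (L ∩ {s | ∀ i ∈ T, s ∉ A i}) := by
      refine mul_le_mul h3 ih' ?_ (prob_nonneg h0 h1 _)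
      exact mul_nonneg (Finset.prod_nonneg fun i hi =>
        sub_nonneg.2 (hz i (Finset.mem_insert_of_mem hi))) hL0.le
    refine le_of_mul_le_mul_left ?_ hL0
    calc prob p L * ((1 - z a) * (∏ i ∈ T, (1 - z i)) * prob p L)
        = (1 - z a) * prob p L * ((∏ i ∈ T, (1 - z i)) * prob p L) := by ring
      _ ≤ _ := h4.trans h

/-- The probability of a decreasing event decreases with the density. -/
lemma prob_anti_of_isLowerSet {p₀ : ℝ} (h0 : 0 < p₀) (h1 : p₀ < 1) (hp : p₀ ≤ p) (hp1 : p ≤ 1)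
    {A : Set (Finset ι)} (hA : IsLowerSet A) : prob p A ≤ prob p₀ A := by
  set g : Finset ι → ℝ := fun s => ∏ e, if e ∈ s then p / p₀ else (1 - p) / (1 - p₀) with hg
  have hp1' : 1 ≤ p / p₀ := (one_le_div h0).2 hp
  have hp2' : (1 - p) / (1 - p₀) ≤ 1 := (div_le_one (by linarith)).2 (by linarith)
  have hp3' : 0 ≤ (1 - p) / (1 - p₀) := div_nonneg (by linarith) (by linarith)
  have hg0 : 0 ≤ g := fun s => Finset.prod_nonneg fun e _ => by split_ifs <;> linarith
  have hgm : Monotone g := by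
    intro s t hst
    refine Finset.prod_le_prod (fun e _ => by split_ifs <;> linarith) fun e _ => ?_
    by_cases hs : e ∈ s
    · simp [hs, hst hs]
    · by_cases ht : e ∈ t <;> simp [hs, ht]; linarith
  have hw : ∀ s, weight p₀ s * g s = weight p s := by
    intro s
    rw [weight, hg, ← Finset.prod_mul_distrib]
    refine Finset.prod_congr rfl fun e _ => ?_
    have : 1 - p₀ ≠ 0 := by linarith
    split_ifs <;> field_simp
  have hm : Monotone (Aᶜ.indicator (1 : Finset ι → ℝ)) := by
    intro s t hst
    by_cases h : s ∈ Aᶜ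
    · simp only [Set.indicator_of_mem h, Set.indicator_of_mem (hA.compl hst h)]; simp
    · rw [Set.indicator_of_notMem h]; exact Set.indicator_nonneg (by simp) _
  have h := expect_indicator_mul_le h0.le h1.le (L := Set.univ) (by simp) (f := Aᶜ.indicator 1)
    (g := g) (Set.indicator_nonneg (by simp)) hg0 hm hgm
  simp only [Set.indicator_univ, prob_univ, one_mul] at h
  have e1 : expect p₀ g = 1 := by
    simp only [expect, hw]
    simpa [expect] using expect_const (ι := ι) (p := p) 1
  have e2 : expect p₀ (Aᶜ.indicator 1 * g) = prob p Aᶜ := by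
    simp only [expect, prob, Pi.mul_apply]
    refine Finset.sum_congr rfl fun s _ => ?_
    rw [← hw s]; ring
  rw [e1, e2, mul_one] at h
  have h' : prob p₀ Aᶜ ≤ prob p Aᶜ := h
  rw [prob_compl, prob_compl] at h'
  linarith

/-! ### Conditioning on the elements outside a set -/

/-- The sets that agree with `s` outside `E`. -/
def fiber (E s : Finset ι) : Set (Finset ι) := {t | t \ E = s \ E}

omit [Fintype ι] in
lemma fiber_inf_sup (E s : Finset ι) :
    ∀ t ∈ fiber E s, ∀ u ∈ fiber E s, t ⊓ u ∈ fiber E s ∧ t ⊔ u ∈ fiber E s := by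
  intro t ht u hu
  simp only [fiber, Set.mem_ofPred_eq, Finset.ext_iff, Finset.mem_sdiff, Finset.inf_eq_inter,
    Finset.sup_eq_union, Finset.mem_inter, Finset.mem_union] at *
  constructor <;> intro e <;> have := ht e <;> have := hu e <;> tauto

lemma prob_fiber_inter_subset (E s : Finset ι) {F : Finset ι} (hF : F ⊆ E) :
    prob p (fiber E s ∩ {t | F ⊆ t}) = p ^ F.card * prob p (fiber E s) := by
  rw [prob, prob, ← expect_subset_mul F]
  · congr 1
    funext t
    by_cases h : F ⊆ t <;> by_cases h2 : t ∈ fiber E s <;> simp [h, h2]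
  · intro e he t
    have : insert e t ∈ fiber E s ↔ t ∈ fiber E s := by
      simp only [fiber, Set.mem_ofPred_eq, Finset.insert_sdiff_of_mem _ (hF he)]
    by_cases h : t ∈ fiber E s
    · simp [h, this.2 h]
    · rw [Set.indicator_of_notMem h, Set.indicator_of_notMem (mt this.1 h)]

lemma prob_eq_sum_inter (E : Finset ι) (A : Set (Finset ι)) :
    prob p A = ∑ c : Finset ι, prob p (A ∩ {s | s \ E = c}) := by
  unfold prob
  rw [← expect_sum]
  congr 1
  funext s
  rw [Finset.sum_eq_single (s \ E)]
  · by_cases h : s ∈ A <;> simp [h]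
  · intro b _ hb
    exact Set.indicator_of_notMem (fun h => hb h.2.symm) _
  · simp

/-- If `R` does not depend on the elements of `E`, and conditionally on the elements outside `E` the
event `U` has probability at least `q` whenever `R` holds, then `P(R ∩ U) ≥ q P(R)`. -/
lemma mul_prob_le_prob_inter_of_fiber {E : Finset ι} {R U : Set (Finset ι)} {q : ℝ}
    (hR : ∀ s ∈ R, fiber E s ⊆ R)
    (hU : ∀ s ∈ R, q * prob p (fiber E s) ≤ prob p (fiber E s ∩ U)) :
    q * prob p R ≤ prob p (R ∩ U) := by
  rw [prob_eq_sum_inter E R, prob_eq_sum_inter E (R ∩ U), Finset.mul_sum]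
  refine Finset.sum_le_sum fun c _ => ?_
  by_cases hc : ∃ s ∈ R, s \ E = c
  · obtain ⟨s, hs, rfl⟩ := hc
    have e1 : R ∩ {t | t \ E = s \ E} = fiber E s := by
      ext t
      exact ⟨fun h => h.2, fun h => ⟨hR s hs h, h⟩⟩
    have e2 : R ∩ U ∩ {t | t \ E = s \ E} = fiber E s ∩ U := by
      rw [Set.inter_right_comm, e1]
    rw [e1, e2]
    exact hU s hs
  · have e1 : R ∩ {t | t \ E = c} = ∅ := by
      ext t
      simp only [Set.mem_inter_iff, Set.mem_ofPred_eq, Set.mem_empty_iff_false, iff_false]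
      exact fun h => hc ⟨t, h.1, h.2⟩
    have e2 : R ∩ U ∩ {t | t \ E = c} = ∅ := by
      rw [Set.inter_right_comm, e1, Set.empty_inter]
    rw [e1, e2]
    simp [prob, expect]

end RandomSubset

namespace RandomSubset

variable {ι : Type*} [Fintype ι] [DecidableEq ι] {p : ℝ}

/-! ### Janson's inequality -/

/-- The induction step of Janson's inequality. -/
lemma prob_forall_not_subset_insert_le {κ : Type*} [DecidableEq κ] (h0 : 0 < p) (h1 : p ≤ 1)
    (F : κ → Finset ι) (T : Finset κ) (a : κ) :
    prob p {s | ∀ i ∈ insert a T, ¬ F i ⊆ s} ≤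
      Real.exp (-p ^ (F a).card + ∑ j ∈ T with ¬ Disjoint (F a) (F j), p ^ (F a ∪ F j).card) *
        prob p {s | ∀ i ∈ T, ¬ F i ⊆ s} := by
  set L : Set (Finset ι) := {s | F a ⊆ s} with hL
  set N : Set (Finset ι) := {s | ∀ j ∈ T, Disjoint (F a) (F j) → ¬ F j ⊆ s} with hN
  set A : Set (Finset ι) := {s | ∀ i ∈ T, ¬ F i ⊆ s} with hA
  set J := T.filter (fun j => ¬ Disjoint (F a) (F j)) with hJ
  set b := p ^ (F a).card - ∑ j ∈ J, p ^ (F a ∪ F j).card with hb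
  have hLlat : ∀ s ∈ L, ∀ t ∈ L, s ⊓ t ∈ L ∧ s ⊔ t ∈ L := fun s hs t ht =>
    ⟨Finset.subset_inter hs ht, Finset.Subset.trans hs Finset.subset_union_left⟩
  have hNlow : IsLowerSet N := fun s t hts hs j hj hd hjt =>
    hs j hj hd (hjt.trans hts)
  have hLN : prob p (L ∩ N) = p ^ (F a).card * prob p N := by
    rw [prob, prob, ← expect_subset_mul (F a)]
    · congr 1
      funext t
      by_cases h : F a ⊆ t <;> by_cases h2 : t ∈ N <;> simp [h, h2, hL]
    · intro e he t
      have : insert e t ∈ N ↔ t ∈ N := by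
        simp only [hN, Set.mem_ofPred_eq]
        refine forall₃_congr fun j hj hd => ?_
        have : e ∉ F j := Finset.disjoint_left.1 hd he
        rw [Finset.subset_insert_iff, Finset.erase_eq_of_notMem this]
      by_cases h : t ∈ N
      · simp [h, this.2 h]
      · rw [Set.indicator_of_notMem h, Set.indicator_of_notMem (mt this.1 h)]
  have hj : ∀ j, prob p (L ∩ ({s | F j ⊆ s} ∩ N)) ≤ p ^ (F a ∪ F j).card * prob p N := by
    intro j
    have h := prob_inter_mul_prob_le h0.le h1 hLlat (A := {s | F j ⊆ s}) (B := N)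
      (fun s t hst hs => Finset.Subset.trans hs hst) hNlow
    have e : L ∩ {s | F j ⊆ s} = {s | F a ∪ F j ⊆ s} := by
      ext s; simp [hL, Finset.union_subset_iff]
    rw [hLN, e, prob_subset, prob_subset] at h
    refine le_of_mul_le_mul_left ?_ (pow_pos h0 (F a).card)
    linarith
  have hcover : L ∩ N ⊆ (L ∩ A) ∪ ⋃ j ∈ J, (L ∩ ({s | F j ⊆ s} ∩ N)) := by
    rintro s ⟨hsL, hsN⟩
    by_cases hs : s ∈ A
    · exact Or.inl ⟨hsL, hs⟩
    · right
      simp only [hA, Set.mem_ofPred_eq, not_forall, not_not] at hs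
      obtain ⟨j, hjT, hjs⟩ := hs
      simp only [Set.mem_iUnion]
      exact ⟨j, Finset.mem_filter.2 ⟨hjT, fun hd => hsN j hjT hd hjs⟩, hsL, hjs, hsN⟩
  have h3 : b * prob p N ≤ prob p (L ∩ A) := by
    have := (prob_mono h0.le h1 hcover).trans (prob_union_le h0.le h1 _ _)
    have h4 := (prob_biUnion_le h0.le h1 J fun j => (L ∩ ({s | F j ⊆ s} ∩ N))).trans
      (Finset.sum_le_sum fun j _ => hj j)
    rw [← Finset.sum_mul] at h4
    rw [hLN] at this
    rw [hb, sub_mul]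
    linarith
  have hsplit := prob_inter_add_prob_inter_compl (p := p) A L
  have e : {s : Finset ι | ∀ i ∈ insert a T, ¬ F i ⊆ s} = A ∩ Lᶜ := by
    ext s
    simp only [Finset.forall_mem_insert, hA, hL, Set.mem_ofPred_eq, Set.mem_inter_iff,
      Set.mem_compl_iff]
    tauto
  have hAN : prob p A ≤ prob p N := prob_mono h0.le h1 fun s hs j hj _ => hs j hj
  have hA0 := prob_nonneg h0.le h1 A
  have hb' : -p ^ (F a).card + ∑ j ∈ J, p ^ (F a ∪ F j).card = -b := by rw [hb]; ring
  rw [e, hb']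
  rw [Set.inter_comm L A] at h3
  have hexp := Real.add_one_le_exp (-b)
  rcases le_total 0 b with hb0 | hb0
  · have : b * prob p A ≤ b * prob p N := mul_le_mul_of_nonneg_left hAN hb0
    nlinarith
  · have := prob_nonneg h0.le h1 (A ∩ L)
    nlinarith

/-- **Janson's inequality**: an upper bound for the probability that none of the sets `F i` is
contained in a random set. -/
theorem prob_forall_not_subset_le {κ : Type*} [DecidableEq κ] (h0 : 0 < p) (h1 : p ≤ 1)
    (F : κ → Finset ι) (T : Finset κ) :
    prob p {s | ∀ i ∈ T, ¬ F i ⊆ s} ≤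
      Real.exp (-∑ i ∈ T, p ^ (F i).card +
        ∑ i ∈ T, ∑ j ∈ T with j ≠ i ∧ ¬ Disjoint (F i) (F j), p ^ (F i ∪ F j).card) := by
  induction T using Finset.induction_on with
  | empty => simpa using prob_le_one h0.le h1 _
  | insert a T ha ih =>
    refine (prob_forall_not_subset_insert_le h0 h1 F T a).trans ?_
    refine (mul_le_mul_of_nonneg_left ih (Real.exp_nonneg _)).trans ?_
    rw [← Real.exp_add]
    refine Real.exp_le_exp.2 ?_
    rw [Finset.sum_insert ha, Finset.sum_insert ha]
    have e1 : ∑ j ∈ T with ¬ Disjoint (F a) (F j), p ^ (F a ∪ F j).card ≤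
        ∑ j ∈ insert a T with j ≠ a ∧ ¬ Disjoint (F a) (F j), p ^ (F a ∪ F j).card := by
      refine Finset.sum_le_sum_of_subset_of_nonneg ?_ fun _ _ _ => pow_nonneg h0.le _
      intro j hj
      simp only [Finset.mem_filter, Finset.mem_insert] at hj ⊢
      exact ⟨Or.inr hj.1, fun h => ha (h ▸ hj.1), hj.2⟩
    have e2 : ∑ i ∈ T, ∑ j ∈ T with j ≠ i ∧ ¬ Disjoint (F i) (F j), p ^ (F i ∪ F j).card ≤
        ∑ i ∈ T, ∑ j ∈ insert a T with j ≠ i ∧ ¬ Disjoint (F i) (F j), p ^ (F i ∪ F j).card := by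
      refine Finset.sum_le_sum fun i _ =>
        Finset.sum_le_sum_of_subset_of_nonneg ?_ fun _ _ _ => pow_nonneg h0.le _
      exact Finset.filter_subset_filter _ (Finset.subset_insert _ _)
    linarith

/-! ### Binomial random graphs as random sets of pairs -/

variable {V : Type*} [Fintype V] [DecidableEq V]

/-- The graph whose edges are the non-diagonal pairs in `s`. -/
def graph (s : Finset (Sym2 V)) : SimpleGraph V := SimpleGraph.fromEdgeSet (s : Set (Sym2 V))

omit [Fintype V] [DecidableEq V] in
lemma graph_adj {s : Finset (Sym2 V)} {u v : V} : (graph s).Adj u v ↔ s(u, v) ∈ s ∧ u ≠ v := by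
  simp [graph]

omit [Fintype V] [DecidableEq V] in
lemma graph_mono {s t : Finset (Sym2 V)} (h : s ⊆ t) : graph s ≤ graph t :=
  SimpleGraph.fromEdgeSet_mono (by exact_mod_cast h)

lemma prob_graph_eq (p : ℝ) (G : SimpleGraph V) :
    prob p {s : Finset (Sym2 V) | graph s = G} =
      p ^ G.edgeSet.ncard * (1 - p) ^ ((Nat.card V).choose 2 - G.edgeSet.ncard) := by
  classical
  set U : Finset (Sym2 V) := Finset.univ.filter (fun e => ¬ e.IsDiag) with hU
  have hsub : G.edgeFinset ⊆ U := fun e he => by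
    rw [hU, Finset.mem_filter]
    exact ⟨Finset.mem_univ _, G.not_isDiag_of_mem_edgeSet (by simpa using he)⟩
  have e : {s : Finset (Sym2 V) | graph s = G} = {s | s ∩ U = G.edgeFinset} := by
    ext s
    simp only [Set.mem_ofPred_eq, graph]
    rw [← SimpleGraph.edgeSet_inj, SimpleGraph.edgeSet_fromEdgeSet, ← Finset.coe_inj]
    have : ((s ∩ U : Finset (Sym2 V)) : Set (Sym2 V)) = (s : Set (Sym2 V)) \ Sym2.diagSet := by
      ext e; simp [hU]
    rw [this, SimpleGraph.coe_edgeFinset]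
  have hUc : U.card = (Nat.card V).choose 2 := by
    rw [Nat.card_eq_fintype_card, ← Sym2.card_subtype_not_diag, hU, Fintype.card_subtype]
  rw [e, prob_inter_eq hsub, hUc, Set.ncard_eq_toFinset_card', SimpleGraph.edgeFinset]

lemma prob_eq_sum_singleton (p : ℝ) (E : Finset (SimpleGraph V)) :
    prob p {s : Finset (Sym2 V) | graph s ∈ E} =
      ∑ G ∈ E, prob p {s : Finset (Sym2 V) | graph s = G} := by
  classical
  unfold prob
  rw [← expect_sum]
  congr 1
  funext s
  by_cases h : graph s ∈ E
  · rw [Finset.sum_eq_single (graph s)]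
    · simp [h]
    · intro G _ hG
      exact Set.indicator_of_notMem (fun h => hG h.symm) _
    · simp [h]
  · rw [Finset.sum_eq_zero]
    · simp [h]
    · intro G hG
      exact Set.indicator_of_notMem (fun h' => h (by rw [show graph s = G from h']; exact hG)) _

/-- The binomial random graph is the graph of a random set of pairs. -/
theorem binomialRandom_toReal (p : I) (E : Set (SimpleGraph V)) :
    (SimpleGraph.binomialRandom V p E).toReal =
      prob (p : ℝ) {s : Finset (Sym2 V) | graph s ∈ E} := by
  classical
  have hE : E.Finite := Set.toFinite E
  have h := prob_eq_sum_singleton (p : ℝ) hE.toFinset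
  simp only [Set.Finite.mem_toFinset] at h
  rw [h]
  have : MeasurableSingletonClass (SimpleGraph V) := by
    refine ⟨fun G => ?_⟩
    rw [← SimpleGraph.measurableEmbedding_edgeSet.measurableSet_image, Set.image_singleton]
    exact MeasurableSet.singleton _
  have h2 : SimpleGraph.binomialRandom V p E =
      ∑ G ∈ hE.toFinset, SimpleGraph.binomialRandom V p {G} := by
    rw [MeasureTheory.sum_measure_singleton]
    simp
  rw [h2, ENNReal.toReal_sum (fun G _ => MeasureTheory.measure_ne_top _ _)]
  refine Finset.sum_congr rfl fun G _ => ?_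
  rw [prob_graph_eq, SimpleGraph.binomialRandom_singleton]
  simp only [ENNReal.toReal_mul, ENNReal.toReal_pow, ENNReal.coe_toReal]
  rfl

end RandomSubset

/-! ### Paths with prescribed ends in a random graph -/

namespace RandomSubset

section PathSequences

variable {V : Type*} {m : ℕ}

/-- The sequence of vertices `u, w 0, …, w (m - 1), v, v, …`, whose first `m + 2` entries are regarded
as a path of length `m + 1` from `u` to `v`. -/
def pathVert (u v : V) (w : Fin m → V) (i : ℕ) : V :=
  if i = 0 then u else if h : i - 1 < m then w ⟨i - 1, h⟩ else v

@[simp] lemma pathVert_zero (u v : V) (w : Fin m → V) : pathVert u v w 0 = u := rfl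

lemma pathVert_succ (u v : V) (w : Fin m → V) (i : Fin m) : pathVert u v w (i + 1) = w i := by
  simp [pathVert]

@[simp] lemma pathVert_last (u v : V) (w : Fin m → V) : pathVert u v w (m + 1) = v := by
  simp [pathVert]

/-- The vertices of the sequence `pathVert u v w` are pairwise different. -/
def IsPathSeq (u v : V) (w : Fin m → V) : Prop :=
  Set.InjOn (pathVert u v w) (Set.Iic (m + 1))

variable [DecidableEq V]

/-- The edges of the path `pathVert u v w`. -/
def pathEdges (u v : V) (w : Fin m → V) : Finset (Sym2 V) :=
  (Finset.range (m + 1)).image fun i => s(pathVert u v w i, pathVert u v w (i + 1))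

omit [DecidableEq V] in
lemma IsPathSeq.injOn_edge {u v : V} {w : Fin m → V} (hw : IsPathSeq u v w) :
    Set.InjOn (fun i => s(pathVert u v w i, pathVert u v w (i + 1))) (Finset.range (m + 1)) := by
  intro i hi j hj hij
  simp only [Finset.coe_range, Set.mem_Iio] at hi hj
  simp only [Sym2.eq_iff] at hij
  rcases hij with ⟨h, _⟩ | ⟨h1, h2⟩
  · exact hw (by simp; omega) (by simp; omega) h
  · have e1 := hw (by simp; omega) (by simp; omega) h1
    have e2 := hw (by simp; omega) (by simp; omega) h2
    omega

lemma IsPathSeq.card_pathEdges {u v : V} {w : Fin m → V} (hw : IsPathSeq u v w) :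
    (pathEdges u v w).card = m + 1 := by
  rw [pathEdges, Finset.card_image_of_injOn hw.injOn_edge, Finset.card_range]

/-- A path all of whose edges lie on another path with the same ends equals that path. -/
lemma IsPathSeq.eq_of_subset {u v : V} {w w' : Fin m → V} (hw : IsPathSeq u v w)
    (hw' : IsPathSeq u v w')
    (h : ∀ i < m + 1, s(pathVert u v w' i, pathVert u v w' (i + 1)) ∈ pathEdges u v w) :
    w' = w := by
  have key : ∀ i ≤ m + 1, pathVert u v w' i = pathVert u v w i := by
    intro i
    induction i using Nat.strong_induction_on with
    | _ i ih =>
      intro hi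
      rcases i with _ | i
      · simp
      have hi' := ih i (by omega) (by omega)
      have := h i (by omega)
      rw [hi', pathEdges, Finset.mem_image] at this
      obtain ⟨j, hj, hij⟩ := this
      rw [Finset.mem_range] at hj
      rw [Sym2.eq_iff] at hij
      rcases hij with ⟨h1, h2⟩ | ⟨h1, h2⟩
      · have e1 := hw (by simp; omega) (by simp; omega) h1
        rw [← h2, e1]
      · have e2 := hw (by simp; omega) (by simp; omega) h2
        rw [← ih j (by omega) (by omega)] at h1
        have e3 := hw' (by simp; omega) (by simp; omega) h1
        omega
  funext i
  rw [← pathVert_succ u v w', ← pathVert_succ u v w]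
  exact key _ (by omega)

/-- If a path `w'` shares an edge with a different path `w`, and all but `m + 1 - c` of its edges lie on
`w`, then at least `c` of its inner vertices lie on `w`. -/
lemma IsPathSeq.exists_coords {u v : V} {w w' : Fin m → V} (hw : IsPathSeq u v w)
    (hw' : IsPathSeq u v w') (hne : w' ≠ w)
    (hd : ¬ Disjoint (pathEdges u v w) (pathEdges u v w')) :
    ∃ C : Finset (Fin m), C.Nonempty ∧
      (∀ c ∈ C, w' c ∈ (Finset.range (m + 2)).image (pathVert u v w)) ∧
      (pathEdges u v w ∪ pathEdges u v w').card + C.card = 2 * (m + 1) := by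
  set e' : ℕ → Sym2 V := fun i => s(pathVert u v w' i, pathVert u v w' (i + 1)) with he'
  set J := (Finset.range (m + 1)).filter (fun i => e' i ∈ pathEdges u v w) with hJ
  obtain ⟨j₀, hj₀, hj₀'⟩ : ∃ j < m + 1, e' j ∉ pathEdges u v w := by
    by_contra hcon
    push Not at hcon
    exact hne (hw.eq_of_subset hw' hcon)
  have hinter : pathEdges u v w ∩ pathEdges u v w' = J.image e' := by
    ext e
    simp only [hJ, Finset.mem_inter, Finset.mem_image, Finset.mem_filter]
    constructor
    · rintro ⟨h1, h2⟩
      rw [pathEdges, Finset.mem_image] at h2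
      obtain ⟨i, hi, rfl⟩ := h2
      exact ⟨i, ⟨hi, h1⟩, rfl⟩
    · rintro ⟨i, ⟨hi, h1⟩, rfl⟩
      exact ⟨h1, Finset.mem_image_of_mem _ hi⟩
  have hJcard : (pathEdges u v w ∩ pathEdges u v w').card = J.card := by
    rw [hinter, Finset.card_image_of_injOn]
    exact hw'.injOn_edge.mono (by exact_mod_cast Finset.filter_subset _ _)
  have hlt : ∀ i ∈ J, (if i < j₀ then i else i - 1) < m := by
    intro i hi
    simp only [hJ, Finset.mem_filter, Finset.mem_range] at hi
    have : i ≠ j₀ := fun h => hj₀' (h ▸ hi.2)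
    split_ifs <;> omega
  -- an edge before (after) the missing edge is charged to its later (earlier) end, which is inner
  refine ⟨J.attach.image fun i => ⟨if i.1 < j₀ then i.1 else i.1 - 1, hlt i.1 i.2⟩, ?_, ?_, ?_⟩
  · rw [Finset.image_nonempty, Finset.attach_nonempty_iff, ← Finset.card_pos, ← hJcard,
      Finset.card_pos, ← Finset.not_disjoint_iff_nonempty_inter]
    exact hd
  · intro c hc
    rw [Finset.mem_image] at hc
    obtain ⟨⟨i, hi⟩, -, rfl⟩ := hc
    have hi2 := hi
    simp only [hJ, Finset.mem_filter, Finset.mem_range] at hi2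
    have hne : i ≠ j₀ := fun h => hj₀' (h ▸ hi2.2)
    have hmem := hi2.2
    rw [pathEdges, Finset.mem_image] at hmem
    obtain ⟨j, hj, hjj⟩ := hmem
    rw [Finset.mem_range] at hj
    have hboth : pathVert u v w' i ∈ (Finset.range (m + 2)).image (pathVert u v w) ∧
        pathVert u v w' (i + 1) ∈ (Finset.range (m + 2)).image (pathVert u v w) := by
      have a1 : pathVert u v w j ∈ (Finset.range (m + 2)).image (pathVert u v w) :=
        Finset.mem_image_of_mem _ (Finset.mem_range.2 (by omega))
      have a2 : pathVert u v w (j + 1) ∈ (Finset.range (m + 2)).image (pathVert u v w) :=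
        Finset.mem_image_of_mem _ (Finset.mem_range.2 (by omega))
      rw [he', Sym2.eq_iff] at hjj
      rcases hjj with ⟨h1, h2⟩ | ⟨h1, h2⟩
      · rw [← h1, ← h2]; exact ⟨a1, a2⟩
      · rw [← h1, ← h2]; exact ⟨a2, a1⟩
    rw [← pathVert_succ u v w']
    by_cases hlt' : i < j₀
    · simpa [hlt'] using hboth.2
    · have : i - 1 + 1 = i := by omega
      simpa [hlt', this] using hboth.1
  · rw [Finset.card_image_of_injOn, Finset.card_attach, ← hJcard, Finset.card_union_add_card_inter,
      hw.card_pathEdges, hw'.card_pathEdges, two_mul]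
    rintro ⟨i, hi⟩ - ⟨j, hj⟩ - hij
    simp only [Fin.mk.injEq] at hij
    simp only [hJ, Finset.mem_filter, Finset.mem_range] at hi hj
    have : i ≠ j₀ := fun h => hj₀' (h ▸ hi.2)
    have : j ≠ j₀ := fun h => hj₀' (h ▸ hj.2)
    simp only [Subtype.mk.injEq]
    split_ifs at hij <;> omega

/-- A short distance is witnessed by a path sequence. -/
lemma exists_isPathSeq_of_edist_le {G : SimpleGraph V} {u v : V} (huv : u ≠ v) {k : ℕ}
    (h : G.edist u v ≤ k) :
    ∃ m < k, ∃ w : Fin m → V, IsPathSeq u v w ∧ ∀ e ∈ pathEdges u v w, e ∈ G.edgeSet := by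
  have hreach : G.Reachable u v := by
    rw [← SimpleGraph.edist_ne_top_iff_reachable]
    exact ne_top_of_le_ne_top (ENat.natCast_ne_top k) h
  obtain ⟨q, hq, hql⟩ := hreach.exists_path_of_dist
  have hlen : q.length ≤ k := by
    rw [hql]
    rw [← hreach.coe_dist_eq_edist] at h
    exact_mod_cast h
  have hpos : 0 < q.length := by
    rcases Nat.eq_zero_or_pos q.length with h0 | h0
    · exact absurd (SimpleGraph.Walk.eq_of_length_eq_zero h0) huv
    · exact h0
  have hvert : ∀ i ≤ q.length - 1 + 1,
      pathVert u v (fun i : Fin (q.length - 1) => q.getVert (i + 1)) i = q.getVert i := by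
    intro i hi
    unfold pathVert
    split_ifs with h1 h2
    · simp [h1]
    · simp only
      congr 1
      omega
    · have : i = q.length := by omega
      rw [this, SimpleGraph.Walk.getVert_length]
  refine ⟨q.length - 1, by omega, fun i => q.getVert (i + 1), ?_, ?_⟩
  · intro i hi j hj hij
    simp only [Set.mem_Iic] at hi hj
    rw [hvert i hi, hvert j hj] at hij
    exact hq.getVert_injOn (by simp; omega) (by simp; omega) hij
  · intro e he
    rw [pathEdges, Finset.mem_image] at he
    obtain ⟨i, hi, rfl⟩ := he
    rw [Finset.mem_range] at hi
    rw [hvert i (by omega), hvert (i + 1) (by omega)]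
    exact q.adj_getVert_succ (by omega)

lemma IsPathSeq.edist_le {s : Finset (Sym2 V)} {u v : V} {w : Fin m → V} (hw : IsPathSeq u v w)
    (hs : pathEdges u v w ⊆ s) : (graph s).edist u v ≤ (m + 1 : ℕ) := by
  have key : ∀ i ≤ m + 1, (graph s).edist u (pathVert u v w i) ≤ (i : ℕ) := by
    intro i
    induction i with
    | zero => intro _; simp
    | succ i ih =>
      intro hi
      have hadj : (graph s).Adj (pathVert u v w i) (pathVert u v w (i + 1)) := by
        rw [graph, SimpleGraph.fromEdgeSet_adj]
        refine ⟨hs ?_, fun h => ?_⟩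
        · exact Finset.mem_image.2 ⟨i, Finset.mem_range.2 (by omega), rfl⟩
        · have := hw (by simp; omega) (by simp; omega) h
          omega
      refine (SimpleGraph.edist_triangle (v := pathVert u v w i)).trans ?_
      rw [SimpleGraph.edist_eq_one_iff_adj.2 hadj]
      push_cast
      exact add_le_add_left (ih (by omega)) 1
  simpa using key (m + 1) le_rfl

end PathSequences

section Distances

variable {V : Type*} [Fintype V] [DecidableEq V] {p : ℝ}

/-- The first moment bound for short distances. -/
lemma prob_edist_le (h0 : 0 ≤ p) (h1 : p ≤ 1) {u v : V} (huv : u ≠ v) (k : ℕ) :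
    prob p {s : Finset (Sym2 V) | (graph s).edist u v ≤ k} ≤
      ∑ m ∈ Finset.range k, (Fintype.card V : ℝ) ^ m * p ^ (m + 1) := by
  classical
  have hsub : {s : Finset (Sym2 V) | (graph s).edist u v ≤ k} ⊆ ⋃ m ∈ Finset.range k,
      ⋃ w ∈ Finset.univ.filter (fun w : Fin m → V => IsPathSeq u v w),
        {s : Finset (Sym2 V) | pathEdges u v w ⊆ s} := by
    intro s hs
    obtain ⟨m, hm, w, hw, he⟩ := exists_isPathSeq_of_edist_le huv hs
    simp only [Set.mem_iUnion]
    refine ⟨m, Finset.mem_range.2 hm, w, by simpa using hw, fun e hes => ?_⟩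
    have := he e hes
    simp only [graph, SimpleGraph.edgeSet_fromEdgeSet] at this
    exact_mod_cast this.1
  refine (prob_mono h0 h1 hsub).trans ((prob_biUnion_le h0 h1 _ _).trans ?_)
  refine Finset.sum_le_sum fun m _ => (prob_biUnion_le h0 h1 _ _).trans ?_
  have : ∀ w ∈ Finset.univ.filter (fun w : Fin m → V => IsPathSeq u v w),
      prob p {s : Finset (Sym2 V) | pathEdges u v w ⊆ s} ≤ p ^ (m + 1) := by
    intro w hw
    rw [prob_subset, IsPathSeq.card_pathEdges (by simpa using hw)]
  refine (Finset.sum_le_card_nsmul _ _ _ this).trans ?_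
  rw [nsmul_eq_mul]
  refine mul_le_mul_of_nonneg_right ?_ (pow_nonneg h0 _)
  have : (Finset.univ.filter (fun w : Fin m → V => IsPathSeq u v w)).card
      ≤ (Fintype.card V) ^ m := by
    refine (Finset.card_filter_le _ _).trans ?_
    simp
  exact_mod_cast this

lemma card_isPathSeq_ge {u v : V} (huv : u ≠ v) (m : ℕ)
    [DecidablePred fun w : Fin m → V => IsPathSeq u v w] :
    (Fintype.card V - 2 + 1 - m) ^ m ≤
      (Finset.univ.filter (fun w : Fin m → V => IsPathSeq u v w)).card := by
  have hc : Fintype.card (Fin m ↪ {x : V // x ≠ u ∧ x ≠ v}) =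
      (Fintype.card V - 2).descFactorial m := by
    rw [Fintype.card_embedding_eq, Fintype.card_fin]
    congr 1
    rw [Fintype.card_subtype]
    have : Finset.univ.filter (fun x : V => x ≠ u ∧ x ≠ v) = ({u, v} : Finset V)ᶜ := by
      ext x; simp
    rw [this, Finset.card_compl, Finset.card_pair huv]
  refine (Nat.pow_sub_le_descFactorial _ _).trans ?_
  rw [← hc, ← Finset.card_univ]
  refine Finset.card_le_card_of_injOn (fun g i => (g i : V)) ?_ ?_
  · intro g _
    simp only [Finset.coe_filter, Finset.mem_univ, true_and, Set.mem_ofPred_eq]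
    intro i hi j hj hij
    simp only [Set.mem_Iic] at hi hj
    have hin : ∀ a (ha : a < m), pathVert u v (fun i => (g i : V)) (a + 1) = g ⟨a, ha⟩ :=
      fun a ha => pathVert_succ u v (fun i => (g i : V)) ⟨a, ha⟩
    have hcase : ∀ i ≤ m + 1, i = 0 ∨ i = m + 1 ∨ ∃ a, a < m ∧ i = a + 1 := by
      intro i hi
      rcases i with _ | i
      · simp
      · rcases Nat.lt_or_ge i m with h | h
        · exact Or.inr (Or.inr ⟨i, h, rfl⟩)
        · exact Or.inr (Or.inl (by omega))
    rcases hcase i hi with rfl | rfl | ⟨a, ha, rfl⟩ <;>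
      rcases hcase j hj with rfl | rfl | ⟨b, hb, rfl⟩ <;>
      try simp only [pathVert_zero, pathVert_last] at hij ⊢
    · exact absurd hij huv
    · rw [hin b hb] at hij; exact absurd hij.symm (g ⟨b, hb⟩).2.1
    · exact absurd hij.symm huv
    · rw [hin b hb] at hij; exact absurd hij.symm (g ⟨b, hb⟩).2.2
    · rw [hin a ha] at hij; exact absurd hij (g ⟨a, ha⟩).2.1
    · rw [hin a ha] at hij; exact absurd hij (g ⟨a, ha⟩).2.2
    · rw [hin a ha, hin b hb] at hij
      have := g.injective (Subtype.ext hij)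
      simpa using this
  · intro g _ g' _ h
    ext i
    exact congrFun h i

/-- The correlation term of Janson's inequality for the paths from `u` to `v`. -/
lemma sum_card_union_le (h0 : 0 < p) (hp : 1 ≤ (Fintype.card V : ℝ) * p) {u v : V} {m : ℕ}
    [DecidablePred fun w : Fin m → V => IsPathSeq u v w] {w : Fin m → V} (hw : IsPathSeq u v w) :
    ∑ w' ∈ Finset.univ.filter (fun w : Fin m → V => IsPathSeq u v w) with
        w' ≠ w ∧ ¬ Disjoint (pathEdges u v w) (pathEdges u v w'),
      p ^ (pathEdges u v w ∪ pathEdges u v w').card ≤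
      p ^ (m + 1) * ((2 * (m + 2)) ^ m * ((Fintype.card V : ℝ) ^ m * p ^ (m + 1) /
        (Fintype.card V * p))) := by
  set n : ℝ := (Fintype.card V : ℝ) with hn
  set W : Finset V := (Finset.range (m + 2)).image (pathVert u v w) with hW
  have hn0 : 0 ≤ n := Nat.cast_nonneg _
  set P := (Finset.univ : Finset (Finset (Fin m))).filter (fun C => C.Nonempty) with hP
  set B : Finset (Fin m) → Finset (Fin m → V) := fun C =>
    Fintype.piFinset fun c => if c ∈ C then W else Finset.univ with hB
  have hstep : ∑ w' ∈ Finset.univ.filter (fun w : Fin m → V => IsPathSeq u v w) with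
        w' ≠ w ∧ ¬ Disjoint (pathEdges u v w) (pathEdges u v w'),
      p ^ (pathEdges u v w ∪ pathEdges u v w').card ≤
      ∑ C ∈ P, ∑ w' ∈ B C, p ^ (2 * (m + 1) - C.card) := by
    rw [Finset.sum_comm' (t' := Finset.univ) (s' := fun w' => P.filter (fun C => w' ∈ B C))
      (by simp)]
    refine le_trans (Finset.sum_le_sum fun w' hw' => ?_)
      (Finset.sum_le_univ_sum_of_nonneg fun w' => Finset.sum_nonneg fun _ _ => pow_nonneg h0.le _)
    · simp only [Finset.mem_filter, Finset.mem_univ, true_and] at hw'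
      obtain ⟨C, hC, hCW, hCc⟩ := hw.exists_coords hw'.1 hw'.2.1 hw'.2.2
      have : p ^ (pathEdges u v w ∪ pathEdges u v w').card = p ^ (2 * (m + 1) - C.card) := by
        congr 1; omega
      rw [this]
      refine Finset.single_le_sum (f := fun C : Finset (Fin m) => p ^ (2 * (m + 1) - C.card))
        (fun _ _ => pow_nonneg h0.le _) ?_
      simp only [hP, hB, Finset.mem_filter, Finset.mem_univ, true_and, Fintype.mem_piFinset]
      refine ⟨hC, fun c => ?_⟩
      by_cases hc : c ∈ C
      · rw [if_pos hc]; exact hCW c hc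
      · simp [hc]
  refine hstep.trans ?_
  have hterm : ∀ C ∈ P, ∑ w' ∈ B C, p ^ (2 * (m + 1) - C.card) ≤
      p ^ (m + 1) * ((m + 2) ^ m * (n ^ m * p ^ (m + 1) / (n * p))) := by
    intro C hC
    have hCpos : 1 ≤ C.card := by
      simp only [hP, Finset.mem_filter] at hC; exact hC.2.card_pos
    have hCm : C.card ≤ m := by simpa using Finset.card_le_univ C
    have hWc : (W.card : ℝ) ≤ m + 2 := by
      have : W.card ≤ m + 2 := Finset.card_image_le.trans (by simp)
      exact_mod_cast this
    have hBc : ((B C).card : ℝ) ≤ (m + 2) ^ m * n ^ (m - C.card) := by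
      have : (B C).card = W.card ^ C.card * (Fintype.card V) ^ (m - C.card) := by
        rw [hB, Fintype.card_piFinset]
        rw [← Finset.prod_mul_prod_compl C]
        congr 1
        · rw [← Finset.prod_const]
          exact Finset.prod_congr rfl fun c hc => by simp [hc]
        · have hcc : m - C.card = Cᶜ.card := by rw [Finset.card_compl, Fintype.card_fin]
          rw [hcc, ← Finset.prod_const]
          refine Finset.prod_congr rfl fun c hc => ?_
          have : c ∉ C := by simpa using hc
          simp [this]
      rw [this]
      push_cast
      refine mul_le_mul_of_nonneg_right ?_ (pow_nonneg hn0 _)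
      calc (W.card : ℝ) ^ C.card ≤ ((m : ℝ) + 2) ^ C.card :=
            pow_le_pow_left₀ (Nat.cast_nonneg _) hWc _
        _ ≤ ((m : ℝ) + 2) ^ m :=
            pow_le_pow_right₀ (by linarith [(Nat.cast_nonneg m : (0 : ℝ) ≤ m)]) hCm
    rw [Finset.sum_const, nsmul_eq_mul]
    have hexp : p ^ (2 * (m + 1) - C.card) = p ^ (m + 1) * p ^ (m + 1 - C.card) := by
      rw [← pow_add]; congr 1; omega
    rw [hexp]
    have hnp : 0 < n * p := lt_of_lt_of_le one_pos hp
    have hfin : n ^ (m - C.card) * p ^ (m + 1 - C.card) ≤ n ^ m * p ^ (m + 1) / (n * p) := by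
      rw [le_div_iff₀ hnp]
      have e1 : n ^ m * p ^ (m + 1) =
          n ^ (m - C.card) * p ^ (m + 1 - C.card) * (n * p) ^ C.card := by
        rw [mul_pow]
        calc n ^ m * p ^ (m + 1) = n ^ (m - C.card + C.card) * p ^ (m + 1 - C.card + C.card) := by
              congr 2 <;> omega
          _ = _ := by rw [pow_add, pow_add]; ring
      rw [e1]
      refine mul_le_mul_of_nonneg_left ?_ (mul_nonneg (pow_nonneg hn0 _) (pow_nonneg h0.le _))
      exact le_self_pow₀ hp (by omega)
    calc ((B C).card : ℝ) * (p ^ (m + 1) * p ^ (m + 1 - C.card))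
        ≤ ((m + 2) ^ m * n ^ (m - C.card)) * (p ^ (m + 1) * p ^ (m + 1 - C.card)) :=
          mul_le_mul_of_nonneg_right hBc (mul_nonneg (pow_nonneg h0.le _) (pow_nonneg h0.le _))
      _ = p ^ (m + 1) * ((m + 2) ^ m * (n ^ (m - C.card) * p ^ (m + 1 - C.card))) := by ring
      _ ≤ _ := by
          refine mul_le_mul_of_nonneg_left ?_ (pow_nonneg h0.le _)
          exact mul_le_mul_of_nonneg_left hfin (by positivity)
  refine (Finset.sum_le_card_nsmul _ _ _ hterm).trans ?_
  rw [nsmul_eq_mul]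
  have hPc : (P.card : ℝ) ≤ 2 ^ m := by
    have : P.card ≤ 2 ^ m := (Finset.card_filter_le _ _).trans (by simp)
    exact_mod_cast this
  refine (mul_le_mul_of_nonneg_right hPc (by positivity)).trans (le_of_eq ?_)
  rw [mul_pow]; ring

/-- An upper bound for the probability of a long distance, from Janson's inequality for the paths of
length `m + 1`. -/
theorem prob_lt_edist_le (h0 : 0 < p) (h1 : p ≤ 1) {u v : V} (huv : u ≠ v) (m : ℕ)
    (hm : m + 1 ≤ Fintype.card V) (hp : 1 ≤ (Fintype.card V : ℝ) * p) :
    prob p {s : Finset (Sym2 V) | ((m + 1 : ℕ) : ℕ∞) < (graph s).edist u v} ≤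
      Real.exp (-((Fintype.card V : ℝ) ^ m * p ^ (m + 1)) *
        (1 - m * (m + 1) / (Fintype.card V : ℝ) - (2 * (m + 2)) ^ m *
          ((Fintype.card V : ℝ) ^ m * p ^ (m + 1)) / (Fintype.card V * p))) := by
  classical
  set n : ℝ := (Fintype.card V : ℝ) with hn
  have hn0 : 0 < n := by
    rw [hn]; exact_mod_cast (by omega : 0 < Fintype.card V)
  set T := Finset.univ.filter (fun w : Fin m → V => IsPathSeq u v w) with hT
  have hsub : {s : Finset (Sym2 V) | ((m + 1 : ℕ) : ℕ∞) < (graph s).edist u v} ⊆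
      {s | ∀ w ∈ T, ¬ pathEdges u v w ⊆ s} := by
    intro s hs w hw hws
    have : IsPathSeq u v w := by simpa [hT] using hw
    exact absurd (this.edist_le hws) (not_le.2 hs)
  refine (prob_mono h0.le h1 hsub).trans
    ((prob_forall_not_subset_le h0 h1 (pathEdges u v) T).trans (Real.exp_le_exp.2 ?_))
  have hcard : ∀ w ∈ T, p ^ (pathEdges u v w).card = p ^ (m + 1) := fun w hw => by
    rw [IsPathSeq.card_pathEdges (by simpa [hT] using hw)]
  rw [Finset.sum_congr rfl hcard, Finset.sum_const, nsmul_eq_mul]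
  have hpair : ∑ w ∈ T, ∑ w' ∈ T with
      w' ≠ w ∧ ¬ Disjoint (pathEdges u v w) (pathEdges u v w'),
      p ^ (pathEdges u v w ∪ pathEdges u v w').card ≤
      T.card • (p ^ (m + 1) * ((2 * (m + 2)) ^ m * (n ^ m * p ^ (m + 1) / (n * p)))) :=
    Finset.sum_le_card_nsmul _ _ _ fun w hw =>
      sum_card_union_le h0 hp (by simpa [hT] using hw)
  rw [nsmul_eq_mul] at hpair
  have hTle : (T.card : ℝ) ≤ n ^ m := by
    have : T.card ≤ (Fintype.card V) ^ m := (Finset.card_filter_le _ _).trans (by simp)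
    rw [hn]; exact_mod_cast this
  have hTge : n ^ m * (1 - m * (m + 1) / n) ≤ (T.card : ℝ) := by
    have h := card_isPathSeq_ge huv m
    have hc2 : 2 ≤ Fintype.card V := by
      have := Finset.card_le_univ ({u, v} : Finset V)
      rwa [Finset.card_pair huv] at this
    have h' : ((Fintype.card V - 2 + 1 - m : ℕ) : ℝ) ^ m ≤ (T.card : ℝ) := by exact_mod_cast h
    have h2 : ((Fintype.card V - 2 + 1 - m : ℕ) : ℝ) = n - (m + 1) := by
      have : Fintype.card V - 2 + 1 - m = Fintype.card V - (m + 1) := by omega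
      rw [this, Nat.cast_sub hm]; push_cast; rfl
    rw [h2] at h'
    refine le_trans ?_ h'
    have hb : 1 + (m : ℝ) * (-((m + 1) / n)) ≤ (1 + -((m + 1) / n)) ^ m := by
      refine one_add_mul_le_pow ?_ m
      have : ((m : ℝ) + 1) / n ≤ 1 := by
        rw [div_le_one hn0, hn]; exact_mod_cast hm
      linarith
    calc n ^ m * (1 - m * (m + 1) / n) = n ^ m * (1 + (m : ℝ) * (-((m + 1) / n))) := by ring
      _ ≤ n ^ m * (1 + -((m + 1) / n)) ^ m := mul_le_mul_of_nonneg_left hb (by positivity)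
      _ = (n - (m + 1)) ^ m := by
          rw [← mul_pow]; congr 1; field_simp; ring
  have hpm : 0 < p ^ (m + 1) := by positivity
  have hK : 0 ≤ p ^ (m + 1) * ((2 * (m + 2)) ^ m * (n ^ m * p ^ (m + 1) / (n * p))) := by positivity
  have a1 := mul_le_mul_of_nonneg_right hTge hpm.le
  have a2 := hpair.trans (mul_le_mul_of_nonneg_right hTle hK)
  calc _ ≤ -(n ^ m * (1 - m * (m + 1) / n) * p ^ (m + 1)) +
        n ^ m * (p ^ (m + 1) * ((2 * (m + 2)) ^ m * (n ^ m * p ^ (m + 1) / (n * p)))) := by linarith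
    _ = _ := by ring

end Distances

end RandomSubset

namespace RandomSubset

/-! ### Chernoff bounds -/

section Chernoff

variable {ι : Type*} [Fintype ι] [DecidableEq ι] {p : ℝ}

lemma expect_pow_card_inter_le (h0 : 0 ≤ p) (h1 : p ≤ 1) {t : ℝ} (ht : 0 ≤ t) (F : Finset ι) :
    expect p (fun s => t ^ (s ∩ F).card) ≤ Real.exp ((t - 1) * (p * F.card)) := by
  rw [expect_pow_card_inter]
  have : 1 - p + p * t ≤ Real.exp ((t - 1) * p) := by
    have := Real.add_one_le_exp ((t - 1) * p); linarith
  refine (pow_le_pow_left₀ (by nlinarith [mul_nonneg h0 ht]) this _).trans (le_of_eq ?_)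
  rw [← Real.exp_nat_mul]
  congr 1
  ring

lemma prob_card_inter_le (h0 : 0 ≤ p) (h1 : p ≤ 1) {t : ℝ} (ht : 0 ≤ t) (ht1 : t ≤ 1)
    (F : Finset ι) (a : ℕ) :
    t ^ a * prob p {s | (s ∩ F).card ≤ a} ≤ Real.exp ((t - 1) * (p * F.card)) :=
  (mul_prob_le_expect h0 h1 (fun _ => pow_nonneg ht _)
    fun _ hs => pow_le_pow_of_le_one ht ht1 hs).trans (expect_pow_card_inter_le h0 h1 ht F)

lemma prob_le_card_inter (h0 : 0 ≤ p) (h1 : p ≤ 1) {t : ℝ} (ht : 1 ≤ t)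
    (F : Finset ι) (a : ℕ) :
    t ^ a * prob p {s | a ≤ (s ∩ F).card} ≤ Real.exp ((t - 1) * (p * F.card)) :=
  (mul_prob_le_expect h0 h1 (fun _ => pow_nonneg (by linarith) _)
    fun _ hs => pow_le_pow_right₀ ht hs).trans (expect_pow_card_inter_le h0 h1 (by linarith) F)

end Chernoff

/-! ### Counting the vectors of queried distances -/

variable {V : Type*} [Fintype V] [DecidableEq V] {p : ℝ}

/-- The distance between the two vertices of a pair. -/
noncomputable def pairDist (G : SimpleGraph V) : Sym2 V → ℕ∞ :=
  Sym2.lift ⟨fun u v => G.edist u v, fun _ _ => SimpleGraph.edist_comm⟩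

omit [Fintype V] [DecidableEq V] in
@[simp] lemma pairDist_mk (G : SimpleGraph V) (u v : V) : pairDist G s(u, v) = G.edist u v := rfl

/-- The queried pairs whose distance differs from `d`. -/
noncomputable def atypicalPairs (Q : Finset (Sym2 V)) (d : ℕ) (G : SimpleGraph V) :
    Finset (Sym2 V) := by
  classical exact Q.filter fun e => pairDist G e ≠ d

/-- The number of the non-diagonal pairs. -/
lemma card_not_isDiag : (Finset.univ.filter fun e : Sym2 V => ¬ e.IsDiag).card =
    (Fintype.card V).choose 2 := by
  rw [← Sym2.card_subtype_not_diag, Fintype.card_subtype]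

lemma ncard_edgeSet_graph (s : Finset (Sym2 V)) :
    (graph s).edgeSet.ncard = (s ∩ Finset.univ.filter fun e : Sym2 V => ¬ e.IsDiag).card := by
  rw [← Set.ncard_coe_finset]
  congr 1
  ext e
  simp [graph]

omit [Fintype V] in
/-- The number of reconstructible graphs for which all queried distances are at most `k + 2` and at
most `M` of them differ from `k + 1`: such a graph is determined by its queried distances, and a vector
of distances with `a` entries different from `k + 1` is counted with weight `t ^ a`. -/
lemma card_reconstructs_mul_le (Q : Finset (Sym2 V)) (hQ : ∀ e ∈ Q, ¬ e.IsDiag) (k M : ℕ) {t : ℝ}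
    (ht : 0 ≤ t) (ht1 : t ≤ 1) (𝒯 : Finset (SimpleGraph V))
    (h𝒯 : ∀ G ∈ 𝒯, Reconstructs (Q : Set (Sym2 V)) G ∧ (∀ e ∈ Q, pairDist G e ≤ (k + 2 : ℕ)) ∧
      (atypicalPairs Q (k + 1) G).card ≤ M) :
    𝒯.card * t ^ M ≤ (1 + (k + 1) * t) ^ Q.card := by
  classical
  set c : ℕ → ℝ := fun a => if a = k + 1 then 1 else t with hc
  have hc0 : ∀ a, 0 ≤ c a := fun a => by simp only [hc]; split_ifs <;> linarith
  set φ : SimpleGraph V → (Q → ℕ) := fun G e => (pairDist G e).toNat with hφ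
  have hcoe : ∀ G ∈ 𝒯, ∀ e : Q, ((φ G e : ℕ) : ℕ∞) = pairDist G e := fun G hG e =>
    ENat.natCast_toNat (ne_top_of_le_ne_top (ENat.natCast_ne_top _) ((h𝒯 G hG).2.1 e e.2))
  have hinj : Set.InjOn φ 𝒯 := by
    intro G hG G' hG' h
    refine ((h𝒯 G hG).1 G' fun x y hxy => ?_).symm
    have e1 := hcoe G hG ⟨s(x, y), hxy⟩
    have e2 := hcoe G' hG' ⟨s(x, y), hxy⟩
    rw [← h, e1] at e2
    exact e2.symm
  have hmem : ∀ G ∈ 𝒯, φ G ∈ Fintype.piFinset fun _ : Q => Finset.Icc 1 (k + 2) := by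
    intro G hG
    rw [Fintype.mem_piFinset]
    intro e
    have he := hcoe G hG e
    have h2 := (h𝒯 G hG).2.1 e e.2
    rw [← he] at h2
    refine Finset.mem_Icc.2 ⟨?_, by exact_mod_cast h2⟩
    rw [Nat.one_le_iff_ne_zero]
    intro h0
    rw [h0] at he
    have hnd := hQ e e.2
    generalize (e : Sym2 V) = e' at he hnd
    induction e' using Sym2.ind with
    | _ u v =>
      rw [pairDist_mk] at he
      exact hnd (SimpleGraph.edist_eq_zero_iff.1 (by exact_mod_cast he.symm))
  have hw : ∀ G ∈ 𝒯, t ^ M ≤ ∏ e : Q, c (φ G e) := by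
    intro G hG
    have e1 : ∏ e : Q, c (φ G e) = t ^ (atypicalPairs Q (k + 1) G).card := by
      rw [atypicalPairs, ← Finset.prod_const, Finset.prod_filter, ← Finset.prod_coe_sort Q]
      refine Finset.prod_congr rfl fun e _ => ?_
      have he := hcoe G hG e
      simp only [hc]
      rw [← he]
      by_cases h : φ G e = k + 1
      · simp [h]
      · rw [if_neg h, if_pos]
        exact_mod_cast h
    rw [e1]
    exact pow_le_pow_of_le_one ht ht1 (h𝒯 G hG).2.2
  calc 𝒯.card * t ^ M = ∑ G ∈ 𝒯, t ^ M := by rw [Finset.sum_const, nsmul_eq_mul]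
    _ ≤ ∑ G ∈ 𝒯, ∏ e : Q, c (φ G e) := Finset.sum_le_sum hw
    _ = ∑ f ∈ 𝒯.image φ, ∏ e : Q, c (f e) :=
        (Finset.sum_image (f := fun f => ∏ e : Q, c (f e)) hinj).symm
    _ ≤ ∑ f ∈ Fintype.piFinset fun _ : Q => Finset.Icc 1 (k + 2), ∏ e : Q, c (f e) := by
        refine Finset.sum_le_sum_of_subset_of_nonneg ?_ fun f _ _ =>
          Finset.prod_nonneg fun e _ => hc0 _
        intro f hf
        obtain ⟨G, hG, rfl⟩ := Finset.mem_image.1 hf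
        exact hmem G hG
    _ = ∏ e : Q, ∑ a ∈ Finset.Icc 1 (k + 2), c a := by rw [Finset.prod_univ_sum]
    _ = (1 + (k + 1) * t) ^ Q.card := by
        have : ∑ a ∈ Finset.Icc 1 (k + 2), c a = 1 + (k + 1) * t := by
          have hk : k + 1 ∈ Finset.Icc 1 (k + 2) := Finset.mem_Icc.2 ⟨by omega, by omega⟩
          have he : ∀ a ∈ (Finset.Icc 1 (k + 2)).erase (k + 1), c a = t := fun a ha => by
            simp only [hc, if_neg (Finset.ne_of_mem_erase ha)]
          rw [← Finset.add_sum_erase _ _ hk, Finset.sum_congr rfl he, Finset.sum_const,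
            Finset.card_erase_of_mem hk, nsmul_eq_mul]
          simp [hc]
        rw [this, Finset.prod_const, Finset.card_univ, Fintype.card_coe]

/-- The probability of a reconstructible graph with typical numbers of edges and of distances. -/
lemma prob_reconstructs_typical_le (h0 : 0 ≤ p) (h1 : p ≤ 1) (Q : Finset (Sym2 V))
    (hQ : ∀ e ∈ Q, ¬ e.IsDiag) (k M E : ℕ) {t : ℝ} (ht : 0 < t) (ht1 : t ≤ 1) :
    prob p {s : Finset (Sym2 V) | Reconstructs (Q : Set (Sym2 V)) (graph s) ∧
      (∀ e ∈ Q, pairDist (graph s) e ≤ (k + 2 : ℕ)) ∧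
      (atypicalPairs Q (k + 1) (graph s)).card ≤ M ∧ E ≤ (graph s).edgeSet.ncard} ≤
      (t ^ M)⁻¹ * (1 + (k + 1) * t) ^ Q.card * p ^ E := by
  classical
  set 𝒯 : Finset (SimpleGraph V) := Finset.univ.filter fun G =>
    Reconstructs (Q : Set (Sym2 V)) G ∧ (∀ e ∈ Q, pairDist G e ≤ (k + 2 : ℕ)) ∧
      (atypicalPairs Q (k + 1) G).card ≤ M ∧ E ≤ G.edgeSet.ncard with h𝒯
  have hc := card_reconstructs_mul_le Q hQ k M ht.le ht1 𝒯 (by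
    intro G hG
    simp only [h𝒯, Finset.mem_filter, Finset.mem_univ, true_and] at hG
    exact ⟨hG.1, hG.2.1, hG.2.2.1⟩)
  have hset : {s : Finset (Sym2 V) | Reconstructs (Q : Set (Sym2 V)) (graph s) ∧
      (∀ e ∈ Q, pairDist (graph s) e ≤ (k + 2 : ℕ)) ∧
      (atypicalPairs Q (k + 1) (graph s)).card ≤ M ∧ E ≤ (graph s).edgeSet.ncard} =
      {s | graph s ∈ 𝒯} := by
    ext s; simp [h𝒯]
  rw [hset, prob_eq_sum_singleton]
  have hG : ∀ G ∈ 𝒯, prob p {s : Finset (Sym2 V) | graph s = G} ≤ p ^ E := by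
    intro G hG
    simp only [h𝒯, Finset.mem_filter, Finset.mem_univ, true_and] at hG
    rw [prob_graph_eq]
    refine (mul_le_of_le_one_right (pow_nonneg h0 _)
      (pow_le_one₀ (by linarith) (by linarith))).trans ?_
    exact pow_le_pow_of_le_one h0 h1 hG.2.2.2
  refine (Finset.sum_le_card_nsmul _ _ _ hG).trans ?_
  rw [nsmul_eq_mul]
  refine mul_le_mul_of_nonneg_right ?_ (pow_nonneg h0 _)
  rw [inv_mul_eq_div, le_div_iff₀ (pow_pos ht _)]
  exact hc

/-- Markov's inequality for the number of atypical distances. -/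
lemma prob_card_atypicalPairs_le (h0 : 0 ≤ p) (h1 : p ≤ 1) (Q : Finset (Sym2 V))
    (hQ : ∀ e ∈ Q, ¬ e.IsDiag) (d : ℕ) {z : ℝ}
    (hz : ∀ u v : V, u ≠ v → prob p {s : Finset (Sym2 V) | (graph s).edist u v ≠ d} ≤ z) (M : ℕ) :
    (M + 1) * prob p {s : Finset (Sym2 V) | ¬ (atypicalPairs Q d (graph s)).card ≤ M} ≤
      Q.card * z := by
  classical
  have h := mul_prob_le_expect h0 h1 (c := M + 1)
    (f := fun s : Finset (Sym2 V) => ((atypicalPairs Q d (graph s)).card : ℝ))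
    (fun _ => Nat.cast_nonneg _) (A := {s | ¬ (atypicalPairs Q d (graph s)).card ≤ M}) (by
      intro s hs
      have : M + 1 ≤ (atypicalPairs Q d (graph s)).card := by
        have : ¬ (atypicalPairs Q d (graph s)).card ≤ M := hs
        omega
      exact_mod_cast this)
  refine h.trans ?_
  have e : (fun s : Finset (Sym2 V) => ((atypicalPairs Q d (graph s)).card : ℝ)) =
      fun s => ∑ e ∈ Q, Set.indicator {s : Finset (Sym2 V) | pairDist (graph s) e ≠ d} 1 s := by
    funext s
    simp [atypicalPairs, Finset.card_filter, Set.indicator_apply]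
  rw [e, expect_sum, ← nsmul_eq_mul]
  refine Finset.sum_le_card_nsmul _ _ _ fun e he => ?_
  have hnd := hQ e he
  induction e using Sym2.ind with
  | _ u v => exact hz u v (by simpa using hnd)

end RandomSubset

/-! ### Asymptotics of the parameters -/

namespace RandomSubset

lemma eventually_mul_log_pow_le (C : ℝ) (j : ℕ) {c : ℝ} (hc : 0 < c) :
    ∀ᶠ n : ℕ in atTop, C * Real.log n ^ j ≤ (n : ℝ) ^ c := by
  have h := (isLittleO_log_rpow_rpow_atTop (j : ℝ) hc).comp_tendsto tendsto_natCast_atTop_atTop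
  have h2 := h.def (c := 1 / (|C| + 1)) (by positivity)
  filter_upwards [h2, eventually_ge_atTop 1] with n hn hn1
  have hlog : 0 ≤ Real.log n := Real.log_natCast_nonneg n
  simp only [Function.comp_apply, Real.rpow_natCast, Real.norm_eq_abs] at hn
  have hnc : 0 ≤ (n : ℝ) ^ c := by positivity
  rw [abs_of_nonneg (pow_nonneg hlog j), abs_of_nonneg hnc, div_mul_eq_mul_div, one_mul,
    le_div_iff₀ (by positivity)] at hn
  have : C ≤ |C| + 1 := by linarith [le_abs_self C]
  nlinarith [pow_nonneg hlog j]

lemma eventually_le_log (C : ℝ) : ∀ᶠ n : ℕ in atTop, C ≤ Real.log n :=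
  (Real.tendsto_log_atTop.comp tendsto_natCast_atTop_atTop).eventually_ge_atTop C

/-- The consequences of the assumptions on `p` that hold for all large `n`, with a constant `c`. -/
structure Regime (k : ℕ) (c : ℝ) (n : ℕ) (p : ℝ) : Prop where
  pos : 0 < p
  lt_one : p < 1
  two_log_le : 2 * Real.log n ≤ (n : ℝ) ^ (k + 1) * p ^ (k + 2)
  le_log : (n : ℝ) ^ k * p ^ (k + 1) ≤ Real.log n
  exp_mul_le : Real.exp ((n : ℝ) ^ k * p ^ (k + 1)) * (n : ℝ) ^ c ≤ n * p

lemma exists_regime (k : ℕ) (hk : 1 ≤ k) (ε : ℝ) (hε : 0 < ε) (hεk : ε < 1 / ((k : ℝ) + 1))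
    (w : ℕ → ℝ) (hw : Tendsto w atTop atTop) (p : ℕ → I)
    (hp : ∀ᶠ n : ℕ in atTop,
      (p n : ℝ) = ((2 * Real.log n + w n) / (n : ℝ) ^ (k + 1)) ^ (1 / ((k : ℝ) + 2)))
    (hp_lt : ∀ᶠ n : ℕ in atTop,
      (p n : ℝ) <
        ((1 / ((k : ℝ) + 1) - ε) * (Real.log n / (n : ℝ) ^ k)) ^ (1 / ((k : ℝ) + 1))) :
    ∃ c : ℝ, 0 < c ∧ c ≤ 1 ∧ ∀ᶠ n : ℕ in atTop, Regime k c n (p n) := by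
  have hk0 : (0 : ℝ) ≤ k := Nat.cast_nonneg k
  refine ⟨min ε (1 / (2 * ((k : ℝ) + 2))), lt_min hε (by positivity), ?_, ?_⟩
  · refine (min_le_right _ _).trans ?_
    rw [div_le_one (by positivity)]; linarith
  filter_upwards [hp, hp_lt, hw.eventually_ge_atTop 0, eventually_ge_atTop 2,
    eventually_le_log (2 * ((k : ℝ) + 2))] with n hp hlt hw hn2 hlog
  set x : ℝ := (p n : ℝ) with hx
  set l := Real.log n with hl
  have hn : (0 : ℝ) < n := by exact_mod_cast (by omega : 0 < n)
  have hl0 : 0 < l := by linarith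
  have hx0 : 0 ≤ x := (p n).2.1
  have e1 : (1 : ℝ) / ((k : ℝ) + 2) = ((k + 2 : ℕ) : ℝ)⁻¹ := by push_cast; rw [one_div]
  have e2 : (1 : ℝ) / ((k : ℝ) + 1) = ((k + 1 : ℕ) : ℝ)⁻¹ := by push_cast; rw [one_div]
  have hpow : x ^ (k + 2) = (2 * l + w n) / (n : ℝ) ^ (k + 1) := by
    rw [hp, e1, Real.rpow_inv_natCast_pow (by positivity) (by omega)]
  have hδ : 0 ≤ 1 / ((k : ℝ) + 1) - ε := by linarith
  have hpow2 : x ^ (k + 1) ≤ (1 / ((k : ℝ) + 1) - ε) * (l / (n : ℝ) ^ k) := by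
    have h := pow_le_pow_left₀ hx0 hlt.le (k + 1)
    rwa [e2, Real.rpow_inv_natCast_pow (by rw [← e2]; positivity) (by omega), ← e2] at h
  have h2 : 2 * l ≤ (n : ℝ) ^ (k + 1) * x ^ (k + 2) := by
    rw [hpow, mul_div_cancel₀ _ (by positivity)]; linarith
  have hxpos : 0 < x := by
    rcases hx0.eq_or_lt with h | h
    · rw [← h] at h2; simp at h2; linarith
    · exact h
  have h3 : (n : ℝ) ^ k * x ^ (k + 1) ≤ (1 / ((k : ℝ) + 1) - ε) * l := by
    calc (n : ℝ) ^ k * x ^ (k + 1)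
        ≤ (n : ℝ) ^ k * ((1 / ((k : ℝ) + 1) - ε) * (l / (n : ℝ) ^ k)) :=
          mul_le_mul_of_nonneg_left hpow2 (by positivity)
      _ = _ := by field_simp
  have h1k : 1 / ((k : ℝ) + 1) ≤ 1 := by rw [div_le_one (by positivity)]; linarith
  have h4 : (n : ℝ) ^ k * x ^ (k + 1) ≤ l := h3.trans (by nlinarith)
  have hlogX : Real.log (n * x) = l + Real.log x := Real.log_mul hn.ne' hxpos.ne'
  -- `(n x)^(k+2) ≥ n`
  have hX2 : l ≤ (k + 2) * Real.log (n * x) := by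
    have : (n : ℝ) ≤ (n * x) ^ (k + 2) := by
      calc (n : ℝ) ≤ n * (2 * l) := le_mul_of_one_le_right hn.le (by linarith)
        _ ≤ n * ((n : ℝ) ^ (k + 1) * x ^ (k + 2)) := mul_le_mul_of_nonneg_left h2 hn.le
        _ = _ := by ring
    have := Real.log_le_log hn this
    rw [Real.log_pow] at this
    push_cast at this
    exact this
  refine ⟨hxpos, ?_, h2, h4, ?_⟩
  · by_contra hcon
    have hx1 : x = 1 := le_antisymm (p n).2.2 (not_lt.1 hcon)
    rw [hx1, one_pow, mul_one] at h4
    have hn1 : (1 : ℝ) ≤ n := by exact_mod_cast (by omega : 1 ≤ n)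
    have h5 : (n : ℝ) ≤ (n : ℝ) ^ k := le_self_pow₀ hn1 (by omega)
    have h6 := Real.log_le_sub_one_of_pos hn
    linarith
  · rw [← Real.exp_log (mul_pos hn hxpos), Real.rpow_def_of_pos hn, ← Real.exp_add]
    refine Real.exp_le_exp.2 ?_
    rw [← hl]
    rcases le_total ((n : ℝ) ^ k * x ^ (k + 1)) 1 with hlam | hlam
    · have : l * min ε (1 / (2 * ((k : ℝ) + 2))) ≤ l * (1 / (2 * ((k : ℝ) + 2))) :=
        mul_le_mul_of_nonneg_left (min_le_right _ _) hl0.le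
      have h5 : l / ((k : ℝ) + 2) ≤ Real.log (n * x) := by
        rw [div_le_iff₀ (by positivity)]; linarith
      have h6 : l * (1 / (2 * ((k : ℝ) + 2))) = l / ((k : ℝ) + 2) / 2 := by field_simp
      have h7 : 2 ≤ l / ((k : ℝ) + 2) := by rw [le_div_iff₀ (by positivity)]; exact hlog
      linarith
    · have h5 : l ≤ (k + 1) * Real.log (n * x) := by
        have : (n : ℝ) ≤ (n * x) ^ (k + 1) := by
          calc (n : ℝ) ≤ n * ((n : ℝ) ^ k * x ^ (k + 1)) := le_mul_of_one_le_right hn.le hlam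
            _ = _ := by ring
        have := Real.log_le_log hn this
        rw [Real.log_pow] at this
        push_cast at this
        exact this
      have h6 : 1 / ((k : ℝ) + 1) * l ≤ Real.log (n * x) := by
        rw [div_mul_eq_mul_div, one_mul, div_le_iff₀ (by positivity)]; linarith
      have : l * min ε (1 / (2 * ((k : ℝ) + 2))) ≤ l * ε :=
        mul_le_mul_of_nonneg_left (min_le_left _ _) hl0.le
      nlinarith

/-! ### Asymptotics of the distances -/

lemma Regime.mul_pow {k : ℕ} {c : ℝ} {n : ℕ} {p : ℝ} (_h : Regime k c n p) :
    ((n : ℝ) * p) ^ (k + 1) = n * ((n : ℝ) ^ k * p ^ (k + 1)) := by ring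

lemma Regime.rpow_le {k : ℕ} {c : ℝ} {n : ℕ} {p : ℝ} (h : Regime k c n p) :
    (n : ℝ) ^ c ≤ n * p := by
  refine le_trans (le_mul_of_one_le_left (by positivity) ?_) h.exp_mul_le
  exact Real.one_le_exp (mul_nonneg (by positivity) (pow_nonneg h.pos.le _))

lemma eventually_prob_lt_edist_le (m : ℕ) {c : ℝ} (hc : 0 < c) (hc1 : c ≤ 1) {δ : ℝ} (hδ : 0 < δ) :
    ∀ᶠ n : ℕ in atTop, ∀ p : ℝ, 0 < p → p ≤ 1 → (n : ℝ) ^ m * p ^ (m + 1) ≤ 2 * Real.log n →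
      (n : ℝ) ^ c ≤ n * p → ∀ u v : Fin n, u ≠ v →
      prob p {s : Finset (Sym2 (Fin n)) | ((m + 1 : ℕ) : ℕ∞) < (graph s).edist u v} ≤
        Real.exp (-((n : ℝ) ^ m * p ^ (m + 1)) + δ) := by
  set K : ℝ := (2 * (m + 2)) ^ m with hK
  have hK0 : 0 ≤ K := by positivity
  filter_upwards [eventually_ge_atTop (m + 1), eventually_le_log 1,
    eventually_mul_log_pow_le ((4 * K + 2 * (m * (m + 1))) / δ) 2 hc]
    with n hnm hl1 hlog p h0 h1 hΛ hX u v huv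
  have hn : (0 : ℝ) < n := by exact_mod_cast (by omega : 0 < n)
  have hn1 : (1 : ℝ) ≤ n := by exact_mod_cast (by omega : 1 ≤ n)
  have hX1 : 1 ≤ (n : ℝ) * p := (Real.one_le_rpow hn1 hc.le).trans hX
  have h := prob_lt_edist_le h0 h1 huv m (by simpa using hnm) (by simpa using hX1)
  simp only [Fintype.card_fin] at h
  refine h.trans (Real.exp_le_exp.2 ?_)
  set Λ := (n : ℝ) ^ m * p ^ (m + 1) with hΛd
  have hΛ0 : 0 ≤ Λ := by positivity
  have hnc : (n : ℝ) ^ c ≤ n := by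
    calc (n : ℝ) ^ c ≤ (n : ℝ) ^ (1 : ℝ) := Real.rpow_le_rpow_of_exponent_le hn1 hc1
      _ = n := Real.rpow_one _
  have hncpos : 0 < (n : ℝ) ^ c := Real.rpow_pos_of_pos hn c
  set l := Real.log n with hl
  have a1 : Λ * (m * (m + 1) / n) ≤ 2 * (m * (m + 1)) * l ^ 2 / (n : ℝ) ^ c := by
    rw [← mul_div_assoc]
    refine div_le_div₀ (by positivity) ?_ hncpos hnc
    have : Λ ≤ 2 * l ^ 2 := by nlinarith
    calc Λ * (m * (m + 1)) ≤ 2 * l ^ 2 * (m * (m + 1)) :=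
          mul_le_mul_of_nonneg_right this (by positivity)
      _ = _ := by ring
  have a2 : Λ * (K * Λ / (n * p)) ≤ 4 * K * l ^ 2 / (n : ℝ) ^ c := by
    rw [← mul_div_assoc]
    refine div_le_div₀ (by positivity) ?_ hncpos hX
    have : Λ * Λ ≤ 4 * l ^ 2 := by nlinarith
    calc Λ * (K * Λ) = K * (Λ * Λ) := by ring
      _ ≤ K * (4 * l ^ 2) := mul_le_mul_of_nonneg_left this hK0
      _ = _ := by ring
  have a3 : 2 * (m * (m + 1)) * l ^ 2 / (n : ℝ) ^ c + 4 * K * l ^ 2 / (n : ℝ) ^ c ≤ δ := by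
    rw [← add_div, div_le_iff₀ hncpos]
    rw [div_mul_eq_mul_div, div_le_iff₀ hδ] at hlog
    linarith
  calc -Λ * (1 - m * (m + 1) / n - K * Λ / (n * p))
      = -Λ + (Λ * (m * (m + 1) / n) + Λ * (K * Λ / (n * p))) := by ring
    _ ≤ -Λ + δ := by linarith

/-- Two given vertices are at distance more than `k + 2` with probability `O(n⁻²)`. -/
lemma eventually_prob_add_two_lt_edist_le (k : ℕ) (c : ℝ) :
    ∀ᶠ n : ℕ in atTop, ∀ p : ℝ, Regime k c n p → ∀ u v : Fin n, u ≠ v →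
      prob p {s : Finset (Sym2 (Fin n)) | ((k + 2 : ℕ) : ℕ∞) < (graph s).edist u v} ≤
        2 / (n : ℝ) ^ 2 := by
  have hk0 : (0 : ℝ) ≤ k := Nat.cast_nonneg k
  have hcc : (1 : ℝ) / ((k : ℝ) + 2) ≤ 1 := by rw [div_le_one (by positivity)]; linarith
  filter_upwards [eventually_prob_lt_edist_le (k + 1) (c := 1 / ((k : ℝ) + 2)) (by positivity) hcc
    (Real.log_pos (by norm_num : (1 : ℝ) < 2)), eventually_le_log 1, eventually_ge_atTop 1]
    with n hJ hl1 hn1' p hR u v huv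
  have hn : (0 : ℝ) < n := by exact_mod_cast hn1'
  set l := Real.log n with hl
  -- the density at which the expected number of paths of length `k + 2` equals `2 log n`
  set p₀ : ℝ := (2 * l / (n : ℝ) ^ (k + 1)) ^ (((k + 2 : ℕ) : ℝ)⁻¹) with hp₀
  have hbase : 0 < 2 * l / (n : ℝ) ^ (k + 1) := by positivity
  have hp₀pos : 0 < p₀ := Real.rpow_pos_of_pos hbase _
  have hpow : p₀ ^ (k + 2) = 2 * l / (n : ℝ) ^ (k + 1) :=
    Real.rpow_inv_natCast_pow hbase.le (by omega)
  have hΛ : (n : ℝ) ^ (k + 1) * p₀ ^ (k + 2) = 2 * l := by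
    rw [hpow, mul_div_cancel₀ _ (by positivity)]
  have hle : p₀ ≤ p := by
    refine le_of_pow_le_pow_left₀ (n := k + 2) (by omega) hR.pos.le ?_
    refine le_of_mul_le_mul_left ?_ (by positivity : 0 < (n : ℝ) ^ (k + 1))
    rw [hΛ]; exact hR.two_log_le
  have hX : (n : ℝ) ^ (1 / ((k : ℝ) + 2)) ≤ n * p₀ := by
    have e1 : (1 : ℝ) / ((k : ℝ) + 2) = ((k + 2 : ℕ) : ℝ)⁻¹ := by push_cast; rw [one_div]
    refine le_of_pow_le_pow_left₀ (n := k + 2) (by omega) (by positivity) ?_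
    rw [e1, Real.rpow_inv_natCast_pow hn.le (by omega)]
    calc (n : ℝ) ≤ n * (2 * l) := le_mul_of_one_le_right hn.le (by linarith)
      _ = n * ((n : ℝ) ^ (k + 1) * p₀ ^ (k + 2)) := by rw [hΛ]
      _ = _ := by ring
  have h := hJ p₀ hp₀pos (hle.trans hR.lt_one.le) (by rw [hΛ]) hX u v huv
  have hlow : IsLowerSet
      {s : Finset (Sym2 (Fin n)) | ((k + 2 : ℕ) : ℕ∞) < (graph s).edist u v} := by
    intro s t hts hs
    exact lt_of_lt_of_le hs (SimpleGraph.edist_anti (graph_mono hts))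
  refine (prob_anti_of_isLowerSet hp₀pos (lt_of_le_of_lt hle hR.lt_one) hle hR.lt_one.le hlow).trans
    (h.trans (le_of_eq ?_))
  rw [hΛ, Real.exp_add, Real.exp_log (by norm_num), Real.exp_neg, two_mul, Real.exp_add, hl,
    Real.exp_log hn]
  field_simp

lemma Regime.prob_edist_le {k : ℕ} {c : ℝ} (hc : 0 ≤ c) {n : ℕ} {p : ℝ} (h : Regime k c n p)
    {u v : Fin n} (huv : u ≠ v) :
    prob p {s : Finset (Sym2 (Fin n)) | (graph s).edist u v ≤ k} ≤ k * (((n : ℝ) * p) ^ k / n) := by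
  have hn1 : (1 : ℝ) ≤ n := by exact_mod_cast (Nat.one_le_iff_ne_zero.2 (Fin.pos u).ne')
  have hX : 1 ≤ (n : ℝ) * p := (Real.one_le_rpow hn1 hc).trans h.rpow_le
  refine (RandomSubset.prob_edist_le h.pos.le h.lt_one.le huv k).trans ?_
  have hterm : ∀ m ∈ Finset.range k, (Fintype.card (Fin n) : ℝ) ^ m * p ^ (m + 1) ≤
      ((n : ℝ) * p) ^ k / n := by
    intro m hm
    rw [Finset.mem_range] at hm
    rw [Fintype.card_fin, le_div_iff₀ (by positivity)]
    calc (n : ℝ) ^ m * p ^ (m + 1) * n = (n * p) ^ (m + 1) := by ring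
      _ ≤ (n * p) ^ k := pow_le_pow_right₀ hX hm
  simpa using Finset.sum_le_card_nsmul _ _ _ hterm

/-- Two given vertices are at distance `k + 1`, except with probability about `exp (-n^k p^(k+1))`. -/
lemma eventually_prob_edist_ne_le (k : ℕ) {c : ℝ} (hc : 0 < c) (hc1 : c ≤ 1) :
    ∀ᶠ n : ℕ in atTop, ∀ p : ℝ, Regime k c n p → ∀ u v : Fin n, u ≠ v →
      prob p {s : Finset (Sym2 (Fin n)) | (graph s).edist u v ≠ (k + 1 : ℕ)} ≤
        1.2 * Real.exp (-((n : ℝ) ^ k * p ^ (k + 1))) := by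
  filter_upwards [eventually_prob_lt_edist_le k hc hc1
    (Real.log_pos (by norm_num : (1 : ℝ) < 1.1)), eventually_le_log 1, eventually_ge_atTop 1,
    eventually_mul_log_pow_le (10 * k) 1 hc]
    with n hJ hl1 hn1' hlog p hR u v huv
  have hn : (0 : ℝ) < n := by exact_mod_cast hn1'
  set lam := (n : ℝ) ^ k * p ^ (k + 1) with hlam
  have hsub : {s : Finset (Sym2 (Fin n)) | (graph s).edist u v ≠ (k + 1 : ℕ)} ⊆
      {s | (graph s).edist u v ≤ k} ∪ {s | ((k + 1 : ℕ) : ℕ∞) < (graph s).edist u v} := by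
    intro s hs
    rcases lt_or_gt_of_ne hs with h | h
    · left
      push_cast at h
      exact ENat.lt_natCast_add_one_iff.1 h
    · exact Or.inr h
  refine (prob_mono hR.pos.le hR.lt_one.le hsub).trans
    ((prob_union_le hR.pos.le hR.lt_one.le _ _).trans ?_)
  have h1 := hR.prob_edist_le hc.le huv
  have h2 := hJ p hR.pos hR.lt_one.le (by linarith [hR.le_log]) hR.rpow_le u v huv
  rw [Real.exp_add, Real.exp_log (by norm_num)] at h2
  have h3 : k * (((n : ℝ) * p) ^ k / n) ≤ 0.1 * Real.exp (-lam) := by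
    have hX : 0 < (n : ℝ) * p := mul_pos hn hR.pos
    have e1 : ((n : ℝ) * p) ^ k / n = lam / (n * p) := by
      rw [div_eq_div_iff hn.ne' hX.ne', hlam]; ring
    rw [e1, Real.exp_neg, ← mul_div_assoc, div_le_iff₀ hX]
    have h4 : k * lam ≤ 0.1 * (n : ℝ) ^ c := by
      have : (k : ℝ) * lam ≤ k * Real.log n := mul_le_mul_of_nonneg_left hR.le_log (Nat.cast_nonneg k)
      linarith
    refine h4.trans ?_
    rw [mul_assoc]
    refine mul_le_mul_of_nonneg_left ?_ (by norm_num)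
    rw [inv_mul_eq_div, le_div_iff₀ (Real.exp_pos _), mul_comm]
    exact hR.exp_mul_le
  linarith

end RandomSubset

namespace RandomSubset

/-! ### Few queries when a typical distance is `k + 1` -/

/-- The bound on the number of queries, in terms of the mean degree `n p`: with `λ = n^k p^(k+1)`,
there are at most `n² e^λ log n / (8 (k+1)² (n p)^k)` of them. -/
def FewQueries (k n : ℕ) (p : ℝ) (Q : Finset (Sym2 (Fin n))) : Prop :=
  (Q.card : ℝ) ≤ (n : ℝ) ^ 2 * Real.exp ((n : ℝ) ^ k * p ^ (k + 1)) * Real.log n /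
    (8 * ((k : ℝ) + 1) ^ 2 * ((n : ℝ) * p) ^ k)

lemma fewQueries_of_card_le {k n : ℕ} {p : ℝ} (hp : 0 < p) (hn : 0 < n) {Q : Finset (Sym2 (Fin n))}
    (h : (Q.card : ℝ) ≤ 1 / (8 * ((k : ℝ) + 1) ^ 2 * (n : ℝ) ^ ((k : ℤ) - 2) * p ^ k) *
      Real.exp ((n : ℝ) ^ k * p ^ (k + 1)) * Real.log n) : FewQueries k n p Q := by
  have hn' : (n : ℝ) ≠ 0 := by exact_mod_cast hn.ne'
  refine h.trans (le_of_eq ?_)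
  rw [zpow_sub₀ hn', zpow_natCast, mul_pow]
  have : ((n : ℝ) ^ (2 : ℤ)) = (n : ℝ) ^ 2 := by norm_cast
  rw [this]
  field_simp

/-- With high probability all queried distances are at most `k + 2`. -/
lemma eventually_prob_exists_far_le (k : ℕ) (hk : 1 ≤ k) {c : ℝ} (hc : 0 < c) :
    ∀ᶠ n : ℕ in atTop, ∀ p : ℝ, Regime k c n p → ∀ Q : Finset (Sym2 (Fin n)),
      (∀ e ∈ Q, ¬ e.IsDiag) → FewQueries k n p Q →
      prob p {s : Finset (Sym2 (Fin n)) | ¬ ∀ e ∈ Q, pairDist (graph s) e ≤ (k + 2 : ℕ)} ≤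
        1 / 100 := by
  filter_upwards [eventually_prob_add_two_lt_edist_le k c, eventually_ge_atTop 1,
    eventually_mul_log_pow_le 100 1 hc, eventually_le_log 0]
    with n hfar hn1' hlog hl0 p hR Q hQ hcard
  have hn : (0 : ℝ) < n := by exact_mod_cast hn1'
  have hn1 : (1 : ℝ) ≤ n := by exact_mod_cast hn1'
  have hX1 : 1 ≤ (n : ℝ) * p := (Real.one_le_rpow hn1 hc.le).trans hR.rpow_le
  have hsub : {s : Finset (Sym2 (Fin n)) | ¬ ∀ e ∈ Q, pairDist (graph s) e ≤ (k + 2 : ℕ)} ⊆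
      ⋃ e ∈ Q, {s | ((k + 2 : ℕ) : ℕ∞) < pairDist (graph s) e} := by
    intro s hs
    simp only [Set.mem_ofPred_eq, not_forall, not_le] at hs
    obtain ⟨e, he, hes⟩ := hs
    simp only [Set.mem_iUnion]
    exact ⟨e, he, hes⟩
  have hterm : ∀ e ∈ Q, prob p {s : Finset (Sym2 (Fin n)) |
      ((k + 2 : ℕ) : ℕ∞) < pairDist (graph s) e} ≤ 2 / (n : ℝ) ^ 2 := by
    intro e he
    have hnd := hQ e he
    induction e using Sym2.ind with
    | _ u v => exact hfar p hR u v (by simpa using hnd)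
  refine (prob_mono hR.pos.le hR.lt_one.le hsub).trans
    ((prob_biUnion_le hR.pos.le hR.lt_one.le _ _).trans
      ((Finset.sum_le_card_nsmul _ _ _ hterm).trans ?_))
  rw [nsmul_eq_mul]
  have hXk : (n : ℝ) * p ≤ ((n : ℝ) * p) ^ k := le_self_pow₀ hX1 (by omega)
  set lam := (n : ℝ) ^ k * p ^ (k + 1)
  set l := Real.log n
  have hk1 : (1 : ℝ) ≤ ((k : ℝ) + 1) ^ 2 :=
    one_le_pow₀ (by linarith [(Nat.cast_nonneg k : (0 : ℝ) ≤ k)])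
  have h1 : (Q.card : ℝ) ≤ (n : ℝ) ^ 2 * (Real.exp lam * l) / (2 * ((n : ℝ) * p)) := by
    refine hcard.trans ?_
    rw [mul_assoc]
    refine div_le_div_of_nonneg_left (by positivity) (by positivity) ?_
    nlinarith
  have h2 : 100 * (Real.exp lam * l) ≤ n * p := by
    refine le_trans ?_ hR.exp_mul_le
    rw [pow_one] at hlog
    nlinarith [Real.exp_pos lam]
  calc (Q.card : ℝ) * (2 / (n : ℝ) ^ 2)
      ≤ (n : ℝ) ^ 2 * (Real.exp lam * l) / (2 * ((n : ℝ) * p)) * (2 / (n : ℝ) ^ 2) :=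
        mul_le_mul_of_nonneg_right h1 (by positivity)
    _ = (Real.exp lam * l) / (n * p) := by field_simp
    _ ≤ 1 / 100 := by
        rw [div_le_div_iff₀ (by linarith) (by norm_num)]; linarith

lemma exp_neg_five_le : Real.exp (-5) ≤ 1 / 100 := by
  rw [Real.exp_neg, inv_eq_one_div]
  refine one_div_le_one_div_of_le (by norm_num) ?_
  have h5 : Real.exp 5 = Real.exp 1 ^ 5 := by rw [← Real.exp_nat_mul]; norm_num
  have h27 : (2.7 : ℝ) ≤ Real.exp 1 := by have := Real.exp_one_gt_d9; linarith
  rw [h5]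
  calc (100 : ℝ) ≤ 2.7 ^ 5 := by norm_num
    _ ≤ _ := pow_le_pow_left₀ (by norm_num) h27 5

/-- With high probability the number of edges is at least about `0.9` times its expectation. -/
lemma eventually_prob_ncard_edgeSet_le (k : ℕ) {c : ℝ} (hc : 0 < c) :
    ∀ᶠ n : ℕ in atTop, ∀ p : ℝ, Regime k c n p → ∀ E : ℕ, (E : ℝ) ≤ 0.9 * (p * n.choose 2) →
      prob p {s : Finset (Sym2 (Fin n)) | (graph s).edgeSet.ncard ≤ E} ≤ 1 / 100 := by
  filter_upwards [eventually_ge_atTop 8000] with n hn8 p hR E hE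
  have hn : (8000 : ℝ) ≤ n := by exact_mod_cast hn8
  have hn1 : (1 : ℝ) ≤ n := by linarith
  have hX1 : 1 ≤ (n : ℝ) * p := (Real.one_le_rpow hn1 hc.le).trans hR.rpow_le
  have h := prob_card_inter_le hR.pos.le hR.lt_one.le (t := 0.9) (by norm_num) (by norm_num)
    (Finset.univ.filter fun e : Sym2 (Fin n) => ¬ e.IsDiag) E
  rw [card_not_isDiag, Fintype.card_fin] at h
  simp only [← ncard_edgeSet_graph] at h
  set B := p * (n.choose 2 : ℝ) with hB
  have hB' : 2000 ≤ B := by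
    rw [hB, Nat.cast_choose_two]
    nlinarith
  have ht : Real.exp (-0.107) ≤ 0.9 := by
    rw [Real.exp_neg, inv_le_comm₀ (Real.exp_pos _) (by norm_num)]
    have := Real.quadratic_le_exp_of_nonneg (by norm_num : (0 : ℝ) ≤ 0.107)
    norm_num at this ⊢
    linarith
  have h2 : Real.exp (-0.107 * (0.9 * B)) ≤ 0.9 ^ E := by
    calc Real.exp (-0.107 * (0.9 * B)) ≤ Real.exp (E * (-0.107)) := by
          refine Real.exp_le_exp.2 ?_; linarith
      _ = Real.exp (-0.107) ^ E := Real.exp_nat_mul _ _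
      _ ≤ 0.9 ^ E := pow_le_pow_left₀ (Real.exp_pos _).le ht _
  have h3 := (mul_le_mul_of_nonneg_right h2 (prob_nonneg hR.pos.le hR.lt_one.le
    {s : Finset (Sym2 (Fin n)) | (graph s).edgeSet.ncard ≤ E})).trans h
  rw [mul_comm, ← le_div_iff₀ (Real.exp_pos _), ← Real.exp_sub] at h3
  refine h3.trans ?_
  calc Real.exp ((0.9 - 1) * B - -0.107 * (0.9 * B)) ≤ Real.exp (-5) :=
        Real.exp_le_exp.2 (by linarith)
    _ ≤ 1 / 100 := exp_neg_five_le

/-- The exponents in the count of the typical distance vectors and in the probability of a typical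
graph: with `λ = n^k p^(k+1) ≥ 1/2`, the entropy of the queried distances is smaller than that of the
random graph. -/
lemma entropy_exponent_le {k n : ℕ} (hk : 1 ≤ k) {p c : ℝ} (hR : Regime k c n p) (hn : 0 < n)
    {lam : ℝ} (hlam : lam = (n : ℝ) ^ k * p ^ (k + 1)) (hhalf : 1 / 2 ≤ lam)
    {q : ℝ} (hq0 : 0 ≤ q) (hq : q ≤ (n : ℝ) ^ 2 * Real.exp lam * Real.log n /
      (8 * ((k : ℝ) + 1) ^ 2 * ((n : ℝ) * p) ^ k)) :
    q * Real.exp (-lam) * (1.44 * lam + 1.44 * k + 1) ≤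
      0.395 * (k / (k + 1)) * (n ^ 2 * p * Real.log n) := by
  have hk' : (1 : ℝ) ≤ k := by exact_mod_cast hk
  have hn' : (0 : ℝ) < n := by exact_mod_cast hn
  have hp := hR.pos
  set l := Real.log n
  have h1 : q * Real.exp (-lam) * lam ≤ n ^ 2 * p * l / (8 * ((k : ℝ) + 1) ^ 2) := by
    calc q * Real.exp (-lam) * lam ≤ (n : ℝ) ^ 2 * Real.exp lam * l /
          (8 * ((k : ℝ) + 1) ^ 2 * ((n : ℝ) * p) ^ k) * Real.exp (-lam) * lam := by
          refine mul_le_mul_of_nonneg_right (mul_le_mul_of_nonneg_right hq (Real.exp_pos _).le) ?_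
          linarith
      _ = n ^ 2 * p * l / (8 * ((k : ℝ) + 1) ^ 2) := by
          rw [Real.exp_neg]
          have := Real.exp_pos lam
          field_simp
          rw [hlam]; ring
  have h2 : 1.44 * lam + 1.44 * k + 1 ≤ lam * (6.32 * k) := by nlinarith
  have hqe : 0 ≤ q * Real.exp (-lam) := mul_nonneg hq0 (Real.exp_pos _).le
  calc q * Real.exp (-lam) * (1.44 * lam + 1.44 * k + 1)
      ≤ q * Real.exp (-lam) * (lam * (6.32 * k)) := mul_le_mul_of_nonneg_left h2 hqe
    _ = (q * Real.exp (-lam) * lam) * (6.32 * k) := by ring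
    _ ≤ n ^ 2 * p * l / (8 * ((k : ℝ) + 1) ^ 2) * (6.32 * k) :=
        mul_le_mul_of_nonneg_right h1 (by linarith)
    _ = 0.79 * k / ((k : ℝ) + 1) ^ 2 * (n ^ 2 * p * l) := by field_simp; ring
    _ ≤ 0.395 * (k / (k + 1)) * (n ^ 2 * p * l) := by
        refine mul_le_mul_of_nonneg_right ?_ (by positivity)
        rw [← mul_div_assoc, div_le_div_iff₀ (by positivity) (by positivity)]
        have hk1 : 0 ≤ (k : ℝ) * (k - 1) := mul_nonneg (by linarith) (by linarith)
        nlinarith [mul_nonneg hk1 (by linarith : (0 : ℝ) ≤ k + 1)]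

lemma Regime.log_le {k n : ℕ} {p c : ℝ} (hR : Regime k c n p) (hn : 0 < n)
    (hl0 : 0 < Real.log n) (hl : Real.log n ≤ (n : ℝ) ^ (0.01 : ℝ)) (hk : 1 ≤ k) :
    Real.log p ≤ -(0.99 * (k / (k + 1)) * Real.log n) := by
  have hn' : (0 : ℝ) < n := by exact_mod_cast hn
  have hk' : (1 : ℝ) ≤ k := by exact_mod_cast hk
  have h := Real.log_le_log (mul_pos (pow_pos hn' k) (pow_pos hR.pos (k + 1))) hR.le_log
  have h2 := Real.log_le_log hl0 hl
  rw [Real.log_rpow hn'] at h2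
  rw [Real.log_mul (by positivity) (pow_pos hR.pos _).ne', Real.log_pow, Real.log_pow] at h
  push_cast at h
  have h3 : (k + 1) * Real.log p ≤ -(0.99 * k * Real.log n) := by nlinarith
  have h4 : -(0.99 * ((k : ℝ) / (k + 1)) * Real.log n) = -(0.99 * k * Real.log n) / (k + 1) := by
    field_simp
  rw [h4, le_div_iff₀ (by positivity)]
  linarith

/-- The case `n^k p^(k+1) ≥ 1/2`: there are fewer typical vectors of queried distances than typical
graphs. -/
theorem eventually_prob_reconstructs_le_of_half_le (k : ℕ) (hk : 1 ≤ k) {c : ℝ} (hc : 0 < c)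
    (hc1 : c ≤ 1) :
    ∀ᶠ n : ℕ in atTop, ∀ p : ℝ, Regime k c n p → 1 / 2 ≤ (n : ℝ) ^ k * p ^ (k + 1) →
      ∀ Q : Finset (Sym2 (Fin n)), (∀ e ∈ Q, ¬ e.IsDiag) → FewQueries k n p Q →
      prob p {s : Finset (Sym2 (Fin n)) | Reconstructs (Q : Set (Sym2 (Fin n))) (graph s)} ≤
        9 / 10 := by
  filter_upwards [eventually_prob_exists_far_le k hk hc, eventually_prob_ncard_edgeSet_le k hc,
    eventually_prob_edist_ne_le k hc hc1, eventually_ge_atTop 8000, eventually_le_log 1,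
    eventually_mul_log_pow_le 1 1 (c := 0.01) (by norm_num)]
    with n hfar hedges hatyp hn8 hl1 hloglog p hR hhalf Q hQ hcard
  have h0 := hR.pos.le
  have h1 := hR.lt_one.le
  have hn : (8000 : ℝ) ≤ n := by exact_mod_cast hn8
  have hk' : (1 : ℝ) ≤ k := by exact_mod_cast hk
  have hX1 : 1 ≤ (n : ℝ) * p := (Real.one_le_rpow (by linarith) hc.le).trans hR.rpow_le
  set lam := (n : ℝ) ^ k * p ^ (k + 1) with hlam
  set q : ℝ := (Q.card : ℝ) with hq
  have hq0 : 0 ≤ q := Nat.cast_nonneg _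
  set M := ⌊1.44 * (q * Real.exp (-lam))⌋₊ with hM
  set B := p * (n.choose 2 : ℝ) with hB
  set E := ⌊0.9 * B⌋₊ with hE
  have hB0 : 0 ≤ B := by positivity
  have hqe : 0 ≤ q * Real.exp (-lam) := mul_nonneg hq0 (Real.exp_pos _).le
  -- the weight for which the atypical distances contribute a bounded factor per expected one
  set t := Real.exp (-lam) / (k + 1) with ht
  have ht0 : 0 < t := by positivity
  have ht1 : t ≤ 1 := by
    rw [ht, div_le_one (by positivity)]
    have : Real.exp (-lam) ≤ 1 := Real.exp_le_one_iff.2 (by linarith)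
    linarith
  have P1 := prob_reconstructs_typical_le h0 h1 Q hQ k M (E + 1) ht0 ht1
  have P2 := hfar p hR Q hQ hcard
  have P3 := prob_card_atypicalPairs_le h0 h1 Q hQ (k + 1) (hatyp p hR) M
  have P4 := hedges p hR E (Nat.floor_le (by positivity))
  set A1 : Set (Finset (Sym2 (Fin n))) := {s | Reconstructs (Q : Set (Sym2 (Fin n))) (graph s) ∧
      (∀ e ∈ Q, pairDist (graph s) e ≤ (k + 2 : ℕ)) ∧
      (atypicalPairs Q (k + 1) (graph s)).card ≤ M ∧ E + 1 ≤ (graph s).edgeSet.ncard}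
  set A2 : Set (Finset (Sym2 (Fin n))) := {s | ¬ ∀ e ∈ Q, pairDist (graph s) e ≤ (k + 2 : ℕ)}
  set A3 : Set (Finset (Sym2 (Fin n))) := {s | ¬ (atypicalPairs Q (k + 1) (graph s)).card ≤ M}
  set A4 : Set (Finset (Sym2 (Fin n))) := {s | (graph s).edgeSet.ncard ≤ E}
  have hsub : {s : Finset (Sym2 (Fin n)) | Reconstructs (Q : Set (Sym2 (Fin n))) (graph s)} ⊆
      (A1 ∪ A2) ∪ (A3 ∪ A4) := by
    intro s hs
    by_cases h2 : s ∈ A2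
    · exact Or.inl (Or.inr h2)
    by_cases h3 : s ∈ A3
    · exact Or.inr (Or.inl h3)
    by_cases h4 : s ∈ A4
    · exact Or.inr (Or.inr h4)
    refine Or.inl (Or.inl ⟨hs, not_not.1 h2, not_not.1 h3, ?_⟩)
    have : ¬ (graph s).edgeSet.ncard ≤ E := h4
    omega
  have htot := (prob_mono h0 h1 hsub).trans ((prob_union_le h0 h1 _ _).trans
    (add_le_add (prob_union_le h0 h1 _ _) (prob_union_le h0 h1 _ _)))
  have P3' : prob p A3 ≤ 5 / 6 := by
    have hM1 : 1.44 * (q * Real.exp (-lam)) ≤ M + 1 := (Nat.lt_floor_add_one _).le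
    have hMpos : (0 : ℝ) < M + 1 := by positivity
    have : (M + 1) * prob p A3 ≤ (M + 1) * (5 / 6 : ℝ) := P3.trans (by linarith)
    exact le_of_mul_le_mul_left this hMpos
  have P1' : prob p A1 ≤ 1 / 100 := by
    refine P1.trans ?_
    have b1 : (t ^ M)⁻¹ ≤ Real.exp (1.44 * (q * Real.exp (-lam)) * (lam + k)) := by
      have : t⁻¹ ≤ Real.exp (lam + k) := by
        rw [ht, inv_div, Real.exp_neg, div_inv_eq_mul, Real.exp_add, mul_comm]
        refine mul_le_mul_of_nonneg_left ?_ (Real.exp_pos _).le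
        linarith [Real.add_one_le_exp (k : ℝ)]
      rw [← inv_pow]
      refine (pow_le_pow_left₀ (by positivity) this M).trans ?_
      rw [← Real.exp_nat_mul]
      refine Real.exp_le_exp.2 (mul_le_mul_of_nonneg_right (Nat.floor_le (by positivity)) ?_)
      linarith
    have b2 : (1 + (k + 1) * t) ^ Q.card ≤ Real.exp (q * Real.exp (-lam)) := by
      have : 1 + (k + 1) * t ≤ Real.exp (Real.exp (-lam)) := by
        have e : ((k : ℝ) + 1) * t = Real.exp (-lam) := by rw [ht]; field_simp
        rw [e, add_comm]
        exact Real.add_one_le_exp _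
      refine (pow_le_pow_left₀ (by positivity) this _).trans (le_of_eq ?_)
      rw [← Real.exp_nat_mul]
    have b3 : p ^ (E + 1) ≤ Real.exp (0.9 * B * Real.log p) := by
      have hlogp : Real.log p ≤ 0 := Real.log_nonpos h0 h1
      calc p ^ (E + 1) = Real.exp ((E + 1 : ℕ) * Real.log p) := by
            rw [Real.exp_nat_mul, Real.exp_log hR.pos]
        _ ≤ _ := by
            refine Real.exp_le_exp.2 (mul_le_mul_of_nonpos_right ?_ hlogp)
            push_cast
            exact (Nat.lt_floor_add_one _).le
    have b4 := entropy_exponent_le hk hR (by omega) hlam hhalf hq0 hcard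
    have b5 := hR.log_le (by omega) (by linarith) (by simpa using hloglog) hk
    -- both exponents are multiples of `r n² p log n`: the entropy of the distances contributes at most
    -- `0.395`, the entropy of the graph at least `0.9 * 0.495 * 0.99 > 0.44`
    set l := Real.log n
    set r : ℝ := (k : ℝ) / (k + 1) with hr
    have hr0 : 1 / 2 ≤ r := by
      rw [hr, div_le_div_iff₀ (by norm_num) (by positivity)]; linarith
    have hBn : 0.495 * (n ^ 2 * p) ≤ B := by
      rw [hB, Nat.cast_choose_two]
      have hpn : 0 ≤ p * n := mul_nonneg h0 (by linarith)
      nlinarith [mul_nonneg hpn (by linarith : (0 : ℝ) ≤ n - 8000)]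
    calc (t ^ M)⁻¹ * (1 + (k + 1) * t) ^ Q.card * p ^ (E + 1)
        ≤ Real.exp (1.44 * (q * Real.exp (-lam)) * (lam + k)) * Real.exp (q * Real.exp (-lam)) *
          Real.exp (0.9 * B * Real.log p) := by
          refine mul_le_mul (mul_le_mul b1 b2 (by positivity) (Real.exp_pos _).le) b3
            (by positivity) (by positivity)
      _ = Real.exp (q * Real.exp (-lam) * (1.44 * lam + 1.44 * k + 1) + 0.9 * B * Real.log p) := by
          rw [← Real.exp_add, ← Real.exp_add]; congr 1; ring
      _ ≤ Real.exp (-5) := by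
          refine Real.exp_le_exp.2 ?_
          have c1 : 0.9 * B * Real.log p ≤ 0.9 * B * -(0.99 * r * l) :=
            mul_le_mul_of_nonneg_left b5 (by positivity)
          have c2 : 0.495 * (n ^ 2 * p) * (r * l) ≤ B * (r * l) :=
            mul_le_mul_of_nonneg_right hBn (by positivity)
          have c3 : 4000 ≤ (n ^ 2 * p) * (r * l) := by
            have d1 : 8000 ≤ (n : ℝ) ^ 2 * p := by
              calc (8000 : ℝ) ≤ n * 1 := by linarith
                _ ≤ n * (n * p) := mul_le_mul_of_nonneg_left hX1 (by linarith)
                _ = _ := by ring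
            have d2 : 1 / 2 ≤ r * l := by
              calc (1 / 2 : ℝ) = 1 / 2 * 1 := by norm_num
                _ ≤ r * l := mul_le_mul hr0 hl1 (by norm_num) (by linarith)
            calc (4000 : ℝ) = 8000 * (1 / 2) := by norm_num
              _ ≤ _ := mul_le_mul d1 d2 (by norm_num) (by linarith)
          have c4 : (0.395 : ℝ) * r * (n ^ 2 * p * l) = 0.395 * ((n ^ 2 * p) * (r * l)) := by ring
          have c5 : 0.9 * B * -(0.99 * r * l) = -(0.891 * (B * (r * l))) := by ring
          have c6 : 0.495 * ((n : ℝ) ^ 2 * p) * (r * l) = 0.495 * ((n ^ 2 * p) * (r * l)) := by ring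
          linarith
      _ ≤ 1 / 100 := exp_neg_five_le
  linarith

end RandomSubset

/-! ### Non-edges that no query detects -/

namespace RandomSubset

section Deterministic

variable {V : Type*}

/-- The edges of `G` with no end in `S`. -/
def outside (S : Set V) (G : SimpleGraph V) : SimpleGraph V where
  Adj u v := G.Adj u v ∧ u ∉ S ∧ v ∉ S
  symm := ⟨fun _ _ h => ⟨h.1.symm, h.2.2, h.2.1⟩⟩
  loopless := ⟨fun _ h => h.1.ne rfl⟩

/-- The vertices outside `S` that can be reached from `u` by at most `r` steps outside `S`. -/
def outsideBall (S : Set V) (G : SimpleGraph V) (r : ℕ) (u : V) : Set V :=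
  {w | w ∉ S ∧ (outside S G).edist u w ≤ r}

lemma outsideBall_mono {S : Set V} {G : SimpleGraph V} {r r' : ℕ} (h : r ≤ r') (u : V) :
    outsideBall S G r u ⊆ outsideBall S G r' u :=
  fun _ hw => ⟨hw.1, hw.2.trans (by exact_mod_cast h)⟩

/-- No pair `uv` of `Q` satisfies `d(u, x) + d(v, y) ≤ k`, where only paths are taken into account that
leave `x` and `y` to a vertex outside `S` and then stay outside `S`. -/
structure Uncovered (S : Set V) (Q : Set (Sym2 V)) (k : ℕ) (x y : V) (G : SimpleGraph V) : Prop where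
  inner : ∀ u ∉ S, ∀ v ∉ S, s(u, v) ∈ Q → ∀ a < k - 1,
    ¬ ((∃ w ∈ outsideBall S G a u, G.Adj x w) ∧ ∃ w ∈ outsideBall S G (k - 2 - a) v, G.Adj y w)
  left : ∀ v ∉ S, s(x, v) ∈ Q → ¬ ∃ w ∈ outsideBall S G (k - 1) v, G.Adj y w
  right : ∀ u ∉ S, s(u, y) ∈ Q → ¬ ∃ w ∈ outsideBall S G (k - 1) u, G.Adj x w

lemma exists_mem_outsideBall {S : Set V} {G : SimpleGraph V} {k i : ℕ} (hik : i ≤ k) {x u : V}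
    (hx : ∀ t ∈ S, t ≠ x → (k : ℕ∞) < G.edist x t) (hxS : x ∈ S) (hu : u ∉ S)
    (h : G.edist u x ≤ i) : ∃ w ∈ outsideBall S G (i - 1) u, G.Adj x w := by
  classical
  rw [SimpleGraph.edist_comm] at h
  have hreach : G.Reachable x u := by
    rw [← SimpleGraph.edist_ne_top_iff_reachable]
    exact ne_top_of_le_ne_top (ENat.natCast_ne_top i) h
  obtain ⟨q, hq, hql⟩ := hreach.exists_path_of_dist
  have hlen : q.length ≤ i := by
    rw [hql]
    rw [← hreach.coe_dist_eq_edist] at h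
    exact_mod_cast h
  cases q with
  | nil => exact absurd hxS hu
  | @cons _ w _ hadj q' =>
    rw [SimpleGraph.Walk.cons_isPath_iff] at hq
    rw [SimpleGraph.Walk.length_cons] at hlen
    have hout : ∀ t ∈ q'.support, t ∉ S := by
      intro t ht htS
      have htx : t ≠ x := fun h => hq.2 (h ▸ ht)
      have h1 : G.edist x t ≤ ((SimpleGraph.Walk.cons hadj (q'.takeUntil t ht)).length : ℕ) :=
        SimpleGraph.edist_le _
      have h2 : (SimpleGraph.Walk.cons hadj (q'.takeUntil t ht)).length ≤ k := by
        rw [SimpleGraph.Walk.length_cons]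
        have := q'.length_takeUntil_le_length ht
        omega
      exact absurd (hx t htS htx) (not_lt.2 (h1.trans (by exact_mod_cast h2)))
    have hedges : ∀ e ∈ q'.edges, e ∈ (outside S G).edgeSet := by
      intro e he
      induction e using Sym2.ind with
      | _ a b =>
        exact ⟨q'.adj_of_mem_edges he, hout a (q'.fst_mem_support_of_mem_edges he),
          hout b (q'.snd_mem_support_of_mem_edges he)⟩
    refine ⟨w, ⟨hout w q'.start_mem_support, ?_⟩, hadj⟩
    rw [SimpleGraph.edist_comm]
    refine (SimpleGraph.edist_le (q'.transfer _ hedges)).trans ?_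
    rw [SimpleGraph.Walk.length_transfer]
    exact_mod_cast (by omega : q'.length ≤ i - 1)

/-- A walk in `G` with the additional edge `xy` can be replaced by one that uses this edge at most
once. -/
lemma edist_le_of_walk_sup_edge {G : SimpleGraph V} {x y : V} {u v : V}
    (q : (G ⊔ SimpleGraph.edge x y).Walk u v) :
    G.edist u v ≤ q.length ∨ G.edist u x + G.edist y v + 1 ≤ q.length ∨
      G.edist u y + G.edist x v + 1 ≤ q.length := by
  induction q with
  | nil => left; simp
  | @cons u t v hadj q ih =>
    rw [SimpleGraph.Walk.length_cons]
    push_cast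
    have hstep : ∀ {a b c d : ℕ∞}, a ≤ c + b → b ≤ d → c ≤ 1 → a ≤ d + 1 := by
      intro a b c d h1 h2 h3
      rw [add_comm d 1]
      exact h1.trans (add_le_add h3 h2)
    have hstep2 : ∀ {a b c d e : ℕ∞}, a ≤ c + b → b + e + 1 ≤ d → c ≤ 1 → a + e + 1 ≤ d + 1 := by
      intro a b c d e h1 h2 h3
      refine add_le_add_left ?_ 1
      calc a + e ≤ c + b + e := add_le_add_left h1 e
        _ ≤ 1 + b + e := by gcongr
        _ = b + e + 1 := by ring
        _ ≤ d := h2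
    have hself : ∀ {a b d : ℕ∞}, a + b + 1 ≤ d → b ≤ d := fun h =>
      (le_add_left le_rfl).trans ((le_add_right le_rfl).trans h)
    rw [SimpleGraph.sup_adj, SimpleGraph.edge_adj] at hadj
    rcases hadj with hadj | ⟨⟨rfl, rfl⟩ | ⟨rfl, rfl⟩, -⟩
    · have h1 : G.edist u t ≤ 1 := (SimpleGraph.edist_eq_one_iff_adj.2 hadj).le
      rcases ih with ih | ih | ih
      · exact Or.inl (hstep (SimpleGraph.edist_triangle (v := t)) ih h1)
      · exact Or.inr (Or.inl (hstep2 (SimpleGraph.edist_triangle (v := t)) ih h1))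
      · exact Or.inr (Or.inr (hstep2 (SimpleGraph.edist_triangle (v := t)) ih h1))
    · rw [SimpleGraph.edist_self, zero_add]
      rcases ih with ih | ih | ih
      · exact Or.inr (Or.inl (add_le_add_left ih 1))
      · exact Or.inr (Or.inl (add_le_add_left (hself ih) 1))
      · exact Or.inl ((hself ih).trans (le_add_right le_rfl))
    · rw [SimpleGraph.edist_self, zero_add]
      rcases ih with ih | ih | ih
      · exact Or.inr (Or.inr (add_le_add_left ih 1))
      · exact Or.inl ((hself ih).trans (le_add_right le_rfl))
      · exact Or.inr (Or.inr (add_le_add_left (hself ih) 1))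

/-- If the vertices of `S` are far apart, an uncovered pair can be added to the graph without changing
the queried distances. -/
lemma Uncovered.not_reconstructs {S : Set V} {Q : Set (Sym2 V)} {k : ℕ} (hk : 1 ≤ k) {x y : V}
    {G : SimpleGraph V} (h : Uncovered S Q k x y G) (hxS : x ∈ S) (hyS : y ∈ S) (hxy : x ≠ y)
    (hQ : s(x, y) ∉ Q) (hS : ∀ s ∈ S, ∀ t ∈ S, t ≠ s → (k : ℕ∞) < G.edist s t)
    (hfar : ∀ u v, s(u, v) ∈ Q → G.edist u v ≤ (k + 2 : ℕ)) : ¬ Reconstructs Q G := by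
  intro hrec
  have key : ∀ u v, s(u, v) ∈ Q → ¬ G.edist u x + G.edist y v ≤ k := by
    intro u v huv hle
    have hnat : ∀ {a b : ℕ∞}, a + b ≤ (k : ℕ∞) → ∃ i j : ℕ, a = i ∧ b = j ∧ i + j ≤ k := by
      intro a b hab
      have ha : a ≠ ⊤ := ne_top_of_le_ne_top (ENat.natCast_ne_top k) ((le_add_right le_rfl).trans hab)
      have hb : b ≠ ⊤ := ne_top_of_le_ne_top (ENat.natCast_ne_top k) ((le_add_left le_rfl).trans hab)
      lift a to ℕ using ha
      lift b to ℕ using hb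
      exact ⟨a, b, rfl, rfl, by exact_mod_cast hab⟩
    obtain ⟨i, j, hi, hj, hij⟩ := hnat hle
    have hiu : G.edist u x ≤ i := hi.le
    have hjv : G.edist v y ≤ j := by rw [SimpleGraph.edist_comm]; exact hj.le
    have hx := fun t ht htx => hS x hxS t ht htx
    have hy := fun t ht hty => hS y hyS t ht hty
    have hcast : ∀ {a : ℕ}, a ≤ k → (a : ℕ∞) ≤ (k : ℕ∞) := fun h => by exact_mod_cast h
    have huS : u ∈ S → u = x := by
      intro huS
      by_contra hne
      have := hx u huS hne
      rw [SimpleGraph.edist_comm, hi] at this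
      exact absurd this (not_lt.2 (hcast (by omega)))
    have hvS : v ∈ S → v = y := by
      intro hvS
      by_contra hne
      have := hy v hvS hne
      rw [hj] at this
      exact absurd this (not_lt.2 (hcast (by omega)))
    by_cases hu : u ∈ S
    · have hux := huS hu
      subst hux
      have hv : v ∉ S := fun hv => hQ (by rw [← hvS hv]; exact huv)
      obtain ⟨w, hw, hadj⟩ := exists_mem_outsideBall (by omega : j ≤ k) hy hyS hv hjv
      exact h.left v hv huv ⟨w, outsideBall_mono (by omega) v hw, hadj⟩
    · obtain ⟨w, hw, hadj⟩ := exists_mem_outsideBall (by omega : i ≤ k) hx hxS hu hiu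
      by_cases hv : v ∈ S
      · have hvy := hvS hv
        subst hvy
        exact h.right u hu huv ⟨w, outsideBall_mono (by omega) u hw, hadj⟩
      · obtain ⟨w', hw', hadj'⟩ := exists_mem_outsideBall (by omega : j ≤ k) hy hyS hv hjv
        have hi1 : i ≠ 0 := by
          rintro rfl
          have hux : u = x := SimpleGraph.edist_eq_zero_iff.1 (by rw [hi]; rfl)
          exact hu (by rw [hux]; exact hxS)
        have hj1 : j ≠ 0 := by
          rintro rfl
          have hyv : y = v := SimpleGraph.edist_eq_zero_iff.1 (by rw [hj]; rfl)
          exact hv (by rw [← hyv]; exact hyS)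
        exact h.inner u hu v hv huv (i - 1) (by omega)
          ⟨⟨w, hw, hadj⟩, ⟨w', outsideBall_mono (by omega) v hw', hadj'⟩⟩
  have hnadj : ¬ G.Adj x y := by
    intro hadj
    have := hS x hxS y hyS hxy.symm
    rw [SimpleGraph.edist_eq_one_iff_adj.2 hadj] at this
    exact absurd this (not_lt.2 (by exact_mod_cast hk))
  have heq := hrec (G ⊔ SimpleGraph.edge x y) (by
    intro u v huv
    refine le_antisymm (SimpleGraph.edist_anti le_sup_left) ?_
    by_contra hlt
    rw [not_le] at hlt
    have hlt2 := lt_of_lt_of_le hlt (hfar u v huv)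
    obtain ⟨q, hq⟩ := SimpleGraph.exists_walk_of_edist_ne_top (ne_top_of_lt hlt)
    have hlen : (q.length : ℕ∞) ≤ k + 1 := by
      rw [hq]
      push_cast at hlt2
      rw [show (k : ℕ∞) + 2 = ((k + 1 : ℕ) : ℕ∞) + 1 by push_cast; ring] at hlt2
      have := ENat.lt_natCast_add_one_iff.1 hlt2
      push_cast at this
      exact this
    have hcancel : ∀ {a : ℕ∞}, a + 1 ≤ q.length → a ≤ k := fun ha =>
      (ENat.add_le_add_iff_right ENat.one_ne_top).1 (ha.trans hlen)
    rcases edist_le_of_walk_sup_edge q with h1 | h1 | h1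
    · rw [hq] at h1
      exact absurd hlt (not_lt.2 h1)
    · exact key u v huv (hcancel h1)
    · refine key v u (by rwa [Sym2.eq_swap]) ?_
      rw [add_comm, SimpleGraph.edist_comm, SimpleGraph.edist_comm (u := v)]
      exact hcancel h1)
  have : (G ⊔ SimpleGraph.edge x y).Adj x y := by
    rw [SimpleGraph.sup_adj, SimpleGraph.edge_adj]
    exact Or.inr ⟨Or.inl ⟨rfl, rfl⟩, hxy⟩
  rw [heq] at this
  exact hnadj this

end Deterministic

end RandomSubset

namespace RandomSubset

/-! ### The conditional probability that a pair is uncovered -/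

variable {V : Type*} [Fintype V] [DecidableEq V] {p : ℝ}

/-- The pairs joining `x` or `y` to a vertex outside `S`. -/
def pairEdges (S : Finset V) (x y : V) : Finset (Sym2 V) :=
  (Sᶜ ×ˢ {x, y}).image fun e => s(e.2, e.1)

lemma mem_pairEdges {S : Finset V} {x y : V} {e : Sym2 V} :
    e ∈ pairEdges S x y ↔ ∃ w ∉ S, e = s(x, w) ∨ e = s(y, w) := by
  simp only [pairEdges, Finset.mem_image, Finset.mem_product, Finset.mem_compl, Finset.mem_insert,
    Finset.mem_singleton, Prod.exists]
  constructor
  · rintro ⟨w, z, ⟨hw, rfl | rfl⟩, rfl⟩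
    · exact ⟨w, hw, Or.inl rfl⟩
    · exact ⟨w, hw, Or.inr rfl⟩
  · rintro ⟨w, hw, rfl | rfl⟩
    · exact ⟨w, x, ⟨hw, Or.inl rfl⟩, rfl⟩
    · exact ⟨w, y, ⟨hw, Or.inr rfl⟩, rfl⟩

omit [Fintype V] in
lemma mem_iff_of_mem_fiber {E s t : Finset (Sym2 V)} (h : t ∈ fiber E s) {e : Sym2 V} (he : e ∉ E) :
    e ∈ t ↔ e ∈ s := by
  have h' : t \ E = s \ E := h
  have := Finset.ext_iff.1 h' e
  simpa [he] using this

lemma outside_eq_of_mem_fiber {S : Finset V} {x y : V} (hx : x ∈ S) (hy : y ∈ S)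
    {s t : Finset (Sym2 V)} (h : t ∈ fiber (pairEdges S x y) s) :
    outside (S : Set V) (graph t) = outside (S : Set V) (graph s) := by
  ext u v
  simp only [outside, Finset.mem_coe]
  refine and_congr_left fun ⟨hu, hv⟩ => ?_
  rw [graph_adj, graph_adj, mem_iff_of_mem_fiber h]
  rw [mem_pairEdges]
  rintro ⟨w, hw, h | h⟩
  · rcases Sym2.eq_iff.1 h with ⟨rfl, _⟩ | ⟨_, rfl⟩
    · exact hu hx
    · exact hv hx
  · rcases Sym2.eq_iff.1 h with ⟨rfl, _⟩ | ⟨_, rfl⟩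
    · exact hu hy
    · exact hv hy

lemma adj_iff_of_mem_fiber {S : Finset V} {x y z w : V}
    (hz : z ∈ S) (hzx : z ≠ x) (hzy : z ≠ y)
    {s t : Finset (Sym2 V)} (h : t ∈ fiber (pairEdges S x y) s) :
    (graph t).Adj z w ↔ (graph s).Adj z w := by
  rw [graph_adj, graph_adj, mem_iff_of_mem_fiber h]
  rw [mem_pairEdges]
  rintro ⟨w', hw', h | h⟩
  · rcases Sym2.eq_iff.1 h with ⟨rfl, _⟩ | ⟨rfl, rfl⟩
    · exact hzx rfl
    · exact hw' hz
  · rcases Sym2.eq_iff.1 h with ⟨rfl, _⟩ | ⟨rfl, rfl⟩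
    · exact hzy rfl
    · exact hw' hz

omit [Fintype V] [DecidableEq V] in
lemma Uncovered.congr {S : Set V} {Q : Set (Sym2 V)} {k : ℕ} {x y : V} {G G' : SimpleGraph V}
    (ho : outside S G = outside S G') (hx : ∀ w ∉ S, G.Adj x w ↔ G'.Adj x w)
    (hy : ∀ w ∉ S, G.Adj y w ↔ G'.Adj y w) (h : Uncovered S Q k x y G) : Uncovered S Q k x y G' := by
  have hb : ∀ r u, outsideBall S G' r u = outsideBall S G r u := fun r u => by
    simp only [outsideBall, ho]
  have hx' : ∀ r u, (∃ w ∈ outsideBall S G' r u, G'.Adj x w) →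
      ∃ w ∈ outsideBall S G r u, G.Adj x w := by
    rintro r u ⟨w, hw, hadj⟩
    rw [hb] at hw
    exact ⟨w, hw, (hx w hw.1).2 hadj⟩
  have hy' : ∀ r u, (∃ w ∈ outsideBall S G' r u, G'.Adj y w) →
      ∃ w ∈ outsideBall S G r u, G.Adj y w := by
    rintro r u ⟨w, hw, hadj⟩
    rw [hb] at hw
    exact ⟨w, hw, (hy w hw.1).2 hadj⟩
  exact ⟨fun u hu v hv huv a ha hcon => h.inner u hu v hv huv a ha ⟨hx' _ _ hcon.1, hy' _ _ hcon.2⟩,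
    fun v hv hxv hcon => h.left v hv hxv (hy' _ _ hcon),
    fun u hu huy hcon => h.right u hu huy (hx' _ _ hcon)⟩

/-- The number of ordered pairs in a set of unordered pairs. -/
lemma card_filter_mk_mem_le (Q : Finset (Sym2 V)) :
    (Finset.univ.filter fun e : V × V => s(e.1, e.2) ∈ Q).card ≤ 2 * Q.card := by
  refine (Finset.card_le_mul_card_image_of_maps_to (t := Q) (f := fun e : V × V => s(e.1, e.2))
    (fun e he => by simpa using he) 2 fun e _ => ?_)
  induction e using Sym2.ind with
  | _ u v =>
    refine (Finset.card_le_card (t := {(u, v), (v, u)}) ?_).trans Finset.card_le_two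
    rintro ⟨a, b⟩ h
    simp only [Finset.mem_filter, Sym2.eq_iff] at h
    simp only [Finset.mem_insert, Finset.mem_singleton, Prod.mk.injEq]
    exact h.2

/-- The number of pairs of `Q` that contain `v`. -/
def queryDegree (Q : Finset (Sym2 V)) (v : V) : ℕ := (Finset.univ.filter fun w => s(v, w) ∈ Q).card

lemma sum_queryDegree_le (Q : Finset (Sym2 V)) : ∑ v, queryDegree Q v ≤ 2 * Q.card := by
  refine le_trans (le_of_eq ?_) (card_filter_mk_mem_le Q)
  simp only [queryDegree, Finset.card_filter]
  rw [Fintype.sum_prod_type]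

lemma exp_neg_le_one_sub {z : ℝ} (hz0 : 0 ≤ z) (hz : z ≤ 1 / 200) :
    Real.exp (-(1.01 * z)) ≤ 1 - z := by
  rw [Real.exp_neg, inv_le_comm₀ (Real.exp_pos _) (by linarith)]
  have h := Real.add_one_le_exp (1.01 * z)
  refine le_trans ?_ h
  rw [inv_le_iff_one_le_mul₀ (by linarith)]
  nlinarith

/-- Conditionally on all edges but those at `x` and `y`, the pair `xy` is uncovered with a probability
that the Harris inequality bounds from below in terms of the expected number of coverings. -/
lemma exp_mul_prob_fiber_le (h0 : 0 ≤ p) (h1 : p ≤ 1) {S : Finset V} {Q : Finset (Sym2 V)} {k : ℕ}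
    {x y : V} (hx : x ∈ S) (hy : y ∈ S) (hxy : x ≠ y) {s : Finset (Sym2 V)} {β : ℕ → ℝ}
    (hβ : ∀ u ∉ S, ∀ r, ((outsideBall (S : Set V) (graph s) r u).ncard : ℝ) ≤ β r)
    {z₁ z₂ : ℝ} (hz1 : ∀ a < k - 1, β a * β (k - 2 - a) * p ^ 2 ≤ z₁)
    (hz2 : β (k - 1) * p ≤ z₂) (hz10 : 0 ≤ z₁) (hz20 : 0 ≤ z₂) (hz11 : z₁ ≤ 1 / 200)
    (hz21 : z₂ ≤ 1 / 200) :
    Real.exp (-(1.01 * ((k - 1 : ℕ) * (2 * Q.card) * z₁ +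
      (queryDegree Q x + queryDegree Q y) * z₂))) * prob p (fiber (pairEdges S x y) s) ≤
      prob p (fiber (pairEdges S x y) s ∩
        {t | Uncovered (S : Set V) (Q : Set (Sym2 V)) k x y (graph t)}) := by
  classical
  set L := fiber (pairEdges S x y) s with hL
  set ball : ℕ → V → Finset V := fun r u => (outsideBall (S : Set V) (graph s) r u).toFinite.toFinset
    with hball
  have hmem : ∀ {r u w}, w ∈ ball r u ↔ w ∈ outsideBall (S : Set V) (graph s) r u := by
    intro r u w; simp [hball]
  have hballS : ∀ {r u w}, w ∈ ball r u → w ∉ S := fun h => (hmem.1 h).1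
  have hcard : ∀ u ∉ S, ∀ r, ((ball r u).card : ℝ) ≤ β r := by
    intro u hu r
    refine le_trans (le_of_eq ?_) (hβ u hu r)
    rw [Set.ncard_eq_toFinset_card _ (Set.toFinite _)]
  have hL0 : 0 ≤ prob p L := prob_nonneg h0 h1 L
  -- `A₁` and `A₂` are the increasing events that violate one of the fields of `Uncovered`
  set A₁ : V × V × ℕ → Set (Finset (Sym2 V)) := fun e =>
    ⋃ c ∈ ball e.2.2 e.1 ×ˢ ball (k - 2 - e.2.2) e.2.1,
      {t | ({s(x, c.1), s(y, c.2)} : Finset (Sym2 V)) ⊆ t} with hA₁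
  set A₂ : V × V → Set (Finset (Sym2 V)) := fun e =>
    ⋃ c ∈ ball (k - 1) e.2, {t | ({s(e.1, c)} : Finset (Sym2 V)) ⊆ t} with hA₂
  set T₁ : Finset (V × V × ℕ) := ((Finset.univ.filter fun e : V × V => s(e.1, e.2) ∈ Q ∧ e.1 ∉ S ∧
    e.2 ∉ S) ×ˢ Finset.range (k - 1)).image fun e => (e.1.1, e.1.2, e.2) with hT₁
  set T₂ : Finset (V × V) := (Finset.univ.filter fun v => s(x, v) ∈ Q ∧ v ∉ S).image
    fun v => (y, v) with hT₂
  set T₃ : Finset (V × V) := (Finset.univ.filter fun u => s(y, u) ∈ Q ∧ u ∉ S).image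
    fun u => (x, u) with hT₃
  have hA1z : ∀ e ∈ T₁, prob p (L ∩ A₁ e) ≤ z₁ * prob p L := by
    rintro ⟨u, v, a⟩ he
    simp only [hT₁, Finset.mem_image, Finset.mem_product, Finset.mem_filter, Finset.mem_univ,
      true_and, Finset.mem_range, Prod.mk.injEq, Prod.exists] at he
    obtain ⟨u, v, a, ⟨⟨-, hu, hv⟩, ha⟩, rfl, rfl, rfl⟩ := he
    have hsub : L ∩ A₁ (u, v, a) ⊆ ⋃ c ∈ ball a u ×ˢ ball (k - 2 - a) v,
        (L ∩ {t | ({s(x, c.1), s(y, c.2)} : Finset (Sym2 V)) ⊆ t}) := by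
      rw [hA₁, Set.inter_iUnion₂]
    have hc : ∀ c ∈ ball a u ×ˢ ball (k - 2 - a) v,
        prob p (L ∩ {t | ({s(x, c.1), s(y, c.2)} : Finset (Sym2 V)) ⊆ t}) ≤ p ^ 2 * prob p L := by
      rintro ⟨w, w'⟩ hc
      rw [Finset.mem_product] at hc
      have hw := hballS hc.1
      have hw' := hballS hc.2
      rw [hL, prob_fiber_inter_subset, Finset.card_pair]
      · intro h
        rcases Sym2.eq_iff.1 h with ⟨h, _⟩ | ⟨h, _⟩
        · exact hxy h
        · exact hw' (h ▸ hx)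
      · intro e he
        simp only [Finset.mem_insert, Finset.mem_singleton] at he
        rw [mem_pairEdges]
        rcases he with rfl | rfl
        · exact ⟨w, hw, Or.inl rfl⟩
        · exact ⟨w', hw', Or.inr rfl⟩
    refine (prob_mono h0 h1 hsub).trans ((prob_biUnion_le h0 h1 _ _).trans
      ((Finset.sum_le_card_nsmul _ _ _ hc).trans ?_))
    rw [nsmul_eq_mul, Finset.card_product, ← mul_assoc]
    refine mul_le_mul_of_nonneg_right (le_trans ?_ (hz1 a ha)) hL0
    push_cast
    refine mul_le_mul_of_nonneg_right ?_ (by positivity)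
    exact mul_le_mul (hcard u hu a) (hcard v hv _) (Nat.cast_nonneg _)
      ((Nat.cast_nonneg _).trans (hcard u hu a))
  have hA2z : ∀ z ∈ ({x, y} : Finset V), ∀ v ∉ S, prob p (L ∩ A₂ (z, v)) ≤ z₂ * prob p L := by
    intro z hz v hv
    have hsub : L ∩ A₂ (z, v) ⊆ ⋃ c ∈ ball (k - 1) v,
        (L ∩ {t | ({s(z, c)} : Finset (Sym2 V)) ⊆ t}) := by
      rw [hA₂, Set.inter_iUnion₂]
    have hc : ∀ c ∈ ball (k - 1) v,
        prob p (L ∩ {t | ({s(z, c)} : Finset (Sym2 V)) ⊆ t}) ≤ p * prob p L := by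
      intro w hw
      rw [hL, prob_fiber_inter_subset, Finset.card_singleton, pow_one]
      intro e he
      rw [Finset.mem_singleton] at he
      rw [mem_pairEdges]
      simp only [Finset.mem_insert, Finset.mem_singleton] at hz
      rcases hz with rfl | rfl
      · exact ⟨w, hballS hw, Or.inl he⟩
      · exact ⟨w, hballS hw, Or.inr he⟩
    refine (prob_mono h0 h1 hsub).trans ((prob_biUnion_le h0 h1 _ _).trans
      ((Finset.sum_le_card_nsmul _ _ _ hc).trans ?_))
    rw [nsmul_eq_mul, ← mul_assoc]
    refine mul_le_mul_of_nonneg_right (le_trans ?_ hz2) hL0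
    exact mul_le_mul_of_nonneg_right (hcard v hv _) h0
  have hup : ∀ F : Finset (Sym2 V), IsUpperSet {t : Finset (Sym2 V) | F ⊆ t} :=
    fun F a b hab ha => Finset.Subset.trans ha hab
  set A : (V × V × ℕ) ⊕ ((V × V) ⊕ (V × V)) → Set (Finset (Sym2 V)) :=
    Sum.elim A₁ (Sum.elim A₂ A₂) with hA
  set z : (V × V × ℕ) ⊕ ((V × V) ⊕ (V × V)) → ℝ :=
    Sum.elim (fun _ => z₁) (Sum.elim (fun _ => z₂) fun _ => z₂) with hz
  set T := T₁.disjSum (T₂.disjSum T₃) with hT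
  have harris := prod_mul_prob_le_prob_inter h0 h1 (fiber_inf_sup (pairEdges S x y) s) T A (by
      rintro (e | e | e) -
      · exact isUpperSet_iUnion₂ fun c _ => hup _
      · exact isUpperSet_iUnion₂ fun c _ => hup _
      · exact isUpperSet_iUnion₂ fun c _ => hup _) z (by
      rintro (e | e | e) - <;> simp only [hz, Sum.elim_inl, Sum.elim_inr] <;> linarith) (by
      rintro (e | e | e) he
      · exact hA1z e (by simpa [hT] using he)
      · have he' : e ∈ T₂ := by simpa [hT] using he
        rw [hT₂, Finset.mem_image] at he'
        obtain ⟨v, hv, rfl⟩ := he'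
        exact hA2z y (by simp) v (by simp at hv; exact hv.2)
      · have he' : e ∈ T₃ := by simpa [hT] using he
        rw [hT₃, Finset.mem_image] at he'
        obtain ⟨v, hv, rfl⟩ := he'
        exact hA2z x (by simp) v (by simp at hv; exact hv.2))
  refine le_trans (mul_le_mul_of_nonneg_right ?_ hL0) (harris.trans (prob_mono h0 h1 ?_))
  · rw [hT, Finset.prod_disjSum, Finset.prod_disjSum]
    simp only [hz, Sum.elim_inl, Sum.elim_inr, Finset.prod_const]
    have hc1 : (T₁.card : ℝ) ≤ (k - 1 : ℕ) * (2 * Q.card) := by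
      have : T₁.card ≤ (k - 1) * (2 * Q.card) := by
        refine Finset.card_image_le.trans ?_
        rw [Finset.card_product, Finset.card_range, mul_comm]
        refine Nat.mul_le_mul_left _ (le_trans (Finset.card_le_card ?_) (card_filter_mk_mem_le Q))
        intro e he
        simp only [Finset.mem_filter, Finset.mem_univ, true_and] at he ⊢
        exact he.1
      exact_mod_cast this
    have hc2 : (T₂.card : ℝ) ≤ queryDegree Q x := by
      have : T₂.card ≤ queryDegree Q x := by
        refine Finset.card_image_le.trans (Finset.card_le_card ?_)
        intro e he
        simp only [Finset.mem_filter, Finset.mem_univ, true_and] at he ⊢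
        exact he.1
      exact_mod_cast this
    have hc3 : (T₃.card : ℝ) ≤ queryDegree Q y := by
      have : T₃.card ≤ queryDegree Q y := by
        refine Finset.card_image_le.trans (Finset.card_le_card ?_)
        intro e he
        simp only [Finset.mem_filter, Finset.mem_univ, true_and] at he ⊢
        exact he.1
      exact_mod_cast this
    have hpow : ∀ {ζ : ℝ} (m : ℕ), 0 ≤ ζ → ζ ≤ 1 / 200 →
        Real.exp (m * (-(1.01 * ζ))) ≤ (1 - ζ) ^ m := by
      intro ζ m hζ0 hζ
      rw [Real.exp_nat_mul]
      exact pow_le_pow_left₀ (Real.exp_pos _).le (exp_neg_le_one_sub hζ0 hζ) m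
    calc Real.exp (-(1.01 * ((k - 1 : ℕ) * (2 * Q.card) * z₁ +
          (queryDegree Q x + queryDegree Q y) * z₂)))
        ≤ Real.exp (T₁.card * (-(1.01 * z₁)) + (T₂.card * (-(1.01 * z₂)) +
          T₃.card * (-(1.01 * z₂)))) := by
          refine Real.exp_le_exp.2 ?_
          have d1 := mul_le_mul_of_nonneg_right hc1 hz10
          have d2 := mul_le_mul_of_nonneg_right hc2 hz20
          have d3 := mul_le_mul_of_nonneg_right hc3 hz20
          linarith
      _ ≤ (1 - z₁) ^ T₁.card * ((1 - z₂) ^ T₂.card * (1 - z₂) ^ T₃.card) := by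
          rw [Real.exp_add, Real.exp_add]
          have n1 : 0 ≤ (1 - z₁) ^ T₁.card := pow_nonneg (by linarith) _
          have n2 : 0 ≤ (1 - z₂) ^ T₂.card := pow_nonneg (by linarith) _
          exact mul_le_mul (hpow _ hz10 hz11) (mul_le_mul (hpow _ hz20 hz21) (hpow _ hz20 hz21)
            (Real.exp_pos _).le n2) (by positivity) n1
  · rintro t ⟨ht, htA⟩
    have ho := outside_eq_of_mem_fiber hx hy ht
    have hb : ∀ r u, outsideBall (S : Set V) (graph t) r u = outsideBall (S : Set V) (graph s) r u :=
      fun r u => by simp only [outsideBall, ho]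
    refine ⟨ht, ?_, ?_, ?_⟩
    · rintro u hu v hv huv a ha ⟨⟨w, hw, hadj⟩, w', hw', hadj'⟩
      rw [hb] at hw hw'
      refine htA (Sum.inl (u, v, a)) ?_ ?_
      · rw [hT, Finset.inl_mem_disjSum, hT₁, Finset.mem_image]
        exact ⟨((u, v), a), by simpa using ⟨⟨huv, hu, hv⟩, ha⟩, rfl⟩
      · simp only [hA, hA₁, Sum.elim_inl, Set.mem_iUnion]
        refine ⟨(w, w'), Finset.mem_product.2 ⟨hmem.2 hw, hmem.2 hw'⟩, ?_⟩
        rw [graph_adj] at hadj hadj'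
        intro e he
        simp only [Finset.mem_insert, Finset.mem_singleton] at he
        rcases he with rfl | rfl
        · exact hadj.1
        · exact hadj'.1
    · rintro v hv hxv ⟨w, hw, hadj⟩
      rw [hb] at hw
      refine htA (Sum.inr (Sum.inl (y, v))) ?_ ?_
      · rw [hT, Finset.inr_mem_disjSum, Finset.inl_mem_disjSum, hT₂, Finset.mem_image]
        exact ⟨v, by simpa using ⟨hxv, hv⟩, rfl⟩
      · simp only [hA, hA₂, Sum.elim_inl, Sum.elim_inr, Set.mem_iUnion]
        refine ⟨w, hmem.2 hw, ?_⟩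
        rw [graph_adj] at hadj
        exact Finset.singleton_subset_iff.2 hadj.1
    · rintro u hu huy ⟨w, hw, hadj⟩
      rw [hb] at hw
      refine htA (Sum.inr (Sum.inr (x, u))) ?_ ?_
      · rw [hT, Finset.inr_mem_disjSum, Finset.inr_mem_disjSum, hT₃, Finset.mem_image]
        exact ⟨u, by rw [Sym2.eq_swap] at huy; simpa using ⟨huy, hu⟩, rfl⟩
      · simp only [hA, hA₂, Sum.elim_inr, Set.mem_iUnion]
        refine ⟨w, hmem.2 hw, ?_⟩
        rw [graph_adj] at hadj
        exact Finset.singleton_subset_iff.2 hadj.1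

end RandomSubset

namespace RandomSubset

/-! ### Many disjoint pairs -/

variable {V : Type*} [Fintype V] [DecidableEq V] {p : ℝ}

omit [DecidableEq V] in
lemma outsideBall_succ_subset (S : Set V) (G : SimpleGraph V) (r : ℕ) (u : V) :
    outsideBall S G (r + 1) u ⊆
      {u} ∪ ⋃ t ∈ (outsideBall S G r u).toFinite.toFinset, {w | (outside S G).Adj t w} := by
  rintro w ⟨hwS, hw⟩
  obtain ⟨q, hq⟩ := SimpleGraph.exists_walk_of_edist_ne_top
    (ne_top_of_le_ne_top (ENat.natCast_ne_top (r + 1)) hw)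
  rw [← hq] at hw
  have hlen : q.length ≤ r + 1 := by exact_mod_cast hw
  rw [← SimpleGraph.Walk.length_reverse] at hlen
  generalize q.reverse = q' at hlen
  cases q' with
  | nil => exact Or.inl rfl
  | @cons _ t _ hadj q'' =>
    right
    rw [SimpleGraph.Walk.length_cons] at hlen
    simp only [Set.mem_iUnion, Set.Finite.mem_toFinset]
    refine ⟨t, ⟨hadj.2.2, ?_⟩, hadj.symm⟩
    rw [SimpleGraph.edist_comm]
    exact (SimpleGraph.edist_le q'').trans (by exact_mod_cast (by omega : q''.length ≤ r))

omit [DecidableEq V] in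
/-- The size of a ball in a graph of maximum degree at most `D`. -/
lemma ncard_outsideBall_le {S : Set V} {G : SimpleGraph V} {D : ℝ} (hD : 101 ≤ D)
    (hdeg : ∀ u ∉ S, ({w | (outside S G).Adj u w}.ncard : ℝ) ≤ D) (u : V) (r : ℕ) :
    ((outsideBall S G r u).ncard : ℝ) ≤ 1.01 * D ^ r := by
  -- the slack `0.01` absorbs the vertex `u` itself in the induction step, as `0.01 * (D - 1) ≥ 1`
  suffices h : ((outsideBall S G r u).ncard : ℝ) ≤ 1.01 * D ^ r - 0.01 by linarith
  induction r with
  | zero =>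
    have : outsideBall S G 0 u ⊆ {u} := by
      rintro w ⟨-, hw⟩
      have : (outside S G).edist u w = 0 := by simpa using hw
      exact (SimpleGraph.edist_eq_zero_iff.1 this).symm
    have h1 := Set.ncard_le_ncard this
    rw [Set.ncard_singleton] at h1
    have h2 : ((outsideBall S G 0 u).ncard : ℝ) ≤ 1 := by exact_mod_cast h1
    rw [pow_zero]
    linarith
  | succ r ih =>
    have h1 := (Set.ncard_le_ncard (outsideBall_succ_subset S G r u)).trans
      (Set.ncard_union_le _ _)
    rw [Set.ncard_singleton] at h1
    have h2 := Finset.set_ncard_biUnion_le (outsideBall S G r u).toFinite.toFinset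
      fun t => {w | (outside S G).Adj t w}
    have h3 : ((outsideBall S G (r + 1) u).ncard : ℝ) ≤
        1 + ∑ t ∈ (outsideBall S G r u).toFinite.toFinset,
          ({w | (outside S G).Adj t w}.ncard : ℝ) := by
      exact_mod_cast h1.trans (Nat.add_le_add_left h2 1)
    have h4 : ∑ t ∈ (outsideBall S G r u).toFinite.toFinset,
        ({w | (outside S G).Adj t w}.ncard : ℝ) ≤ (outsideBall S G r u).ncard * D := by
      rw [Set.ncard_eq_toFinset_card _ (Set.toFinite _), ← nsmul_eq_mul]
      refine Finset.sum_le_card_nsmul _ _ _ fun t ht => hdeg t ?_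
      exact ((Set.Finite.mem_toFinset _).1 ht).1
    have h5 := mul_le_mul_of_nonneg_right ih (by linarith : 0 ≤ D)
    rw [pow_succ]
    nlinarith

/-- The event that all degrees outside `S` are at most `D`. -/
def degreeEvent (S : Finset V) (D : ℝ) : Set (Finset (Sym2 V)) :=
  {s | ∀ u ∉ (S : Set V), ({w | (outside (S : Set V) (graph s)).Adj u w}.ncard : ℝ) ≤ D}

/-- The pairs in `T` are pairwise disjoint. -/
def PairwiseDisjointPairs (T : Finset (V × V)) : Prop :=
  ∀ e ∈ T, ∀ e' ∈ T, e ≠ e' → e.1 ≠ e'.1 ∧ e.1 ≠ e'.2 ∧ e.2 ≠ e'.1 ∧ e.2 ≠ e'.2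

/-- Disjoint pairs are uncovered nearly independently: given the graph outside `S`, whether a pair is
uncovered depends only on the edges from that pair to the outside. -/
lemma prob_forall_not_uncovered_le (h0 : 0 ≤ p) (h1 : p ≤ 1) {S : Finset V} {Q : Finset (Sym2 V)}
    {k : ℕ} {D q : ℝ} (hq1 : q ≤ 1) (T : Finset (V × V))
    (hTS : ∀ e ∈ T, e.1 ∈ S ∧ e.2 ∈ S) (hT : PairwiseDisjointPairs T)
    (hstep : ∀ e ∈ T, ∀ s ∈ degreeEvent S D, q * prob p (fiber (pairEdges S e.1 e.2) s) ≤
      prob p (fiber (pairEdges S e.1 e.2) s ∩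
        {t | Uncovered (S : Set V) (Q : Set (Sym2 V)) k e.1 e.2 (graph t)})) :
    prob p (degreeEvent S D ∩
      {s | ∀ e ∈ T, ¬ Uncovered (S : Set V) (Q : Set (Sym2 V)) k e.1 e.2 (graph s)}) ≤
      (1 - q) ^ T.card := by
  induction T using Finset.induction_on with
  | empty => simpa using prob_le_one h0 h1 _
  | insert a T ha ih =>
    have ih' := ih (fun e he => hTS e (Finset.mem_insert_of_mem he))
      (fun e he e' he' => hT e (Finset.mem_insert_of_mem he) e' (Finset.mem_insert_of_mem he'))
      (fun e he => hstep e (Finset.mem_insert_of_mem he))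
    set U : Set (Finset (Sym2 V)) :=
      {t | Uncovered (S : Set V) (Q : Set (Sym2 V)) k a.1 a.2 (graph t)} with hU
    set R := degreeEvent S D ∩
      {s | ∀ e ∈ T, ¬ Uncovered (S : Set V) (Q : Set (Sym2 V)) k e.1 e.2 (graph s)} with hR
    have haS := hTS a (Finset.mem_insert_self _ _)
    have hclosed : ∀ s ∈ R, fiber (pairEdges S a.1 a.2) s ⊆ R := by
      rintro s ⟨hs1, hs2⟩ t ht
      have ho := outside_eq_of_mem_fiber haS.1 haS.2 ht
      refine ⟨fun u hu => ?_, fun e he hcon => hs2 e he ?_⟩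
      · rw [ho]; exact hs1 u hu
      · have heS := hTS e (Finset.mem_insert_of_mem he)
        have hd := hT e (Finset.mem_insert_of_mem he) a (Finset.mem_insert_self _ _)
          (fun h => ha (h ▸ he))
        exact hcon.congr ho
          (fun w _ => adj_iff_of_mem_fiber heS.1 hd.1 hd.2.1 ht)
          (fun w _ => adj_iff_of_mem_fiber heS.2 hd.2.2.1 hd.2.2.2 ht)
    have h := mul_prob_le_prob_inter_of_fiber (p := p) hclosed (U := U) (q := q)
      (fun s hs => hstep a (Finset.mem_insert_self _ _) s hs.1)
    have hsplit := prob_inter_add_prob_inter_compl (p := p) R U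
    have e : degreeEvent S D ∩ {s | ∀ e ∈ insert a T,
        ¬ Uncovered (S : Set V) (Q : Set (Sym2 V)) k e.1 e.2 (graph s)} = R ∩ Uᶜ := by
      ext s
      simp only [hR, hU, Finset.forall_mem_insert, Set.mem_inter_iff, Set.mem_ofPred_eq,
        Set.mem_compl_iff]
      tauto
    rw [e, Finset.card_insert_of_notMem ha, pow_succ']
    have := mul_le_mul_of_nonneg_left ih' (by linarith : 0 ≤ 1 - q)
    linarith

/-- A greedy choice of disjoint pairs outside `Q` among vertices of low query degree. -/
lemma exists_disjoint_pairs (Q : Finset (Sym2 V)) (d m : ℕ) (L : Finset V)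
    (hd : ∀ v ∈ L, queryDegree Q v ≤ d) (hL : 2 * m + d ≤ L.card) :
    ∃ T : Finset (V × V), T.card = m ∧ PairwiseDisjointPairs T ∧
      ∀ e ∈ T, e.1 ∈ L ∧ e.2 ∈ L ∧ e.1 ≠ e.2 ∧ s(e.1, e.2) ∉ Q := by
  induction m generalizing L with
  | zero => exact ⟨∅, rfl, by simp [PairwiseDisjointPairs], by simp⟩
  | succ m ih =>
    obtain ⟨x, hx⟩ : L.Nonempty := Finset.card_pos.1 (by omega)
    obtain ⟨y, hy, hyQ⟩ : ∃ y ∈ L.erase x, s(x, y) ∉ Q := by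
      by_contra hcon
      push Not at hcon
      have : (L.erase x).card ≤ queryDegree Q x :=
        Finset.card_le_card fun y hy => by simpa using hcon y hy
      rw [Finset.card_erase_of_mem hx] at this
      have := hd x hx
      omega
    have hyL := Finset.mem_of_mem_erase hy
    have hyx := Finset.ne_of_mem_erase hy
    obtain ⟨T, hTc, hTd, hT⟩ := ih ((L.erase x).erase y)
      (fun v hv => hd v (Finset.mem_of_mem_erase (Finset.mem_of_mem_erase hv))) (by
        rw [Finset.card_erase_of_mem hy, Finset.card_erase_of_mem hx]; omega)
    have hT' : ∀ e ∈ T, e.1 ≠ x ∧ e.1 ≠ y ∧ e.2 ≠ x ∧ e.2 ≠ y := by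
      intro e he
      have := hT e he
      simp only [Finset.mem_erase] at this
      tauto
    refine ⟨insert (x, y) T, ?_, ?_, ?_⟩
    · rw [Finset.card_insert_of_notMem, hTc]
      exact fun h => (hT' _ h).1 rfl
    · intro e he e' he' hne
      rw [Finset.mem_insert] at he he'
      rcases he with rfl | he <;> rcases he' with rfl | he'
      · exact absurd rfl hne
      · have := hT' e' he'
        exact ⟨this.1.symm, this.2.2.1.symm, this.2.1.symm, this.2.2.2.symm⟩
      · have := hT' e he
        exact ⟨this.1, this.2.1, this.2.2.1, this.2.2.2⟩
      · exact hTd e he e' he' hne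
    · intro e he
      rw [Finset.mem_insert] at he
      rcases he with rfl | he
      · exact ⟨hx, hyL, hyx.symm, hyQ⟩
      · have := hT e he
        exact ⟨Finset.mem_of_mem_erase (Finset.mem_of_mem_erase this.1),
          Finset.mem_of_mem_erase (Finset.mem_of_mem_erase this.2.1), this.2.2⟩

/-- A positive fraction of the vertices has a query degree that is at most slightly above the
average. -/
lemma card_low_queryDegree_ge (Q : Finset (Sym2 V)) {d : ℕ}
    (hd : 2.04 * (Q.card : ℝ) / Fintype.card V ≤ d + 1) :
    (Fintype.card V : ℝ) / 52 ≤ (Finset.univ.filter fun v => queryDegree Q v ≤ d).card := by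
  set n : ℝ := (Fintype.card V : ℝ) with hn
  set B := Finset.univ.filter fun v => ¬ queryDegree Q v ≤ d with hB
  have hsplit : ((Finset.univ.filter fun v => queryDegree Q v ≤ d).card : ℝ) + B.card = n := by
    rw [hn, ← Finset.card_univ, ← Finset.card_filter_add_card_filter_not
      (s := Finset.univ) (fun v => queryDegree Q v ≤ d)]
    push_cast
    rfl
  have h1 : B.card * (d + 1) ≤ 2 * Q.card := by
    rw [← smul_eq_mul]
    refine (Finset.card_nsmul_le_sum B (queryDegree Q) (d + 1) fun v hv => ?_).trans
      ((Finset.sum_le_univ_sum_of_nonneg fun _ => Nat.zero_le _).trans (sum_queryDegree_le Q))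
    simp only [hB, Finset.mem_filter] at hv
    omega
  have h1' : (B.card : ℝ) * (d + 1) ≤ 2 * Q.card := by exact_mod_cast h1
  have hn0 : 0 ≤ n := by positivity
  rcases hn0.eq_or_lt with h0 | h0
  · rw [← h0]; simp
  · have hdpos : (0 : ℝ) < d + 1 := by positivity
    rw [div_le_iff₀ h0] at hd
    have h2 : 1.02 * (B.card : ℝ) ≤ n := by
      have : 1.02 * (B.card : ℝ) * (d + 1) ≤ n * (d + 1) := by linarith
      exact le_of_mul_le_mul_right this hdpos
    have : (0 : ℝ) ≤ B.card := by positivity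
    linarith

/-- The degrees outside `S` are at most `D`, except with the probability given by the Chernoff bound. -/
lemma prob_compl_degreeEvent_le (h0 : 0 ≤ p) (h1 : p ≤ 1) (S : Finset V) {D t : ℝ}
    (ht : 1 ≤ t) : prob p (degreeEvent S D)ᶜ ≤ Fintype.card V *
      Real.exp ((t - 1) * (p * Fintype.card V) - D * Real.log t) := by
  set star : V → Finset (Sym2 V) := fun u => Finset.univ.image fun w => s(u, w) with hstar
  have hsub : (degreeEvent S D)ᶜ ⊆ ⋃ u ∈ (Finset.univ : Finset V),
      {s | ⌈D⌉₊ ≤ (s ∩ star u).card} := by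
    intro s hs
    simp only [degreeEvent, Set.mem_compl_iff, Set.mem_ofPred_eq, not_forall, not_le] at hs
    obtain ⟨u, hu, hs⟩ := hs
    simp only [Set.mem_iUnion]
    refine ⟨u, Finset.mem_univ u, ?_⟩
    have hle : {w | (outside (S : Set V) (graph s)).Adj u w}.ncard ≤ (s ∩ star u).card := by
      rw [← Set.ncard_coe_finset]
      refine Set.ncard_le_ncard_of_injOn (fun w => s(u, w)) ?_ ?_ (Finset.finite_toSet _)
      · intro w hw
        have := graph_adj.1 hw.1
        simp only [hstar, Finset.coe_inter, Set.mem_inter_iff, Finset.mem_coe, Finset.mem_image,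
          Finset.mem_univ, true_and]
        exact ⟨this.1, w, rfl⟩
      · intro w _ w' _ h
        exact Sym2.congr_right.1 h
    refine Nat.ceil_le.2 (hs.le.trans ?_)
    exact_mod_cast hle
  refine (prob_mono h0 h1 hsub).trans ((prob_biUnion_le h0 h1 _ _).trans ?_)
  rw [← nsmul_eq_mul, ← Finset.card_univ]
  refine Finset.sum_le_card_nsmul _ _ _ fun u _ => ?_
  have h := prob_le_card_inter h0 h1 ht (star u) ⌈D⌉₊
  have ht0 : 0 < t := by linarith
  have hpow : Real.exp (D * Real.log t) ≤ t ^ ⌈D⌉₊ := by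
    calc Real.exp (D * Real.log t) ≤ Real.exp (⌈D⌉₊ * Real.log t) :=
          Real.exp_le_exp.2 (mul_le_mul_of_nonneg_right (Nat.le_ceil D) (Real.log_nonneg ht))
      _ = t ^ ⌈D⌉₊ := by rw [Real.exp_nat_mul, Real.exp_log ht0]
  have hstarc : ((star u).card : ℝ) ≤ Fintype.card V := by
    have : (star u).card ≤ Fintype.card V := Finset.card_image_le.trans (by simp)
    exact_mod_cast this
  rw [Real.exp_sub, le_div_iff₀ (Real.exp_pos _), mul_comm]
  refine (mul_le_mul_of_nonneg_right hpow (prob_nonneg h0 h1 _)).trans (h.trans ?_)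
  refine Real.exp_le_exp.2 (mul_le_mul_of_nonneg_left ?_ (by linarith))
  exact mul_le_mul_of_nonneg_left hstarc h0

end RandomSubset

namespace RandomSubset

/-! ### Few queries when a typical distance is `k + 2` -/

lemma eventually_le_rpow (C : ℝ) {c : ℝ} (hc : 0 < c) : ∀ᶠ n : ℕ in atTop, C ≤ (n : ℝ) ^ c := by
  simpa using eventually_mul_log_pow_le C 0 hc

lemma exp_half_le : Real.exp (1 / 2) ≤ 1.65 := by
  refine le_of_pow_le_pow_left₀ (n := 2) (by norm_num) (by norm_num) ?_
  rw [← Real.exp_nat_mul]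
  have := Real.exp_one_lt_d9
  norm_num at this ⊢
  linarith

lemma one_add_div_pow_le {k : ℕ} (hk : 1 ≤ k) : (1 + 0.01 / (k : ℝ)) ^ k ≤ 1.0102 := by
  have hk' : (0 : ℝ) < k := by exact_mod_cast hk
  have h1 : 1 + 0.01 / (k : ℝ) ≤ Real.exp (0.01 / k) := by
    rw [add_comm]; exact Real.add_one_le_exp _
  refine (pow_le_pow_left₀ (by positivity) h1 k).trans ?_
  rw [← Real.exp_nat_mul, mul_div_cancel₀ _ hk'.ne']
  have h2 := Real.add_one_le_exp (-0.01)
  rw [Real.exp_neg, le_inv_comm₀ (by norm_num) (Real.exp_pos _)] at h2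
  refine h2.trans ?_
  norm_num

lemma eventually_prob_compl_degreeEvent_le {c δ : ℝ} (hc : 0 < c) (hδ : 0 < δ) :
    ∀ᶠ n : ℕ in atTop, ∀ p : ℝ, 0 < p → p ≤ 1 → (n : ℝ) ^ c ≤ n * p → ∀ S : Finset (Fin n),
      prob p (degreeEvent S ((1 + δ) * (n * p)))ᶜ ≤ 1 / 100 := by
  have hγ : 0 < (1 + δ) * Real.log (1 + δ) - δ := by
    have h := Real.le_log_one_add_of_nonneg hδ.le
    have h2 : (1 + δ) * (2 * δ / (δ + 2)) ≤ (1 + δ) * Real.log (1 + δ) :=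
      mul_le_mul_of_nonneg_left h (by linarith)
    have h3 : δ < (1 + δ) * (2 * δ / (δ + 2)) := by
      rw [← mul_div_assoc, lt_div_iff₀ (by linarith)]; nlinarith
    linarith
  set γ := (1 + δ) * Real.log (1 + δ) - δ
  filter_upwards [eventually_mul_log_pow_le (6 / γ) 1 hc, eventually_le_log 1,
    eventually_ge_atTop 1] with n hlog hl hn1 p h0 h1 hX S
  have hn : (0 : ℝ) < n := by exact_mod_cast hn1
  refine (prob_compl_degreeEvent_le h0.le h1 S (t := 1 + δ) (by linarith)).trans ?_
  rw [Fintype.card_fin]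
  have e : (1 + δ - 1) * (p * n) - (1 + δ) * (n * p) * Real.log (1 + δ) = -(γ * (n * p)) := by
    ring
  rw [e]
  nth_rw 1 [← Real.exp_log hn]
  rw [← Real.exp_add]
  refine le_trans (Real.exp_le_exp.2 ?_) exp_neg_five_le
  have h2 := hlog.trans hX
  rw [pow_one, div_mul_eq_mul_div, div_le_iff₀ hγ] at h2
  linarith

lemma Regime.pow_div_le {k n : ℕ} {c p : ℝ} (hR : Regime k c n p) (hn : 0 < n)
    (hlam : (n : ℝ) ^ k * p ^ (k + 1) ≤ 1) :
    ((n : ℝ) * p) ^ k / n ≤ ((n : ℝ) ^ (1 / ((k : ℝ) + 1)))⁻¹ := by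
  have hn' : (0 : ℝ) < n := by exact_mod_cast hn
  have hX : (n : ℝ) * p ≤ (n : ℝ) ^ (1 / ((k : ℝ) + 1)) := by
    have e1 : (1 : ℝ) / ((k : ℝ) + 1) = ((k + 1 : ℕ) : ℝ)⁻¹ := by push_cast; rw [one_div]
    refine le_of_pow_le_pow_left₀ (n := k + 1) (by omega) (by positivity) ?_
    rw [e1, Real.rpow_inv_natCast_pow hn'.le (by omega), hR.mul_pow]
    exact mul_le_of_le_one_right hn'.le hlam
  set y := (n : ℝ) ^ (1 / ((k : ℝ) + 1)) with hy
  have hy0 : 0 < y := by positivity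
  have hyn : y ^ (k + 1) = n := by
    have e1 : (1 : ℝ) / ((k : ℝ) + 1) = ((k + 1 : ℕ) : ℝ)⁻¹ := by push_cast; rw [one_div]
    rw [hy, e1, Real.rpow_inv_natCast_pow hn'.le (by omega)]
  have hp := hR.pos
  rw [div_le_iff₀ hn']
  calc ((n : ℝ) * p) ^ k ≤ y ^ k := pow_le_pow_left₀ (by positivity) hX k
    _ = y⁻¹ * n := by rw [eq_inv_mul_iff_mul_eq₀ hy0.ne', ← pow_succ', hyn]

/-- The exponent in the lower bound for the conditional probability that a pair is uncovered. -/
lemma covering_exponent_le {k n : ℕ} (hk : 1 ≤ k) {p q l lam a b : ℝ} (hn : 0 < n) (hp : 0 < p)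
    (hlam : lam < 1 / 2) (hl : 0 ≤ l)
    (hq : q ≤ (n : ℝ) ^ 2 * Real.exp lam * l / (8 * ((k : ℝ) + 1) ^ 2 * ((n : ℝ) * p) ^ k))
    (ha : a ≤ 2.04 * q / n) (hb : b ≤ 2.04 * q / n) (hq0 : 0 ≤ q) :
    1.01 * ((k - 1 : ℕ) * (2 * q) * (1.0306 * (((n : ℝ) * p) ^ k / n ^ 2)) +
      (a + b) * (1.0204 * (((n : ℝ) * p) ^ k / n))) ≤ 0.45 * (1 / ((k : ℝ) + 1)) * l := by
  have hn' : (0 : ℝ) < n := by exact_mod_cast hn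
  have hk' : (1 : ℝ) ≤ k := by exact_mod_cast hk
  set Y := ((n : ℝ) * p) ^ k with hY
  have hY0 : 0 < Y := by positivity
  set Θ := q * Y / (n : ℝ) ^ 2 with hΘ
  have hΘ0 : 0 ≤ Θ := by positivity
  have hΘle : Θ ≤ 1.65 * l / (8 * ((k : ℝ) + 1) ^ 2) := by
    have h1 : Θ ≤ Real.exp lam * l / (8 * ((k : ℝ) + 1) ^ 2) := by
      rw [hΘ, div_le_iff₀ (by positivity)]
      calc q * Y ≤ (n : ℝ) ^ 2 * Real.exp lam * l / (8 * ((k : ℝ) + 1) ^ 2 * Y) * Y :=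
            mul_le_mul_of_nonneg_right hq hY0.le
        _ = _ := by field_simp
    refine h1.trans (div_le_div_of_nonneg_right (mul_le_mul_of_nonneg_right ?_ hl) (by positivity))
    exact (Real.exp_le_exp.2 hlam.le).trans exp_half_le
  have h2 : (a + b) * (1.0204 * (Y / n)) ≤ 4.08 * 1.0204 * Θ := by
    calc (a + b) * (1.0204 * (Y / n)) ≤ (2.04 * q / n + 2.04 * q / n) * (1.0204 * (Y / n)) :=
          mul_le_mul_of_nonneg_right (by linarith) (by positivity)
      _ = _ := by rw [hΘ]; field_simp; ring
  have h3 : (k - 1 : ℕ) * (2 * q) * (1.0306 * (Y / n ^ 2)) = (k - 1 : ℝ) * (2 * 1.0306) * Θ := by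
    rw [hΘ, Nat.cast_sub hk]; push_cast; field_simp
  rw [h3]
  have h4 : 1.01 * ((k - 1 : ℝ) * (2 * 1.0306) * Θ + 4.08 * 1.0204 * Θ) ≤ 2.13 * (k + 1) * Θ := by
    nlinarith
  calc _ ≤ 2.13 * (k + 1) * Θ := by linarith
    _ ≤ 2.13 * (k + 1) * (1.65 * l / (8 * ((k : ℝ) + 1) ^ 2)) :=
        mul_le_mul_of_nonneg_left hΘle (by positivity)
    _ = (2.13 * 1.65 / 8) * (1 / ((k : ℝ) + 1)) * l := by field_simp
    _ ≤ _ := by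
        refine mul_le_mul_of_nonneg_right (mul_le_mul_of_nonneg_right (by norm_num) ?_) hl
        positivity

/-- There are polynomially many disjoint pairs, not in `Q`, of vertices of low query degree. -/
lemma eventually_exists_disjoint_pairs (k : ℕ) (hk : 1 ≤ k) {c : ℝ} (hc : 0 < c) :
    ∀ᶠ n : ℕ in atTop, ∀ p : ℝ, Regime k c n p → ∀ Q : Finset (Sym2 (Fin n)), FewQueries k n p Q →
      ∃ T : Finset (Fin n × Fin n), T.card = ⌊(n : ℝ) ^ (0.48 * (1 / ((k : ℝ) + 1)))⌋₊ ∧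
        PairwiseDisjointPairs T ∧ ∀ e ∈ T, e.1 ≠ e.2 ∧ s(e.1, e.2) ∉ Q ∧
          (queryDegree Q e.1 : ℝ) ≤ 2.04 * Q.card / n ∧
          (queryDegree Q e.2 : ℝ) ≤ 2.04 * Q.card / n := by
  filter_upwards [eventually_ge_atTop 1, eventually_mul_log_pow_le 100 1 hc, eventually_le_log 0,
    eventually_le_rpow 400 (c := 1 / 2) (by norm_num)] with n hn1 hlog hl hroot p hR Q hQ
  have hn : (0 : ℝ) < n := by exact_mod_cast hn1
  have hn1' : (1 : ℝ) ≤ n := by exact_mod_cast hn1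
  have hk' : (1 : ℝ) ≤ k := by exact_mod_cast hk
  have hX1 : 1 ≤ (n : ℝ) * p := (Real.one_le_rpow hn1' hc.le).trans hR.rpow_le
  have hXk : (n : ℝ) * p ≤ ((n : ℝ) * p) ^ k := le_self_pow₀ hX1 (by omega)
  set m := ⌊(n : ℝ) ^ (0.48 * (1 / ((k : ℝ) + 1)))⌋₊ with hm
  set d := ⌊2.04 * (Q.card : ℝ) / n⌋₊ with hd
  have hd0 : (0 : ℝ) ≤ 2.04 * (Q.card : ℝ) / n := by positivity
  have hdle : (d : ℝ) ≤ 2.04 * (Q.card : ℝ) / n := Nat.floor_le hd0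
  have hQn : (Q.card : ℝ) ≤ n ^ 2 / 200 := by
    refine hQ.trans ?_
    rw [mul_assoc, mul_div_assoc, ← mul_one_div ((n : ℝ) ^ 2) 200]
    refine mul_le_mul_of_nonneg_left ?_ (by positivity)
    rw [div_le_iff₀ (by positivity)]
    set lam := (n : ℝ) ^ k * p ^ (k + 1)
    have h2 : 100 * (Real.exp lam * Real.log n) ≤ n * p := by
      refine le_trans ?_ hR.exp_mul_le
      rw [pow_one] at hlog
      nlinarith [Real.exp_pos lam]
    have h3 : (8 : ℝ) ≤ 8 * ((k : ℝ) + 1) ^ 2 := by nlinarith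
    have h4 : 8 * ((n : ℝ) * p) ≤ 8 * ((k : ℝ) + 1) ^ 2 * ((n : ℝ) * p) ^ k :=
      mul_le_mul h3 hXk (by linarith) (by positivity)
    linarith
  have hdn : (d : ℝ) ≤ n / 90 := by
    refine hdle.trans ?_
    rw [div_le_iff₀ hn]
    nlinarith
  have hmn : (m : ℝ) ≤ n / 400 := by
    refine (Nat.floor_le (by positivity)).trans ?_
    have h1 : (n : ℝ) ^ (0.48 * (1 / ((k : ℝ) + 1))) ≤ (n : ℝ) ^ ((1 : ℝ) / 2) := by
      refine Real.rpow_le_rpow_of_exponent_le hn1' ?_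
      have : 1 / ((k : ℝ) + 1) ≤ 1 := by rw [div_le_one (by positivity)]; linarith
      linarith
    have h2 : (n : ℝ) ^ ((1 : ℝ) / 2) * (n : ℝ) ^ ((1 : ℝ) / 2) = n := by
      rw [← Real.rpow_add hn]; norm_num
    nlinarith
  have hlow := card_low_queryDegree_ge Q (d := d) (by
    rw [Fintype.card_fin]; exact (Nat.lt_floor_add_one _).le)
  rw [Fintype.card_fin] at hlow
  set L := Finset.univ.filter fun v => queryDegree Q v ≤ d with hL
  have hdeg : ∀ v ∈ L, queryDegree Q v ≤ d := fun v hv => by simpa [hL] using hv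
  have hcast : ((2 * m + d : ℕ) : ℝ) ≤ L.card := by
    push_cast
    linarith
  obtain ⟨T, hTc, hTd, hT⟩ := exists_disjoint_pairs Q d m L hdeg (by exact_mod_cast hcast)
  have hdeg' : ∀ v ∈ L, (queryDegree Q v : ℝ) ≤ 2.04 * Q.card / n := fun v hv =>
    le_trans (by exact_mod_cast hdeg v hv) hdle
  exact ⟨T, hTc, hTd, fun e he => ⟨(hT e he).2.2.1, (hT e he).2.2.2, hdeg' _ (hT e he).1,
    hdeg' _ (hT e he).2.1⟩⟩

/-- Few vertices are far apart from each other with high probability. -/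
lemma eventually_prob_exists_near_le (k : ℕ) {c : ℝ} (hc : 0 < c) :
    ∀ᶠ n : ℕ in atTop, ∀ p : ℝ, Regime k c n p → (n : ℝ) ^ k * p ^ (k + 1) ≤ 1 →
      ∀ S : Finset (Fin n), (S.card : ℝ) ≤ 2 * (n : ℝ) ^ (0.48 * (1 / ((k : ℝ) + 1))) →
      prob p {s : Finset (Sym2 (Fin n)) | ¬ ∀ x ∈ (S : Set (Fin n)), ∀ y ∈ (S : Set (Fin n)), y ≠ x →
        (k : ℕ∞) < (graph s).edist x y} ≤ 1 / 100 := by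
  filter_upwards [eventually_ge_atTop 1,
    eventually_le_rpow (400 * k) (c := 0.04 * (1 / ((k : ℝ) + 1))) (by positivity)]
    with n hn1 hbig p hR hlam S hS
  have hn : (0 : ℝ) < n := by exact_mod_cast hn1
  set κ := 1 / ((k : ℝ) + 1) with hκ
  have hsub : {s : Finset (Sym2 (Fin n)) | ¬ ∀ x ∈ (S : Set (Fin n)), ∀ y ∈ (S : Set (Fin n)),
      y ≠ x → (k : ℕ∞) < (graph s).edist x y} ⊆ ⋃ e ∈ S.offDiag,
        {s | (graph s).edist e.1 e.2 ≤ k} := by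
    intro s hs
    simp only [Set.mem_ofPred_eq, not_forall, not_lt] at hs
    obtain ⟨x, hx, y, hy, hyx, h⟩ := hs
    simp only [Set.mem_iUnion]
    exact ⟨(x, y), Finset.mem_offDiag.2 ⟨hx, hy, hyx.symm⟩, h⟩
  refine (prob_mono hR.pos.le hR.lt_one.le hsub).trans
    ((prob_biUnion_le hR.pos.le hR.lt_one.le _ _).trans
      ((Finset.sum_le_card_nsmul _ _ (k * (((n : ℝ) * p) ^ k / n)) fun e he => ?_).trans ?_))
  · exact hR.prob_edist_le hc.le (Finset.mem_offDiag.1 he).2.2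
  rw [nsmul_eq_mul]
  have h1 : (S.offDiag.card : ℝ) ≤ 4 * (n : ℝ) ^ (0.96 * κ) := by
    have : S.offDiag.card ≤ S.card * S.card := by
      rw [Finset.offDiag_card]; omega
    have h' : (S.offDiag.card : ℝ) ≤ S.card * S.card := by exact_mod_cast this
    refine h'.trans ((mul_le_mul hS hS (Nat.cast_nonneg _) (by positivity)).trans (le_of_eq ?_))
    have : (n : ℝ) ^ (0.96 * κ) = (n : ℝ) ^ (0.48 * κ) * (n : ℝ) ^ (0.48 * κ) := by
      rw [← Real.rpow_add hn]; congr 1; ring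
    rw [this]; ring
  have h2 := hR.pow_div_le hn1 hlam
  rw [← hκ] at h2
  have hp := hR.pos
  calc (S.offDiag.card : ℝ) * (k * (((n : ℝ) * p) ^ k / n))
      ≤ 4 * (n : ℝ) ^ (0.96 * κ) * (k * ((n : ℝ) ^ κ)⁻¹) :=
        mul_le_mul h1 (mul_le_mul_of_nonneg_left h2 (by positivity)) (by positivity) (by positivity)
    _ = 4 * k * ((n : ℝ) ^ (0.04 * κ))⁻¹ := by
        have e : (n : ℝ) ^ κ = (n : ℝ) ^ (0.96 * κ) * (n : ℝ) ^ (0.04 * κ) := by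
          rw [← Real.rpow_add hn]; congr 1; ring
        rw [e]
        have : (n : ℝ) ^ (0.96 * κ) ≠ 0 := by positivity
        field_simp
    _ ≤ 1 / 100 := by
        rw [← div_eq_mul_inv, div_le_div_iff₀ (by positivity) (by norm_num)]
        linarith

/-- The case `n^k p^(k+1) < 1/2`: among polynomially many disjoint pairs of vertices, one is
uncovered. -/
theorem eventually_prob_reconstructs_le_of_lt_half (k : ℕ) (hk : 1 ≤ k) {c : ℝ} (hc : 0 < c) :
    ∀ᶠ n : ℕ in atTop, ∀ p : ℝ, Regime k c n p → (n : ℝ) ^ k * p ^ (k + 1) < 1 / 2 →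
      ∀ Q : Finset (Sym2 (Fin n)), (∀ e ∈ Q, ¬ e.IsDiag) → FewQueries k n p Q →
      prob p {s : Finset (Sym2 (Fin n)) | Reconstructs (Q : Set (Sym2 (Fin n))) (graph s)} ≤
        9 / 10 := by
  have hk' : (1 : ℝ) ≤ k := by exact_mod_cast hk
  have hκ0 : 0 < 1 / ((k : ℝ) + 1) := by positivity
  set κ := 1 / ((k : ℝ) + 1) with hκ
  filter_upwards [eventually_prob_exists_far_le k hk hc,
    eventually_prob_compl_degreeEvent_le hc (δ := 0.01 / k) (by positivity),
    eventually_exists_disjoint_pairs k hk hc, eventually_prob_exists_near_le k hc,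
    eventually_ge_atTop 1, eventually_le_log 0, eventually_le_rpow 101 hc,
    eventually_le_rpow 400 hκ0, eventually_le_rpow 6 (c := 0.03 * κ) (by positivity)]
    with n hfar hdegree hpairs hnear hn1 hl hbig hκbig hmbig p hR hlam Q hQ hcard
  have hn : (0 : ℝ) < n := by exact_mod_cast hn1
  have hn1' : (1 : ℝ) ≤ n := by exact_mod_cast hn1
  have h0 := hR.pos.le
  have h1 := hR.lt_one.le
  have hp := hR.pos
  obtain ⟨T, hTc, hTd, hT⟩ := hpairs p hR Q hcard
  set m := ⌊(n : ℝ) ^ (0.48 * κ)⌋₊ with hm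
  set S := T.image Prod.fst ∪ T.image Prod.snd with hS
  have hTS : ∀ e ∈ T, e.1 ∈ S ∧ e.2 ∈ S := fun e he =>
    ⟨Finset.mem_union_left _ (Finset.mem_image_of_mem _ he),
      Finset.mem_union_right _ (Finset.mem_image_of_mem _ he)⟩
  have hScard : (S.card : ℝ) ≤ 2 * (n : ℝ) ^ (0.48 * κ) := by
    have h2 : S.card ≤ m + m := by
      rw [← hTc]
      exact (Finset.card_union_le _ _).trans (add_le_add Finset.card_image_le Finset.card_image_le)
    have h3 : (m : ℝ) ≤ (n : ℝ) ^ (0.48 * κ) := Nat.floor_le (by positivity)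
    have h4 : (S.card : ℝ) ≤ m + m := by exact_mod_cast h2
    linarith
  set δ := 0.01 / (k : ℝ) with hδ
  set D := (1 + δ) * ((n : ℝ) * p) with hD
  have hδ0 : 0 < δ := by positivity
  have hX := hR.rpow_le
  have hD101 : 101 ≤ D := by
    rw [hD]; nlinarith
  set q := Real.exp (-(0.45 * κ * Real.log n)) with hq
  have hq0 : 0 < q := Real.exp_pos _
  have hq1 : q ≤ 1 := Real.exp_le_one_iff.2 (by
    have : 0 ≤ 0.45 * κ * Real.log n := by positivity
    linarith)
  set Y := ((n : ℝ) * p) ^ k with hY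
  have hY0 : 0 < Y := by positivity
  have hYn : Y / n ≤ 1 / 400 := by
    refine (hR.pow_div_le hn1 (by linarith)).trans ?_
    rw [← hκ, inv_eq_one_div]
    exact one_div_le_one_div_of_le (by norm_num) hκbig
  have hδk := one_add_div_pow_le hk
  rw [← hδ] at hδk
  have hDpow : ∀ j ≤ k, D ^ j * (n * p) ^ (k - j) ≤ 1.0102 * Y := by
    intro j hj
    have e : D ^ j * (n * p) ^ (k - j) = (1 + δ) ^ j * Y := by
      rw [hD, mul_pow, mul_assoc, ← pow_add, Nat.add_sub_cancel' hj]
    rw [e]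
    refine mul_le_mul_of_nonneg_right (le_trans ?_ hδk) hY0.le
    exact pow_le_pow_right₀ (by linarith) hj
  have hstep : ∀ e ∈ T, ∀ s ∈ degreeEvent S D, q * prob p (fiber (pairEdges S e.1 e.2) s) ≤
      prob p (fiber (pairEdges S e.1 e.2) s ∩
        {t | Uncovered (S : Set (Fin n)) (Q : Set (Sym2 (Fin n))) k e.1 e.2 (graph t)}) := by
    intro e he s hs
    have heT := hT e he
    refine le_trans (mul_le_mul_of_nonneg_right ?_ (prob_nonneg h0 h1 _))
      (exp_mul_prob_fiber_le h0 h1 (hTS e he).1 (hTS e he).2 heT.1 (β := fun r => 1.01 * D ^ r)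
        (fun u _ r => ncard_outsideBall_le hD101 hs u r)
        (z₁ := 1.0306 * (Y / n ^ 2)) (z₂ := 1.0204 * (Y / n)) ?_ ?_ (by positivity) (by positivity)
        ?_ ?_)
    · refine Real.exp_le_exp.2 (neg_le_neg ?_)
      exact covering_exponent_le hk hn1 hp hlam hl hcard heT.2.2.1 heT.2.2.2 (Nat.cast_nonneg _)
    · intro a ha
      have h2 := hDpow (k - 2) (by omega)
      have e2 : k - (k - 2) = 2 := by omega
      rw [e2] at h2
      have e3 : D ^ (k - 2) = D ^ a * D ^ (k - 2 - a) := by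
        rw [← pow_add]; congr 1; omega
      rw [← mul_div_assoc, le_div_iff₀ (by positivity)]
      calc 1.01 * D ^ a * (1.01 * D ^ (k - 2 - a)) * p ^ 2 * n ^ 2
          = 1.0201 * (D ^ (k - 2) * (n * p) ^ 2) := by rw [e3]; ring
        _ ≤ 1.0201 * (1.0102 * Y) := mul_le_mul_of_nonneg_left h2 (by norm_num)
        _ ≤ 1.0306 * Y := by linarith
    · have h2 := hDpow (k - 1) (by omega)
      have e2 : k - (k - 1) = 1 := by omega
      rw [e2, pow_one] at h2
      rw [← mul_div_assoc, le_div_iff₀ hn]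
      calc 1.01 * D ^ (k - 1) * p * n = 1.01 * (D ^ (k - 1) * (n * p)) := by ring
        _ ≤ 1.01 * (1.0102 * Y) := mul_le_mul_of_nonneg_left h2 (by norm_num)
        _ ≤ 1.0204 * Y := by linarith
    · have : Y / (n : ℝ) ^ 2 ≤ Y / n := by
        refine div_le_div_of_nonneg_left hY0.le hn ?_
        exact le_self_pow₀ hn1' (by norm_num)
      linarith
    · linarith
  have P1 := prob_forall_not_uncovered_le (Q := Q) (k := k) h0 h1 hq1 T hTS hTd hstep
  have P2 := hfar p hR Q hQ hcard
  have P3 := hdegree p hp h1 hX S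
  have P4 := hnear p hR (by linarith) S hScard
  have P1' : (1 - q) ^ T.card ≤ 1 / 100 := by
    have h2 : 1 - q ≤ Real.exp (-q) := by linarith [Real.add_one_le_exp (-q)]
    refine (pow_le_pow_left₀ (by linarith) h2 _).trans ?_
    rw [← Real.exp_nat_mul, hTc]
    refine (Real.exp_le_exp.2 ?_).trans exp_neg_five_le
    have h3 : (n : ℝ) ^ (0.48 * κ) ≤ m + 1 := (Nat.lt_floor_add_one _).le
    have h4 : (n : ℝ) ^ (0.48 * κ) * q = (n : ℝ) ^ (0.03 * κ) := by
      rw [hq, Real.rpow_def_of_pos hn, Real.rpow_def_of_pos hn, ← Real.exp_add]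
      congr 1; ring
    have h5 := mul_le_mul_of_nonneg_right h3 hq0.le
    linarith
  have hsub : {s : Finset (Sym2 (Fin n)) | Reconstructs (Q : Set (Sym2 (Fin n))) (graph s)} ⊆
      ((degreeEvent S D ∩ {s | ∀ e ∈ T,
        ¬ Uncovered (S : Set (Fin n)) (Q : Set (Sym2 (Fin n))) k e.1 e.2 (graph s)}) ∪
        {s | ¬ ∀ e ∈ Q, pairDist (graph s) e ≤ (k + 2 : ℕ)}) ∪ ((degreeEvent S D)ᶜ ∪
        {s | ¬ ∀ x ∈ (S : Set (Fin n)), ∀ y ∈ (S : Set (Fin n)), y ≠ x →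
          (k : ℕ∞) < (graph s).edist x y}) := by
    intro s hs
    by_cases c2 : ∀ e ∈ Q, pairDist (graph s) e ≤ (k + 2 : ℕ)
    swap
    · exact Or.inl (Or.inr c2)
    by_cases c3 : s ∈ degreeEvent S D
    swap
    · exact Or.inr (Or.inl c3)
    by_cases c4 : ∀ x ∈ (S : Set (Fin n)), ∀ y ∈ (S : Set (Fin n)), y ≠ x →
          (k : ℕ∞) < (graph s).edist x y
    swap
    · exact Or.inr (Or.inr c4)
    refine Or.inl (Or.inl ⟨c3, fun e he hunc => ?_⟩)
    exact hunc.not_reconstructs hk (hTS e he).1 (hTS e he).2 (hT e he).1 (hT e he).2.1 c4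
      (fun u v huv => c2 _ huv) hs
  have htot := (prob_mono h0 h1 hsub).trans ((prob_union_le h0 h1 _ _).trans
    (add_le_add (prob_union_le h0 h1 _ _) (prob_union_le h0 h1 _ _)))
  linarith

end RandomSubset

theorem theorem4 (k : ℕ) (hk : 1 ≤ k) (ε : ℝ) (hε : 0 < ε) (hεk : ε < 1 / ((k : ℝ) + 1))
    (w : ℕ → ℝ) (hw : Tendsto w atTop atTop) (p : ℕ → I)
    (hp : ∀ᶠ n : ℕ in atTop,
      (p n : ℝ) = ((2 * Real.log n + w n) / (n : ℝ) ^ (k + 1)) ^ (1 / ((k : ℝ) + 2)))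
    (hp_lt : ∀ᶠ n : ℕ in atTop,
      (p n : ℝ) <
        ((1 / ((k : ℝ) + 1) - ε) * (Real.log n / (n : ℝ) ^ k)) ^ (1 / ((k : ℝ) + 1))) :
    ¬ ∃ Q : (n : ℕ) → Finset (Sym2 (Fin n)),
      (∀ n : ℕ, ∀ e ∈ Q n, ¬ e.IsDiag) ∧
      (∀ᶠ n : ℕ in atTop,
        ((Q n).card : ℝ) ≤
          1 / (8 * ((k : ℝ) + 1) ^ 2 * (n : ℝ) ^ ((k : ℤ) - 2) * (p n : ℝ) ^ k) *
            Real.exp ((n : ℝ) ^ k * (p n : ℝ) ^ (k + 1)) * Real.log n) ∧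
      WithHighProbability p (fun n => {G | Reconstructs (Q n : Set (Sym2 (Fin n))) G}) := by
  rintro ⟨Q, hQ, hcard, hwhp⟩
  obtain ⟨c, hc, hc1, hR⟩ := RandomSubset.exists_regime k hk ε hε hεk w hw p hp hp_lt
  have hlim : Tendsto (fun n : ℕ => (SimpleGraph.binomialRandom (Fin n) (p n)
      {G | Reconstructs (Q n : Set (Sym2 (Fin n))) G}).toReal) atTop (𝓝 1) := by
    have h := (ENNReal.tendsto_toReal ENNReal.one_ne_top).comp hwhp
    rwa [ENNReal.toReal_one] at h
  obtain ⟨n, hRn, hcn, hgt, hdense, hsparse, hn⟩ := (hR.and (hcard.and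
    ((hlim.eventually_const_lt (by norm_num : (9 / 10 : ℝ) < 1)).and
      ((RandomSubset.eventually_prob_reconstructs_le_of_half_le k hk hc hc1).and
        ((RandomSubset.eventually_prob_reconstructs_le_of_lt_half k hk hc).and
          (eventually_gt_atTop 0)))))).exists
  rw [RandomSubset.binomialRandom_toReal] at hgt
  have hfew := RandomSubset.fewQueries_of_card_le hRn.pos hn hcn
  rcases le_or_gt (1 / 2) ((n : ℝ) ^ k * (p n : ℝ) ^ (k + 1)) with h | h
  · exact absurd hgt (not_lt.2 (hdense (p n) hRn h (Q n) (hQ n) hfew))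
  · exact absurd hgt (not_lt.2 (hsparse (p n) hRn h (Q n) (hQ n) hfew))
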